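/- Let $0<\alpha<1$, $a>0$, $\varepsilon\ge 0$, and let $g$ be locally integrable on $[0,\infty)$. Let $D^\alpha_t h(t)=\frac{1}{\Gamma(1-\alpha)}\int_0^t (t-\tau)^{-\alpha}h'(\tau)\,d\tau$ be the Caputo derivative. Consider the linear fractional advection problem $$\frac{\partial u}{\partial t}+a\frac{\partial u}{\partial x}+\varepsilon D^\alpha_t u=\delta(x)\,g(t)\quad (x\in\mathbb R,\ t>0),\qquad u(x,0)=0,$$ understood in the sense of distributions: $u$ is locally integrable on $\mathbb R\times[0,\infty)$ and, for every $\varphi\in C_c^\infty(\mathbb R^2)$ (not required to vanish at $t=0$), $$\int_0^\infty\!\!\int_{\mathbb R}u\,\bigl(-\partial_t\varphi-a\,\partial_x\varphi+\varepsilon D^{\alpha}_-\varphi\bigr)\,dx\,dt=\int_0^\infty g(t)\varphi(0,t)\,dt,\qquad D^\alpha_-\varphi(x,t)=\frac{-1}{\Gamma(1-\alpha)}\int_t^\infty(s-t)^{-\alpha}\partial_s\varphi(x,s)\,ds .$$ For $y>0$ let $h_\alpha(y,\cdot)$ be the inverse Laplace transform of $s\mapsto e^{-y s^\alpha}$ (principal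 branch), given by the Bromwich integral $h_\alpha(y,t)=\frac1{2\pi i}\int_{1-i\infty}^{1+i\infty}e^{st-ys^\alpha}ds$; for $y=0$ it is the Dirac mass at $t=0$. Then: 1. The problem has a solution, and it is unique up to a null set of $\mathbb R\times(0,\infty)$. It vanishes for $x\le 0$, and for $x>0$ $$u(x,t)=\frac1a\,\Bigl(h_\alpha\Bigl(\frac{\varepsilon x}{a},\cdot\Bigr)*g\Bigr)\Bigl(t-\frac xa\Bigr),$$ where $(h*g)(t)=\int_0^t h(\tau)g(t-\tau)\,d\tau$ for $t\ge0$ and $(h*g)(t)=0$ for $t<0$ (so $u(x,t)=\frac1a g(t-\frac xa)$ for $t\ge \frac xa$ when $\varepsilon=0$). 2. For every $y>0$ and $\operatorname{Re}s>0$, the function $e^{-st}h_\alpha(y,t)$ is integrable on $(0,\infty)$ and $\int_0^\infty e^{-st}h_\alpha(y,t)\,dt=e^{-ys^\alpha}$. 3. For all $y,t>0$, $$h_{1/3}(y,t)=\frac{y}{3^{1/3}t^{4/3}}\,\mathrm{Ai}\Bigl(\frac{y}{3^{1/3}t^{1/3}}\Bigr),\qquad h_{1/2}(y,t)=\frac{y}{2\sqrt\pi\,t^{3/2}}\,e^{-y^2/(4t)},$$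 where $\mathrm{Ai}(x)=\frac{1}{2\pi i}\int_{1-i\infty}^{1+i\infty}e^{v^3/3-xv}\,dv$ is the Airy function. -/

import Mathlib

open MeasureTheory Set
open scoped ContDiff

noncomputable section

namespace FracAdvection

/-- Caputo derivative of order `α` of a function `h` of time:
`D^α h (t) = 1/Γ(1-α) ∫_0^t (t-τ)^(-α) h'(τ) dτ`. -/
def caputoDeriv (α : ℝ) (h : ℝ → ℝ) (t : ℝ) : ℝ :=
  (1 / Real.Gamma (1 - α)) * ∫ τ in (0 : ℝ)..t, (t - τ) ^ (-α) * deriv h τ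

/-- Formal adjoint of the Caputo derivative, acting on test functions:
`-1/Γ(1-α) ∫_t^∞ (s-t)^(-α) φ'(s) ds`. It is the transpose of the distributional operator
`h ↦ (t_+^(-α)/Γ(1-α)) * dh/dt` on causal `h`; see `integral_caputoDeriv_mul`. -/
def caputoAdjoint (α : ℝ) (φ : ℝ → ℝ) (t : ℝ) : ℝ :=
  -((1 / Real.Gamma (1 - α)) * ∫ s in Ioi t, (s - t) ^ (-α) * deriv φ s)

theorem integrable_dom (α T C : ℝ) (hα : α < 1) (F : ℝ × ℝ → ℝ)
    (hm : AEStronglyMeasurable F ((volume.restrict (Ioi 0)).prod (volume.restrict (Ioi 0))))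
    (hF : ∀ t r, 0 < t → 0 < r →
      |F (t, r)| ≤ (Ioc (0 : ℝ) T).indicator (fun _ => C) t *
        (Ioc (0 : ℝ) T).indicator (fun r => r ^ (-α)) r) :
    Integrable F ((volume.restrict (Ioi 0)).prod (volume.restrict (Ioi 0))) := by
  have h1 : Integrable ((Ioc (0 : ℝ) T).indicator (fun _ => C)) (volume.restrict (Ioi 0)) := by
    refine Integrable.restrict ?_
    rw [integrable_indicator_iff measurableSet_Ioc]
    simp
  have h2 : Integrable ((Ioc (0 : ℝ) T).indicator (fun r => r ^ (-α)))
      (volume.restrict (Ioi 0)) := by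
    refine Integrable.restrict ?_
    rw [integrable_indicator_iff measurableSet_Ioc]
    rcases le_or_gt 0 T with hT | hT
    · rw [← intervalIntegrable_iff_integrableOn_Ioc_of_le hT]
      exact intervalIntegral.intervalIntegrable_rpow' (by linarith)
    · simp [Ioc_eq_empty (not_lt.mpr hT.le)]
  refine (h1.mul_prod h2).mono' hm ?_
  rw [Measure.prod_restrict]
  refine (ae_restrict_iff' (measurableSet_Ioi.prod measurableSet_Ioi)).2 (ae_of_all _ ?_)
  rintro ⟨t, r⟩ ⟨ht, hr⟩
  exact hF t r ht hr

theorem exists_bounds (p q : ℝ → ℝ) (hp : Continuous p) (hq : Continuous q)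
    (hs : HasCompactSupport q) :
    ∃ T C : ℝ, 0 ≤ C ∧ (∀ t, T < t → q t = 0) ∧
      (∀ τ t, 0 ≤ τ → τ ≤ T → |p τ * q t| ≤ C) := by
  obtain ⟨T, hT⟩ := hs.isCompact.isBounded.bddAbove
  obtain ⟨A, hA⟩ := (isCompact_Icc (a := (0 : ℝ)) (b := T)).exists_bound_of_continuousOn
    hp.continuousOn
  obtain ⟨B, hB⟩ := hs.exists_bound_of_continuous hq
  have hB0 : 0 ≤ B := (norm_nonneg _).trans (hB 0)
  refine ⟨T, |A| * B, by positivity, fun t ht => ?_, fun τ t h0 h1 => ?_⟩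
  · by_contra h
    exact absurd (hT (subset_tsupport q h)) (not_le.mpr ht)
  · rw [abs_mul]
    exact mul_le_mul ((hA τ ⟨h0, h1⟩).trans (le_abs_self A)) (hB t) (abs_nonneg _)
      (abs_nonneg _)

theorem integral_Ioi_shift (f : ℝ → ℝ) (b d : ℝ) :
    ∫ x in Ioi b, f (x + d) = ∫ x in Ioi (b + d), f x := by
  have h := (measurePreserving_add_right volume d).setIntegral_preimage_emb
    (measurableEmbedding_addRight d) f (Ioi (b + d))
  rw [← h]
  simp

theorem swap_adjoint (α : ℝ) (hα : α < 1) (p q : ℝ → ℝ) (hp : Continuous p)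
    (hq : Continuous q) (hs : HasCompactSupport q) :
    ∫ τ in Ioi (0 : ℝ), p τ * ∫ s in Ioi τ, (s - τ) ^ (-α) * q s
      = ∫ r in Ioi (0 : ℝ), r ^ (-α) * ∫ τ in Ioi (0 : ℝ), p τ * q (τ + r) := by
  obtain ⟨T, C, hC, hT, hb⟩ := exists_bounds p q hp hq hs
  have e1 : ∀ τ : ℝ, ∫ s in Ioi τ, (s - τ) ^ (-α) * q s
      = ∫ r in Ioi (0 : ℝ), r ^ (-α) * q (τ + r) := by
    intro τ
    have := integral_Ioi_shift (fun s => (s - τ) ^ (-α) * q s) 0 τ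
    simpa [add_comm] using this.symm
  simp_rw [e1, ← integral_const_mul]
  rw [integral_integral_swap]
  · refine integral_congr_ae (ae_of_all _ fun r => ?_)
    refine integral_congr_ae (ae_of_all _ fun τ => ?_)
    simp only
    ring
  · refine integrable_dom α T C hα _ ?_ ?_
    · apply Measurable.aestronglyMeasurable
      have := hp.measurable
      have := hq.measurable
      simp only [Function.uncurry_def]
      fun_prop
    · intro τ r hτ hr
      simp only [Function.uncurry_apply_pair]
      by_cases h : τ + r ≤ T
      · rw [indicator_of_mem (mem_Ioc.2 ⟨hτ, by linarith⟩),
          indicator_of_mem (mem_Ioc.2 ⟨hr, by linarith⟩)]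
        have h1 := hb τ (τ + r) hτ.le (by linarith)
        have h2 : 0 ≤ r ^ (-α) := Real.rpow_nonneg hr.le _
        calc |p τ * (r ^ (-α) * q (τ + r))| = |p τ * q (τ + r)| * r ^ (-α) := by
              rw [show p τ * (r ^ (-α) * q (τ + r)) = (p τ * q (τ + r)) * r ^ (-α) by ring,
                abs_mul, abs_of_nonneg h2]
          _ ≤ _ := mul_le_mul_of_nonneg_right h1 h2
      · rw [hT _ (not_le.mp h)]
        simp only [mul_zero, abs_zero]
        exact mul_nonneg (indicator_nonneg (fun _ _ => hC) _)
          (indicator_nonneg (fun x hx => Real.rpow_nonneg hx.1.le _) _)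

theorem swap_conv (α : ℝ) (hα : α < 1) (p q : ℝ → ℝ) (hp : Continuous p)
    (hq : Continuous q) (hs : HasCompactSupport q) :
    ∫ t in Ioi (0 : ℝ), (∫ τ in (0 : ℝ)..t, (t - τ) ^ (-α) * p τ) * q t
      = ∫ r in Ioi (0 : ℝ), r ^ (-α) * ∫ τ in Ioi (0 : ℝ), p τ * q (τ + r) := by
  obtain ⟨T, C, hC, hT, hb⟩ := exists_bounds p q hp hq hs
  have e1 : ∀ t ∈ Ioi (0 : ℝ), (∫ τ in (0 : ℝ)..t, (t - τ) ^ (-α) * p τ) * q t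
      = ∫ r in Ioi (0 : ℝ), (Iio t).indicator (fun r => r ^ (-α) * (p (t - r) * q t)) r := by
    intro t ht
    have ht' : (0 : ℝ) ≤ t := le_of_lt ht
    have h := intervalIntegral.integral_comp_sub_left (fun r => r ^ (-α) * p (t - r)) t
      (a := 0) (b := t)
    simp only [sub_sub_cancel, sub_self, sub_zero] at h
    rw [h, ← intervalIntegral.integral_mul_const, intervalIntegral.integral_of_le ht',
      integral_Ioc_eq_integral_Ioo, setIntegral_indicator measurableSet_Iio, Ioi_inter_Iio]
    refine integral_congr_ae (ae_of_all _ fun r => ?_)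
    simp only
    ring
  have e2 : ∀ r ∈ Ioi (0 : ℝ), r ^ (-α) * ∫ τ in Ioi (0 : ℝ), p τ * q (τ + r)
      = ∫ t in Ioi (0 : ℝ), (Iio t).indicator (fun r => r ^ (-α) * (p (t - r) * q t)) r := by
    intro r hr
    have h := integral_Ioi_shift (fun t => p (t - r) * q t) 0 r
    simp only [add_sub_cancel_right, zero_add] at h
    have h3 : ∀ t : ℝ, (Iio t).indicator (fun r => r ^ (-α) * (p (t - r) * q t)) r
        = (Ioi r).indicator (fun t => r ^ (-α) * (p (t - r) * q t)) t := fun t => rfl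
    simp_rw [h3]
    rw [h, ← integral_const_mul, setIntegral_indicator measurableSet_Ioi, Ioi_inter_Ioi,
      max_eq_right (le_of_lt hr)]
  rw [setIntegral_congr_fun measurableSet_Ioi e1, setIntegral_congr_fun measurableSet_Ioi e2,
    integral_integral_swap]
  refine integrable_dom α T C hα _ ?_ ?_
  · apply Measurable.aestronglyMeasurable
    have := hp.measurable
    have := hq.measurable
    have h3 : (Function.uncurry fun t r : ℝ =>
        (Iio t).indicator (fun r => r ^ (-α) * (p (t - r) * q t)) r)
        = {z : ℝ × ℝ | z.2 < z.1}.indicator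
          (fun z => z.2 ^ (-α) * (p (z.1 - z.2) * q z.1)) := rfl
    rw [h3]
    refine Measurable.indicator (by fun_prop) (measurableSet_lt measurable_snd measurable_fst)
  · intro t r ht hr
    have hnn : 0 ≤ (Ioc (0 : ℝ) T).indicator (fun _ => C) t *
        (Ioc (0 : ℝ) T).indicator (fun r => r ^ (-α)) r :=
      mul_nonneg (indicator_nonneg (fun _ _ => hC) _)
        (indicator_nonneg (fun x hx => Real.rpow_nonneg hx.1.le _) _)
    simp only [Function.uncurry_apply_pair]
    by_cases hrt : r < t
    · rw [indicator_of_mem (mem_Iio.2 hrt)]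
      by_cases h : t ≤ T
      · rw [indicator_of_mem (mem_Ioc.2 ⟨ht, h⟩),
          indicator_of_mem (mem_Ioc.2 ⟨hr, by linarith⟩)]
        have h1 := hb (t - r) t (by linarith) (by linarith)
        have h2 : 0 ≤ r ^ (-α) := Real.rpow_nonneg hr.le _
        rw [abs_mul, abs_of_nonneg h2, mul_comm]
        exact mul_le_mul_of_nonneg_right h1 h2
      · rw [hT _ (not_le.mp h)]
        simpa using hnn
    · rw [indicator_of_notMem (by simpa using hrt)]
      simpa using hnn

/-- Fractional integration by parts: `caputoAdjoint` is the adjoint of `caputoDeriv` on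
functions vanishing at time `0`. -/
theorem integral_caputoDeriv_mul (α : ℝ) (hα : α < 1) (h φ : ℝ → ℝ) (hh : ContDiff ℝ 1 h)
    (h0 : h 0 = 0) (hφ : ContDiff ℝ 1 φ) (hs : HasCompactSupport φ) :
    ∫ t in Ioi (0 : ℝ), caputoDeriv α h t * φ t
      = ∫ t in Ioi (0 : ℝ), h t * caputoAdjoint α φ t := by
  have ibp : ∀ r : ℝ, ∫ τ in Ioi (0 : ℝ), deriv h τ * φ (τ + r)
      = -∫ τ in Ioi (0 : ℝ), h τ * deriv φ (τ + r) := by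
    intro r
    have hφr : ContDiff ℝ 1 (fun τ => φ (τ + r)) := hφ.comp (contDiff_id.add contDiff_const)
    have hsr : HasCompactSupport (fun τ => φ (τ + r)) :=
      hs.comp_homeomorph (Homeomorph.addRight r)
    have hdr : deriv (fun τ => φ (τ + r)) = fun τ => deriv φ (τ + r) := by
      funext τ; exact deriv_comp_add_const φ r τ
    have hsd : HasCompactSupport (fun τ => deriv φ (τ + r)) := hdr ▸ hsr.deriv
    have key := HasCompactSupport.integral_Ioi_deriv_eq (hh.mul hφr) (hsr.mul_left) 0
    have hd : ∀ τ, deriv (fun τ => h τ * φ (τ + r)) τ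
        = deriv h τ * φ (τ + r) + h τ * deriv φ (τ + r) := by
      intro τ
      rw [deriv_fun_mul (hh.differentiable one_ne_zero τ)
        (hφr.differentiable one_ne_zero τ), congrFun hdr τ]
    have c1 : Continuous (deriv h) := hh.continuous_deriv le_rfl
    have c2 : Continuous (deriv φ) := hφ.continuous_deriv le_rfl
    have i1 : Integrable (fun τ => deriv h τ * φ (τ + r)) :=
      (c1.mul hφr.continuous).integrable_of_hasCompactSupport hsr.mul_left
    have i2 : Integrable (fun τ => h τ * deriv φ (τ + r)) :=
      (hh.continuous.mul (c2.comp (continuous_id.add continuous_const)))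
        |>.integrable_of_hasCompactSupport hsd.mul_left
    have key' : ∫ τ in Ioi (0 : ℝ), (deriv h τ * φ (τ + r) + h τ * deriv φ (τ + r)) = 0 := by
      simp_rw [← hd]
      simpa [h0] using key
    rw [integral_add i1.integrableOn i2.integrableOn] at key'
    linarith
  have A := swap_conv α hα (deriv h) φ (hh.continuous_deriv le_rfl) hφ.continuous hs
  have B := swap_adjoint α hα h (deriv φ) hh.continuous (hφ.continuous_deriv le_rfl) hs.deriv
  simp_rw [ibp, mul_neg, integral_neg] at A
  rw [← B] at A
  simp only [caputoDeriv, caputoAdjoint, mul_neg, integral_neg]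
  rw [show (fun t => (1 / Real.Gamma (1 - α) * ∫ τ in (0 : ℝ)..t, (t - τ) ^ (-α) * deriv h τ)
      * φ t) = fun t => 1 / Real.Gamma (1 - α) *
        ((∫ τ in (0 : ℝ)..t, (t - τ) ^ (-α) * deriv h τ) * φ t) by funext t; ring,
    show (fun t => h t * (1 / Real.Gamma (1 - α) * ∫ s in Ioi t, (s - t) ^ (-α) * deriv φ s))
      = fun t => 1 / Real.Gamma (1 - α) *
        (h t * ∫ s in Ioi t, (s - t) ^ (-α) * deriv φ s) by funext t; ring,
    integral_const_mul, integral_const_mul, A, mul_neg]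

/-- `u (x, t)` is a weak (distributional) solution of
`∂u/∂t + a ∂u/∂x + ε D_t^α u = δ(x) g(t)` for `x ∈ ℝ`, `t > 0`, with `u(x, 0) = 0`.
The test functions need not vanish at `t = 0`: this is how the zero initial value is imposed. -/
def IsWeakSolution (α a ε : ℝ) (g : ℝ → ℝ) (u : ℝ × ℝ → ℝ) : Prop :=
  LocallyIntegrableOn u {p : ℝ × ℝ | 0 ≤ p.2} ∧
  ∀ φ : ℝ × ℝ → ℝ, ContDiff ℝ ∞ φ → HasCompactSupport φ →
    ∫ p in {p : ℝ × ℝ | 0 < p.2},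
        u p * (-(deriv (fun t => φ (p.1, t)) p.2) - a * deriv (fun x => φ (x, p.2)) p.1
          + ε * caputoAdjoint α (fun t => φ (p.1, t)) p.2)
      = ∫ t in Ioi (0 : ℝ), g t * φ (0, t)

/-- Inverse Laplace transform by the Bromwich integral along the vertical line `Re s = σ`:
`(1/(2πi)) ∫_{σ-i∞}^{σ+i∞} exp(s t) F(s) ds`, with `s = σ + iw`. -/
def bromwich (F : ℂ → ℂ) (σ t : ℝ) : ℂ :=
  (1 / (2 * Real.pi) : ℝ) *
    ∫ w : ℝ, Complex.exp (((σ : ℂ) + w * Complex.I) * t) * F ((σ : ℂ) + w * Complex.I)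

/-- `h_α(y, t)`, the inverse Laplace transform in `t` of `s ↦ exp(-y s^α)` (principal branch),
for `y > 0`. The integral converges absolutely and is real. -/
def kernel (α y t : ℝ) : ℝ :=
  (bromwich (fun s => Complex.exp (-(y : ℂ) * s ^ (α : ℂ))) 1 t).re

/-- The Airy function `Ai(x) = (1/(2πi)) ∫ exp(v³/3 - x v) dv`, along the line
`v = 1 + iw` (an absolutely convergent contour integral, equal to
`(1/π) ∫_0^∞ cos(k³/3 + x k) dk`; it is real). -/
def airyAi (x : ℝ) : ℝ :=
  ((1 / (2 * Real.pi) : ℝ) *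
    ∫ w : ℝ, Complex.exp ((1 + (w : ℂ) * Complex.I) ^ 3 / 3
      - (x : ℂ) * (1 + (w : ℂ) * Complex.I))).re

/-- The causal convolution in time `(h_α(y, ·) * f)(t) = ∫_0^t h_α(y, τ) f(t-τ) dτ`, zero for
`t < 0` (only the values of `f` on `[0, ∞)` enter). For `y = 0` the inverse Laplace transform of
`exp(0) = 1` is the Dirac mass at `0`, whose convolution with `f` is `f`. -/
def kernelConv (α y : ℝ) (f : ℝ → ℝ) (t : ℝ) : ℝ :=
  if y = 0 then (if 0 ≤ t then f t else 0)
  else ∫ τ in Ioc 0 t, kernel α y τ * f (t - τ)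

/-- The closed form: `(1/a) (h_α(εx/a, ·) * g)(t - x/a)` for `x > 0`, and `0` for `x ≤ 0`. -/
def closedForm (α a ε : ℝ) (g : ℝ → ℝ) (p : ℝ × ℝ) : ℝ :=
  if 0 < p.1 then (1 / a) * kernelConv α (ε * p.1 / a) g (p.2 - p.1 / a) else 0

end FracAdvection

end

noncomputable section

namespace FracAdvection

open Filter Topology Complex

/-! ### Fourier inversion in angular frequency -/

/-! With time measured along characteristics, τ = t - x/a, the operator becomes a ∂_x + ε D^α, and
the Laplace transform in τ turns it into the ordinary differential operator a ∂_x + ε s^α. A unit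
impulse at the origin therefore has transform (1/a) exp(-(εx/a) s^α) for x > 0, that is, the
response (1/a) h_α(εx/a, τ), and a general g is a superposition of impulses.

Weak solutions carry no growth bound, so the transform is applied to test functions and never to u.
Inserting the Bromwich integral of the kernel and exchanging integrals, the pairing with the adjoint
operator becomes the integral of an exact x-derivative (`integral_symbol_mul_adjointSymbol`). Only
the boundary term at x = 0 survives, and Fourier inversion turns it into φ(0)
(`integral_integral_kernel_mul_adjointOp`). For ε = 0 the fundamental solution is a measure on the
ray x = at; `IsFundamentalSolution` covers both cases.

Uniqueness is by duality. Integrating ψ(p + q) against the fundamental solution in q solves the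
adjoint equation with source ψ. The cone 0 ≤ x ≤ at bounds its support except towards t → -∞, and
the adjoint operator looks only at later times, so cutting off at negative times gives an admissible
test function (`exists_adjointOp_eq`). The difference of two weak solutions is then orthogonal to
every ψ supported in t > 0.

The kernel facts rest on moving the Bromwich line (`bromwich_symbol_eq`). On Re s > 0 the power s^α
stays in a sector strictly inside the half plane, so exp(-y s^α) decays like a stretched
exponential, uniformly in Re s. Letting Re s → ∞ gives causality, Re s = 1/t gives the pointwise
bounds, and Fourier inversion on a line gives the Laplace transform. For α = 1/n, an integration by
parts and the substitution v = s^(1/n) leave an entire integrand, whose contour is moved to a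
vertical line (`kernel_eq_integral_vertical`): a Gaussian integral for n = 2, an Airy integral for n
= 3. -/

theorem eq_integral_exp_mul_of_integrable {f F : ℝ → ℂ} (hc : Continuous f) (hf : Integrable f)
    (hF : Integrable F) (h : ∀ w : ℝ, F w = ∫ τ : ℝ, exp (w * τ * I) * f τ) (x : ℝ) :
    f x = (1 / (2 * Real.pi) : ℝ) * ∫ w : ℝ, exp (-(w * x * I)) * F w := by
  have h1 : ∀ v : ℝ, FourierTransformInv.fourierInv f v = F (2 * Real.pi * v) := by
    intro v
    rw [Real.fourierInv_eq', h]
    refine integral_congr_ae (ae_of_all _ fun τ => ?_)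
    simp only [RCLike.inner_apply, conj_trivial, smul_eq_mul]
    push_cast
    ring_nf
  have h2 : Integrable (FourierTransform.fourier f) := by
    have : FourierTransform.fourier f = fun v => F (-(2 * Real.pi) * v) := by
      funext v
      have := h1 (-v)
      rw [Real.fourierInv_eq_fourier_neg, neg_neg] at this
      rw [this]; ring_nf
    rw [this]
    exact hF.comp_mul_left' (by simp [Real.pi_ne_zero])
  have h3 := congrFun (hc.fourier_fourierInv_eq hf h2) x
  rw [← h3, Real.fourier_real_eq_integral_exp_smul]
  have h4 := Measure.integral_comp_mul_left (fun w : ℝ => exp (-(w * x * I)) * F w)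
    (2 * Real.pi)
  rw [abs_of_nonneg (by positivity)] at h4
  rw [one_div, ← Complex.real_smul, ← h4]
  refine integral_congr_ae (ae_of_all _ fun v => ?_)
  simp only [h1, smul_eq_mul]
  push_cast
  ring_nf

/-! ### Vertical line integrals -/

/-- Cauchy's theorem on the rectangle of height 2R between the two lines. The single majorant `m` of
the imaginary part serves twice: its integrability controls the vertical sides, its decay kills the
horizontal ones. -/
theorem integral_vertical_eq {H : ℂ → ℂ} {σ₁ σ₂ : ℝ} {m : ℝ → ℝ}
    (hd : ∀ s : ℂ, s.re ∈ uIcc σ₁ σ₂ → DifferentiableAt ℂ H s)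
    (hm : Integrable m) (hb : ∀ s : ℂ, s.re ∈ uIcc σ₁ σ₂ → ‖H s‖ ≤ m s.im)
    (ht : Tendsto m atTop (𝓝 0)) (ht' : Tendsto m atBot (𝓝 0)) :
    ∫ w : ℝ, H (σ₁ + w * I) = ∫ w : ℝ, H (σ₂ + w * I) := by
  have hint : ∀ σ ∈ uIcc σ₁ σ₂, Integrable fun w : ℝ => H (σ + w * I) := by
    intro σ hσ
    refine hm.mono' (Continuous.aestronglyMeasurable ?_) (ae_of_all _ fun w => ?_)
    · refine continuous_iff_continuousAt.2 fun w => ?_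
      have := (hd (σ + w * I) (by simpa using hσ)).continuousAt
      exact ContinuousAt.comp (f := fun w : ℝ => (σ + w * I : ℂ)) this
        (by fun_prop)
    · simpa using hb (σ + w * I) (by simpa using hσ)
  have hrect : ∀ R : ℝ, (∫ w in (-R)..R, H (σ₂ + w * I)) - ∫ w in (-R)..R, H (σ₁ + w * I)
      = I * ((∫ x in σ₁..σ₂, H (x + (-R : ℝ) * I)) - ∫ x in σ₁..σ₂, H (x + R * I)) := by
    intro R
    have h := integral_boundary_rect_eq_zero_of_differentiableOn H
      (σ₁ + (-R : ℝ) * I) (σ₂ + R * I) (fun s hs => (hd s (by simpa using hs.1)).differentiableWithinAt)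
    simp only [add_re, ofReal_re, mul_re, I_re, mul_zero, ofReal_im, I_im, mul_one, sub_self,
      add_zero, add_im, mul_im, zero_add, smul_eq_mul] at h
    have hI : I * I = -1 := I_mul_I
    linear_combination (-I) * h + ((∫ w in (-R)..R, H (σ₂ + w * I)) - ∫ w in (-R)..R, H (σ₁ + w * I)) * hI
  have hz : ∀ l : Filter ℝ, Tendsto m l (𝓝 0) →
      Tendsto (fun R : ℝ => ∫ x in σ₁..σ₂, H (x + R * I)) l (𝓝 0) := by
    intro l hl
    have h0 : Tendsto (fun R => m R * |σ₂ - σ₁|) l (𝓝 0) := by simpa using hl.mul_const |σ₂ - σ₁|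
    refine squeeze_zero_norm (fun R => ?_) h0
    refine intervalIntegral.norm_integral_le_of_norm_le_const fun x hx => ?_
    simpa using hb (x + R * I) (by simpa using uIoc_subset_uIcc hx)
  have hlim : ∀ σ ∈ uIcc σ₁ σ₂, Tendsto (fun R : ℝ => ∫ w in (-R)..R, H (σ + w * I)) atTop
      (𝓝 (∫ w : ℝ, H (σ + w * I))) := fun σ hσ =>
    intervalIntegral_tendsto_integral (hint σ hσ) tendsto_neg_atTop_atBot tendsto_id
  have e1 := (hlim σ₂ right_mem_uIcc).sub (hlim σ₁ left_mem_uIcc)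
  have e2 : Tendsto (fun R : ℝ =>
      I * ((∫ x in σ₁..σ₂, H (x + (-R : ℝ) * I)) - ∫ x in σ₁..σ₂, H (x + R * I))) atTop
      (𝓝 (I * (0 - 0))) :=
    (((hz atBot ht').comp tendsto_neg_atTop_atBot).sub (hz atTop ht)).const_mul I
  simp_rw [hrect] at e1
  have := tendsto_nhds_unique e1 e2
  simp only [sub_self, mul_zero, sub_eq_zero] at this
  exact this.symm

/-! ### The symbol `exp (-y s^α)` on the right half plane -/

/-- Half of the opening angle of the image of the right half plane under `s ↦ s^α`, through its
cosine. -/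
def symbolConst (α : ℝ) : ℝ := Real.cos (Real.pi / 2 * α)

theorem symbolConst_pos {α : ℝ} (h0 : 0 < α) (h1 : α < 1) : 0 < symbolConst α := by
  apply Real.cos_pos_of_mem_Ioo
  have := Real.pi_pos
  constructor <;> nlinarith

/-- Since |arg s| ≤ π/2, the argument of s^α is at most πα/2 < π/2 in absolute value. This strict
gap is the source of every absolute convergence below. -/
theorem symbolConst_mul_le_re_cpow {α : ℝ} (h0 : 0 < α) (h1 : α < 1) {s : ℂ} (hs : 0 < s.re) :
    symbolConst α * ‖s‖ ^ α ≤ (s ^ (α : ℂ)).re := by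
  rw [cpow_ofReal_re, mul_comm]
  refine mul_le_mul_of_nonneg_left ?_ (by positivity)
  have ha : |arg s| ≤ Real.pi / 2 := abs_arg_le_pi_div_two_iff.2 hs.le
  rw [← Real.cos_abs (arg s * α), abs_mul, abs_of_pos h0, symbolConst]
  apply Real.cos_le_cos_of_nonneg_of_le_pi
  · positivity
  · nlinarith [Real.pi_pos]
  · gcongr

theorem norm_exp_neg_mul_cpow_le {α y : ℝ} (h0 : 0 < α) (h1 : α < 1) (hy : 0 ≤ y) {s : ℂ}
    (hs : 0 < s.re) :
    ‖exp (-(y : ℂ) * s ^ (α : ℂ))‖ ≤ Real.exp (-(y * symbolConst α) * |s.im| ^ α) := by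
  rw [norm_exp, Real.exp_le_exp]
  have h := symbolConst_mul_le_re_cpow h0 h1 hs
  have h2 : |s.im| ^ α ≤ ‖s‖ ^ α := by
    gcongr
    exact abs_im_le_norm s
  have h3 := (symbolConst_pos h0 h1).le
  simp only [neg_mul, neg_re, mul_re, ofReal_re, ofReal_im, zero_mul, sub_zero, neg_le_neg_iff]
  calc y * symbolConst α * |s.im| ^ α ≤ y * (symbolConst α * ‖s‖ ^ α) := by
        rw [mul_assoc]; gcongr
    _ ≤ _ := by gcongr

theorem hasDerivAt_exp_neg_mul_cpow (α y : ℝ) {s : ℂ} (hs : 0 < s.re) :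
    HasDerivAt (fun s : ℂ => exp (-(y : ℂ) * s ^ (α : ℂ)))
      (exp (-(y : ℂ) * s ^ (α : ℂ)) * (-(y : ℂ) * (α * s ^ ((α : ℂ) - 1)))) s := by
  have h : HasDerivAt (fun s : ℂ => s ^ (α : ℂ)) ((α : ℂ) * s ^ ((α : ℂ) - 1)) s := by
    simpa using (hasDerivAt_id s).cpow_const (c := (α : ℂ)) (Or.inl hs)
  exact (h.const_mul _).cexp

theorem conj_cpow_ofReal (α : ℝ) {s : ℂ} (hs : 0 < s.re) :
    (starRingEnd ℂ) (s ^ (α : ℂ)) = ((starRingEnd ℂ) s) ^ (α : ℂ) := by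
  have := cpow_conj s (α : ℂ) (fun h => by
    rw [arg_eq_pi_iff] at h; linarith [h.1])
  rw [conj_ofReal] at this
  rw [this, conj_conj]

/-! ### Stretched exponentials -/

theorem integral_abs_rpow_mul_exp {p q b : ℝ} (hp : 0 < p) (hq : -1 < q) (hb : 0 < b) :
    ∫ x : ℝ, |x| ^ q * Real.exp (-b * |x| ^ p)
      = 2 * (b ^ (-(q + 1) / p) * (1 / p) * Real.Gamma ((q + 1) / p)) := by
  rw [integral_comp_abs (f := fun x => x ^ q * Real.exp (-b * x ^ p)),
    integral_rpow_mul_exp_neg_mul_rpow hp hq hb]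

theorem integrable_abs_rpow_mul_exp {p q b : ℝ} (hp : 0 < p) (hq : -1 < q) (hb : 0 < b) :
    Integrable fun x : ℝ => |x| ^ q * Real.exp (-b * |x| ^ p) := by
  -- The Bochner integral of a non-integrable function is 0 by convention, so a nonzero value proves
  -- integrability.
  refine Integrable.of_integral_ne_zero ?_
  rw [integral_abs_rpow_mul_exp hp hq hb]
  have : 0 < Real.Gamma ((q + 1) / p) := Real.Gamma_pos_of_pos (div_pos (by linarith) hp)
  positivity

theorem integrable_exp_neg_mul_abs_rpow {p b : ℝ} (hp : 0 < p) (hb : 0 < b) :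
    Integrable fun x : ℝ => Real.exp (-b * |x| ^ p) := by
  simpa using integrable_abs_rpow_mul_exp (q := 0) hp (by norm_num) hb

theorem tendsto_exp_neg_mul_abs_rpow {p b : ℝ} (hp : 0 < p) (hb : 0 < b) {l : Filter ℝ}
    (hl : Tendsto (fun x : ℝ => |x|) l atTop) :
    Tendsto (fun x : ℝ => Real.exp (-b * |x| ^ p)) l (𝓝 0) := by
  refine Real.tendsto_exp_atBot.comp ?_
  exact ((tendsto_rpow_atTop hp).comp hl).const_mul_atTop_of_neg (by linarith)

/-! ### The kernel -/

/-- The Laplace transform `exp (-y s^α)` of the kernel. -/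
def symbol (α y : ℝ) (s : ℂ) : ℂ := exp (-(y : ℂ) * s ^ (α : ℂ))

theorem kernel_eq_re_bromwich (α y t : ℝ) : kernel α y t = (bromwich (symbol α y) 1 t).re := rfl

theorem continuousAt_symbol (α y : ℝ) {s : ℂ} (hs : 0 < s.re) : ContinuousAt (symbol α y) s :=
  (hasDerivAt_exp_neg_mul_cpow α y hs).continuousAt

theorem continuous_symbol_vertical (α y : ℝ) {σ : ℝ} (hσ : 0 < σ) :
    Continuous fun w : ℝ => symbol α y (σ + w * I) := by
  refine continuous_iff_continuousAt.2 fun w => ?_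
  exact ContinuousAt.comp (f := fun w : ℝ => (σ + w * I : ℂ))
    (continuousAt_symbol α y (by simpa using hσ)) (by fun_prop)

theorem norm_symbol_vertical_le {α y : ℝ} (h0 : 0 < α) (h1 : α < 1) (hy : 0 ≤ y) {σ : ℝ}
    (hσ : 0 < σ) (w : ℝ) :
    ‖symbol α y (σ + w * I)‖ ≤ Real.exp (-(y * symbolConst α) * |w| ^ α) := by
  simpa [symbol] using norm_exp_neg_mul_cpow_le h0 h1 hy (s := σ + w * I) (by simpa using hσ)

theorem integrable_symbol_vertical {α y : ℝ} (h0 : 0 < α) (h1 : α < 1) (hy : 0 < y) {σ : ℝ}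
    (hσ : 0 < σ) : Integrable fun w : ℝ => symbol α y (σ + w * I) :=
  (integrable_exp_neg_mul_abs_rpow h0 (mul_pos hy (symbolConst_pos h0 h1))).mono'
    (continuous_symbol_vertical α y hσ).aestronglyMeasurable
    (ae_of_all _ (norm_symbol_vertical_le h0 h1 hy.le hσ))

theorem norm_exp_vertical_mul (σ w t : ℝ) :
    ‖exp (((σ : ℂ) + w * I) * t)‖ = Real.exp (σ * t) := by
  rw [norm_exp]; simp

theorem integrable_exp_mul_symbol {α y : ℝ} (h0 : 0 < α) (h1 : α < 1) (hy : 0 < y) {σ : ℝ}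
    (hσ : 0 < σ) (t : ℝ) :
    Integrable fun w : ℝ => exp (((σ : ℂ) + w * I) * t) * symbol α y (σ + w * I) := by
  refine (integrable_symbol_vertical h0 h1 hy hσ).bdd_mul (c := Real.exp (σ * t)) ?_ ?_
  · exact Continuous.aestronglyMeasurable (by fun_prop)
  · exact ae_of_all _ fun w => (norm_exp_vertical_mul σ w t).le

/-- The stretched exponential bound on the symbol is uniform in Re s > 0, so the line can be moved
freely; each later estimate chooses its own abscissa. -/
theorem bromwich_symbol_eq {α y : ℝ} (h0 : 0 < α) (h1 : α < 1) (hy : 0 < y) {σ : ℝ}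
    (hσ : 0 < σ) (t : ℝ) : bromwich (symbol α y) σ t = bromwich (symbol α y) 1 t := by
  simp only [bromwich]
  congr 1
  have hpos : ∀ s : ℂ, s.re ∈ uIcc σ 1 → 0 < s.re := fun s hs => by
    rcases le_total σ 1 with h | h
    · rw [uIcc_of_le h] at hs; linarith [hs.1]
    · rw [uIcc_of_ge h] at hs; linarith [hs.1]
  have hb := mul_pos hy (symbolConst_pos h0 h1)
  have := integral_vertical_eq (H := fun s => exp (s * t) * symbol α y s) (σ₁ := σ) (σ₂ := 1)
    (m := fun w => Real.exp ((max σ 1) * |t|) * Real.exp (-(y * symbolConst α) * |w| ^ α))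
    ?_ ((integrable_exp_neg_mul_abs_rpow h0 hb).const_mul _) ?_ ?_ ?_
  · exact this
  · intro s hs
    exact (by fun_prop : DifferentiableAt ℂ (fun s : ℂ => exp (s * t)) s).mul
      (hasDerivAt_exp_neg_mul_cpow α y (hpos s hs)).differentiableAt
  · intro s hs
    rw [norm_mul, norm_exp]
    refine mul_le_mul ?_ (norm_exp_neg_mul_cpow_le h0 h1 hy.le (hpos s hs)) (norm_nonneg _)
      (Real.exp_pos _).le
    rw [Real.exp_le_exp]
    simp only [mul_re, ofReal_re, ofReal_im, mul_zero, sub_zero]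
    have h2 : s.re ≤ max σ 1 := by
      have := hs.2
      simpa using this
    calc s.re * t ≤ s.re * |t| := mul_le_mul_of_nonneg_left (le_abs_self t) (hpos s hs).le
      _ ≤ _ := mul_le_mul_of_nonneg_right h2 (abs_nonneg t)
  · simpa using (tendsto_exp_neg_mul_abs_rpow h0 hb tendsto_abs_atTop_atTop).const_mul
      (Real.exp ((max σ 1) * |t|))
  · simpa using (tendsto_exp_neg_mul_abs_rpow h0 hb tendsto_abs_atBot_atTop).const_mul
      (Real.exp ((max σ 1) * |t|))

theorem conj_symbol (α y : ℝ) {s : ℂ} (hs : 0 < s.re) :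
    (starRingEnd ℂ) (symbol α y s) = symbol α y ((starRingEnd ℂ) s) := by
  rw [symbol, symbol, ← exp_conj, map_mul, map_neg, conj_ofReal, conj_cpow_ofReal α hs]

theorem ofReal_kernel (α y t : ℝ) :
    ((kernel α y t : ℝ) : ℂ) = bromwich (symbol α y) 1 t := by
  rw [kernel_eq_re_bromwich, ← conj_eq_iff_re, bromwich, map_mul, conj_ofReal, ← integral_conj,
    ← integral_neg_eq_self]
  congr 1
  refine integral_congr_ae (ae_of_all _ fun w => ?_)
  have h : (starRingEnd ℂ) (((1 : ℝ) : ℂ) + ((-w : ℝ) : ℂ) * I) = ((1 : ℝ) : ℂ) + w * I := by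
    simp
  simp only
  rw [map_mul, conj_symbol α y (by simp), ← exp_conj, map_mul, h, conj_ofReal]

theorem kernel_eq {α y : ℝ} (h0 : 0 < α) (h1 : α < 1) (hy : 0 < y) {σ : ℝ} (hσ : 0 < σ)
    (t : ℝ) : ((kernel α y t : ℝ) : ℂ) = (1 / (2 * Real.pi) : ℝ) *
      ∫ w : ℝ, exp (((σ : ℂ) + w * I) * t) * symbol α y (σ + w * I) := by
  rw [ofReal_kernel, ← bromwich_symbol_eq h0 h1 hy hσ, bromwich]

theorem abs_kernel_le {α y : ℝ} (h0 : 0 < α) (h1 : α < 1) (hy : 0 < y) {σ : ℝ} (hσ : 0 < σ)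
    (t : ℝ) : |kernel α y t| ≤
      Real.exp (σ * t) * (1 / (2 * Real.pi) * ∫ w : ℝ, Real.exp (-(y * symbolConst α) * |w| ^ α)) := by
  have hb := mul_pos hy (symbolConst_pos h0 h1)
  rw [← Real.norm_eq_abs, ← norm_real, kernel_eq h0 h1 hy hσ, norm_mul, norm_real, Real.norm_of_nonneg (by positivity),
    mul_left_comm, ← integral_const_mul]
  refine mul_le_mul_of_nonneg_left ?_ (by positivity)
  refine norm_integral_le_of_norm_le ((integrable_exp_neg_mul_abs_rpow h0 hb).const_mul _)
    (ae_of_all _ fun w => ?_)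
  rw [norm_mul, norm_exp_vertical_mul]
  exact mul_le_mul_of_nonneg_left (norm_symbol_vertical_le h0 h1 hy.le hσ w) (Real.exp_pos _).le

/-- The constant in `abs_kernel_le` does not depend on σ, and exp(σt) → 0 as σ → ∞ when t < 0. -/
theorem kernel_eq_zero_of_neg {α y t : ℝ} (h0 : 0 < α) (h1 : α < 1) (hy : 0 < y) (ht : t < 0) :
    kernel α y t = 0 := by
  set C := 1 / (2 * Real.pi) * ∫ w : ℝ, Real.exp (-(y * symbolConst α) * |w| ^ α)
  have h : Tendsto (fun σ : ℝ => Real.exp (σ * t) * C) atTop (𝓝 0) := by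
    simpa using (Real.tendsto_exp_atBot.comp
      (tendsto_id.atTop_mul_const_of_neg ht)).mul_const C
  refine abs_eq_zero.1 (le_antisymm (ge_of_tendsto h ?_) (abs_nonneg _))
  filter_upwards [eventually_gt_atTop 0] with σ hσ using abs_kernel_le h0 h1 hy hσ t

theorem measurable_kernel (α : ℝ) : Measurable fun p : ℝ × ℝ => kernel α p.1 p.2 := by
  have h : StronglyMeasurable fun p : ℝ × ℝ => ∫ w : ℝ,
      exp ((((1 : ℝ) : ℂ) + w * I) * p.2) * symbol α p.1 ((1 : ℝ) + w * I) := by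
    have h2 : Measurable fun z : (ℝ × ℝ) × ℝ =>
        exp ((((1 : ℝ) : ℂ) + z.2 * I) * z.1.2) * symbol α z.1.1 ((1 : ℝ) + z.2 * I) := by
      unfold symbol
      fun_prop
    exact h2.stronglyMeasurable.integral_prod_right
  exact Complex.measurable_re.comp (h.measurable.const_mul _)

theorem measurable_kernel_right (α y : ℝ) : Measurable (kernel α y) := by
  have h : Measurable fun t : ℝ => (y, t) := by fun_prop
  have h2 := (measurable_kernel α).comp h
  exact h2

/-- Bounding the kernel on the line of abscissa σ/2 costs exp(σt/2), which leaves half of the decay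
exp(-σt) for t > 0; causality takes care of t < 0. -/
theorem integrable_exp_neg_mul_kernel {α y : ℝ} (h0 : 0 < α) (h1 : α < 1) (hy : 0 < y) {σ : ℝ}
    (hσ : 0 < σ) : Integrable fun t : ℝ => Real.exp (-σ * t) * kernel α y t := by
  set C := 1 / (2 * Real.pi) * ∫ w : ℝ, Real.exp (-(y * symbolConst α) * |w| ^ α)
  have hm : Integrable ((Ioi (0 : ℝ)).indicator fun t => Real.exp (-(σ / 2) * t) * C) :=
    (IntegrableOn.integrable_indicator ((exp_neg_integrableOn_Ioi 0 (half_pos hσ)).mul_const C)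
      measurableSet_Ioi)
  refine hm.mono' ((Measurable.mul (by fun_prop) (measurable_kernel_right α y)).aestronglyMeasurable)
    ?_
  filter_upwards [Measure.ae_ne volume 0] with t ht
  rcases lt_or_gt_of_ne ht with ht | ht
  · simp [kernel_eq_zero_of_neg h0 h1 hy ht, ht.le]
  · rw [indicator_of_mem (mem_Ioi.2 ht), norm_mul, Real.norm_eq_abs, Real.norm_eq_abs, Real.abs_exp]
    calc _ ≤ Real.exp (-σ * t) * (Real.exp (σ / 2 * t) * C) :=
          mul_le_mul_of_nonneg_left (abs_kernel_le h0 h1 hy (half_pos hσ) t) (Real.exp_pos _).le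
      _ = _ := by rw [← mul_assoc, ← Real.exp_add]; congr 2; ring

/-- By definition 2π exp(-σt) h(t) is a Fourier integral of the symbol on the line Re s = σ. Both
functions are integrable and the symbol is continuous, so Fourier inversion holds at every point. -/
theorem symbol_eq_integral {α y : ℝ} (h0 : 0 < α) (h1 : α < 1) (hy : 0 < y) {σ : ℝ}
    (hσ : 0 < σ) (w : ℝ) :
    symbol α y (σ + w * I) = ∫ t : ℝ, exp (-((σ : ℂ) + w * I) * t) * (kernel α y t : ℂ) := by
  have hF : Integrable fun t : ℝ => (2 * Real.pi : ℂ) *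
      ((Real.exp (-σ * t) * kernel α y t : ℝ) : ℂ) :=
    (integrable_exp_neg_mul_kernel h0 h1 hy hσ).ofReal.const_mul _
  rw [eq_integral_exp_mul_of_integrable (continuous_symbol_vertical α y hσ)
    (integrable_symbol_vertical h0 h1 hy hσ) hF ?_ w, ← integral_const_mul]
  · refine integral_congr_ae (ae_of_all _ fun t => ?_)
    have hpi : (Real.pi : ℂ) ≠ 0 := by simp [Real.pi_ne_zero]
    simp only
    rw [show -((σ : ℂ) + w * I) * t = -σ * t + -(t * w * I) by ring, exp_add]
    push_cast
    field_simp
  · intro t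
    have hpi : (Real.pi : ℂ) ≠ 0 := by simp [Real.pi_ne_zero]
    rw [ofReal_mul, kernel_eq h0 h1 hy hσ]
    have : ∀ u : ℝ, exp (((σ : ℂ) + u * I) * t) * symbol α y (σ + u * I)
        = exp (σ * t) * (exp (t * u * I) * symbol α y (σ + u * I)) := by
      intro u
      rw [show ((σ : ℂ) + u * I) * t = σ * t + t * u * I by ring, exp_add, mul_assoc]
    simp_rw [this]
    rw [integral_const_mul]
    push_cast
    rw [show -(σ : ℂ) * t = -(σ * t) by ring, exp_neg]
    have := exp_ne_zero ((σ : ℂ) * t)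
    rw [show ∀ a : ℂ, 2 * (Real.pi : ℂ) * ((exp (σ * t))⁻¹ * (1 / (2 * Real.pi) * (exp (σ * t) * a)))
      = a from fun a => by field_simp]

theorem laplace_kernel {α y : ℝ} (h0 : 0 < α) (h1 : α < 1) (hy : 0 < y) {s : ℂ}
    (hs : 0 < s.re) :
    IntegrableOn (fun t : ℝ => exp (-s * t) * (kernel α y t : ℂ)) (Ioi 0) ∧
      ∫ t in Ioi (0 : ℝ), exp (-s * t) * (kernel α y t : ℂ) = exp (-(y : ℂ) * s ^ (α : ℂ)) := by
  have hI : Integrable fun t : ℝ => exp (-s * t) * (kernel α y t : ℂ) := by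
    refine (integrable_exp_neg_mul_kernel h0 h1 hy hs).mono ?_ (ae_of_all _ fun t => ?_)
    · have := measurable_kernel_right α y
      exact Measurable.aestronglyMeasurable (by fun_prop)
    · rw [norm_mul, norm_mul, norm_exp]
      simp
  refine ⟨hI.integrableOn, ?_⟩
  -- By causality the bilateral and the one-sided Laplace integrals coincide.
  rw [← setIntegral_eq_of_subset_of_ae_sdiff_eq_zero (t := univ)
    MeasurableSet.univ.nullMeasurableSet (subset_univ _), setIntegral_univ]
  · have := symbol_eq_integral h0 h1 hy hs s.im
    rw [re_add_im] at this
    rw [← this, symbol]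
  · filter_upwards [Measure.ae_ne volume 0] with t ht h
    have : t < 0 := lt_of_le_of_ne (by simpa using h) ht
    simp [kernel_eq_zero_of_neg h0 h1 hy this]

/-! ### Pointwise bounds for the kernel -/

/-- The abscissa 1/t makes exp(σt) equal to e; the remaining integral over the line scales like
y^(-1/α). -/
theorem abs_kernel_le_rpow {α : ℝ} (h0 : 0 < α) (h1 : α < 1) :
    ∃ C, 0 ≤ C ∧ ∀ y t : ℝ, 0 < y → 0 < t → |kernel α y t| ≤ C * y ^ (-1 / α) := by
  have hc := symbolConst_pos h0 h1
  refine ⟨Real.exp 1 * (1 / (2 * Real.pi) * (2 * (symbolConst α ^ (-1 / α) * (1 / α) *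
    Real.Gamma (1 / α)))), ?_, fun y t hy ht => ?_⟩
  · have := Real.Gamma_pos_of_pos (one_div_pos.2 h0)
    positivity
  · have h := abs_kernel_le h0 h1 hy (one_div_pos.2 ht) t
    have h2 := integral_abs_rpow_mul_exp (q := 0) h0 (by norm_num) (mul_pos hy hc)
    simp only [Real.rpow_zero, one_mul, zero_add] at h2
    rw [h2, Real.mul_rpow hy.le hc.le, one_div_mul_cancel ht.ne'] at h
    refine h.trans (le_of_eq ?_)
    ring

theorem norm_vertical_rpow_le {α : ℝ} (h1 : α < 1) (σ : ℝ) {w : ℝ} (hw : w ≠ 0) :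
    ‖((σ : ℂ) + w * I) ^ ((α : ℂ) - 1)‖ ≤ |w| ^ (α - 1) := by
  have hne : (σ : ℂ) + w * I ≠ 0 := fun h => hw (by simpa using congrArg im h)
  rw [show (α : ℂ) - 1 = ((α - 1 : ℝ) : ℂ) by push_cast; ring, norm_cpow_real]
  refine Real.rpow_le_rpow_of_nonpos (abs_pos.2 hw) ?_ (by linarith)
  simpa using abs_im_le_norm ((σ : ℂ) + w * I)

theorem norm_bromwich_deriv_le {α y : ℝ} (h0 : 0 < α) (h1 : α < 1) (hy : 0 < y) {σ : ℝ}
    (hσ : 0 < σ) (t : ℝ) {w : ℝ} (hw : w ≠ 0) :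
    ‖exp (((σ : ℂ) + w * I) * t) * (symbol α y (σ + w * I) *
        ((y : ℂ) * (α * ((σ : ℂ) + w * I) ^ ((α : ℂ) - 1))))‖
      ≤ Real.exp (σ * t) * (y * α) *
        (|w| ^ (α - 1) * Real.exp (-(y * symbolConst α) * |w| ^ α)) := by
  have e1 := norm_symbol_vertical_le h0 h1 hy.le hσ w
  have e2 := norm_vertical_rpow_le h1 σ hw
  rw [norm_mul, norm_exp_vertical_mul, norm_mul, norm_mul, norm_mul, norm_real, norm_real,
    Real.norm_of_nonneg hy.le, Real.norm_of_nonneg h0.le, mul_assoc (Real.exp _)]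
  refine mul_le_mul_of_nonneg_left ?_ (Real.exp_pos _).le
  calc _ ≤ Real.exp (-(y * symbolConst α) * |w| ^ α) * (y * (α * |w| ^ (α - 1))) := by gcongr
    _ = _ := by ring

theorem integrable_bromwich_deriv {α y : ℝ} (h0 : 0 < α) (h1 : α < 1) (hy : 0 < y) {σ : ℝ}
    (hσ : 0 < σ) (t : ℝ) :
    Integrable fun w : ℝ => exp (((σ : ℂ) + w * I) * t) * (symbol α y (σ + w * I) *
        ((y : ℂ) * (α * ((σ : ℂ) + w * I) ^ ((α : ℂ) - 1)))) := by
  refine ((integrable_abs_rpow_mul_exp h0 (q := α - 1) (by linarith)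
    (mul_pos hy (symbolConst_pos h0 h1))).const_mul (Real.exp (σ * t) * (y * α))).mono' ?_ ?_
  · unfold symbol
    exact Measurable.aestronglyMeasurable (by fun_prop)
  · filter_upwards [Measure.ae_ne volume 0] with w hw using
      norm_bromwich_deriv_le h0 h1 hy hσ t hw

/-- Integration by parts along the line: the w-derivative of exp(st) exp(-y s^α) has integral zero,
so the factor t is traded for minus the logarithmic derivative of the symbol. -/
theorem mul_kernel_eq {α y : ℝ} (h0 : 0 < α) (h1 : α < 1) (hy : 0 < y) {σ : ℝ} (hσ : 0 < σ)
    (t : ℝ) : ((t * kernel α y t : ℝ) : ℂ) = (1 / (2 * Real.pi) : ℝ) *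
      ∫ w : ℝ, exp (((σ : ℂ) + w * I) * t) * (symbol α y (σ + w * I) *
        ((y : ℂ) * (α * ((σ : ℂ) + w * I) ^ ((α : ℂ) - 1)))) := by
  have hi1 := integrable_exp_mul_symbol h0 h1 hy hσ t
  have hi2 := integrable_bromwich_deriv h0 h1 hy hσ t
  have hd : ∀ w : ℝ, HasDerivAt (fun w : ℝ => exp (((σ : ℂ) + w * I) * t) * symbol α y (σ + w * I))
      ((I * t) * (exp (((σ : ℂ) + w * I) * t) * symbol α y (σ + w * I)) -
        I * (exp (((σ : ℂ) + w * I) * t) * (symbol α y (σ + w * I) *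
        ((y : ℂ) * (α * ((σ : ℂ) + w * I) ^ ((α : ℂ) - 1)))))) w := by
    intro w
    have hl : HasDerivAt (fun w : ℝ => (σ : ℂ) + w * I) I w := by
      simpa using ((ofRealCLM.hasDerivAt (x := w)).mul_const I).const_add (σ : ℂ)
    have hs := (hasDerivAt_exp_neg_mul_cpow α y (s := σ + w * I) (by simpa using hσ)).comp w hl
    have he := (hl.mul_const (t : ℂ)).cexp
    refine (he.mul hs).congr_deriv ?_
    simp only [symbol, Function.comp_def]
    ring
  have h := integral_eq_zero_of_hasDerivAt_of_integrable hd
    ((hi1.const_mul _).sub (hi2.const_mul _)) hi1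
  rw [integral_sub (hi1.const_mul _) (hi2.const_mul _), integral_const_mul, integral_const_mul,
    mul_assoc, ← mul_sub] at h
  have h' := (mul_eq_zero.1 h).resolve_left I_ne_zero
  rw [sub_eq_zero] at h'
  rw [ofReal_mul, kernel_eq h0 h1 hy hσ, ← h']
  ring

/-- Again on the line Re s = 1/t, now for t h. The factor yα from differentiating the symbol cancels
exactly against ∫ |w|^(α-1) exp(-yc|w|^α) dw = 2/(ycα), so no y remains. -/
theorem abs_kernel_le_inv {α : ℝ} (h0 : 0 < α) (h1 : α < 1) :
    ∃ C, 0 ≤ C ∧ ∀ y t : ℝ, 0 < y → 0 < t → |kernel α y t| ≤ C * t⁻¹ := by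
  have hc := symbolConst_pos h0 h1
  refine ⟨1 / (2 * Real.pi) * (Real.exp 1 * (2 * (symbolConst α)⁻¹)), by positivity,
    fun y t hy ht => ?_⟩
  rw [← div_eq_mul_inv, le_div_iff₀ ht]
  have h := mul_kernel_eq h0 h1 hy (one_div_pos.2 ht) t
  have h2 := integral_abs_rpow_mul_exp (q := α - 1) h0 (by linarith) (mul_pos hy hc)
  have h3 : |t * kernel α y t| ≤ 1 / (2 * Real.pi) * (Real.exp (1 / t * t) * (y * α) *
      ∫ w : ℝ, |w| ^ (α - 1) * Real.exp (-(y * symbolConst α) * |w| ^ α)) := by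
    rw [← Real.norm_eq_abs, ← norm_real, h, norm_mul, norm_real,
      Real.norm_of_nonneg (by positivity), ← integral_const_mul]
    refine mul_le_mul_of_nonneg_left ?_ (by positivity)
    refine norm_integral_le_of_norm_le ((integrable_abs_rpow_mul_exp h0 (q := α - 1) (by linarith)
      (mul_pos hy hc)).const_mul _) ?_
    filter_upwards [Measure.ae_ne volume 0] with w hw using
      norm_bromwich_deriv_le h0 h1 hy (one_div_pos.2 ht) t hw
  rw [h2, one_div_mul_cancel ht.ne', abs_mul, abs_of_pos ht, sub_add_cancel, neg_div,
    div_self h0.ne', Real.rpow_neg_one, Real.Gamma_one] at h3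
  rw [mul_comm]
  refine h3.trans (le_of_eq ?_)
  field_simp

/-- Neither of the two previous bounds is locally integrable on its own: y^(-1/α) fails at y = 0 and
1/t at t = 0. Their geometric mean with weights α/2 and 1 - α/2 has both exponents above -1. -/
theorem abs_kernel_le_mul_rpow {α : ℝ} (h0 : 0 < α) (h1 : α < 1) :
    ∃ C, 0 ≤ C ∧ ∀ y t : ℝ, 0 < y → 0 < t →
      |kernel α y t| ≤ C * (y ^ (-1 / 2 : ℝ) * t ^ (α / 2 - 1)) := by
  obtain ⟨C₁, hC₁, H₁⟩ := abs_kernel_le_rpow h0 h1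
  obtain ⟨C₂, hC₂, H₂⟩ := abs_kernel_le_inv h0 h1
  refine ⟨C₁ ^ (α / 2) * C₂ ^ (1 - α / 2), by positivity, fun y t hy ht => ?_⟩
  have e : |kernel α y t| = |kernel α y t| ^ (α / 2) * |kernel α y t| ^ (1 - α / 2) := by
    rw [← Real.rpow_add' (abs_nonneg _) (by norm_num)]
    simp
  rw [e]
  calc _ ≤ (C₁ * y ^ (-1 / α)) ^ (α / 2) * (C₂ * t⁻¹) ^ (1 - α / 2) := by
        gcongr
        · exact H₁ y t hy ht
        · linarith
        · exact H₂ y t hy ht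
    _ = _ := by
        rw [Real.mul_rpow hC₁ (by positivity), Real.mul_rpow hC₂ (by positivity),
          ← Real.rpow_mul hy.le, Real.inv_rpow ht.le, ← Real.rpow_neg ht.le,
          show -1 / α * (α / 2) = -1 / 2 by field_simp, neg_sub]
        ring

/-! ### The kernels for `α = 1/2` and `α = 1/3` -/

theorem cpow_one_div_pow {n : ℕ} (hn : n ≠ 0) (s : ℂ) :
    (s ^ ((1 / n : ℝ) : ℂ)) ^ n = s := by
  have : ((1 / n : ℝ) : ℂ) = (n : ℂ)⁻¹ := by push_cast; ring
  rw [this, cpow_nat_inv_pow s hn]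

/-- With v = s^(1/n) the factor (1/n) s^(1/n - 1) ds is dv, and the integrand of `mul_kernel_eq`
becomes y exp(t v^n - y v) dv. A primitive `P` then evaluates the truncated integral at its
endpoints; the factor -i comes from dw = -i ds. -/
theorem mul_kernel_eq_tendsto {n : ℕ} (hn : 2 ≤ n) {y t : ℝ} (hy : 0 < y) {P : ℂ → ℂ}
    (hP : ∀ v, HasDerivAt P (exp (t * v ^ n - y * v)) v) :
    Tendsto (fun R : ℝ => (1 / (2 * Real.pi) : ℝ) * (y * -I *
      (P ((1 + R * I : ℂ) ^ ((1 / n : ℝ) : ℂ)) - P ((1 + (-R : ℝ) * I : ℂ) ^ ((1 / n : ℝ) : ℂ)))))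
      atTop (𝓝 ((t * kernel (1 / n) y t : ℝ) : ℂ)) := by
  have hn' : (2 : ℝ) ≤ n := by exact_mod_cast hn
  have h0 : (0 : ℝ) < 1 / n := by positivity
  have h1 : (1 : ℝ) / n < 1 := by rw [div_lt_one (by linarith)]; linarith
  have hi := integrable_bromwich_deriv h0 h1 hy one_pos t
  rw [mul_kernel_eq h0 h1 hy one_pos t]
  refine Tendsto.const_mul _ ?_
  refine (intervalIntegral_tendsto_integral hi tendsto_neg_atTop_atBot tendsto_id).congr fun R => ?_
  have hd : ∀ w : ℝ, HasDerivAt (fun w : ℝ => (y * -I) * P ((1 + w * I : ℂ) ^ ((1 / n : ℝ) : ℂ)))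
      (exp ((((1 : ℝ) : ℂ) + w * I) * t) * (symbol (1 / n) y ((1 : ℝ) + w * I) *
        ((y : ℂ) * (((1 / n : ℝ) : ℂ) * (((1 : ℝ) : ℂ) + w * I) ^ (((1 / n : ℝ) : ℂ) - 1))))) w := by
    intro w
    have hl : HasDerivAt (fun w : ℝ => (1 : ℂ) + w * I) I w := by
      simpa using ((ofRealCLM.hasDerivAt (x := w)).mul_const I).const_add (1 : ℂ)
    have hp : HasDerivAt (fun s : ℂ => s ^ ((1 / n : ℝ) : ℂ)) _ (1 + w * I : ℂ) :=
      (hasDerivAt_id (1 + w * I : ℂ)).cpow_const (c := ((1 / n : ℝ) : ℂ)) (Or.inl (by simp))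
    have h3 := ((hP _).comp _ hp).comp w hl
    refine (h3.const_mul (y * -I)).congr_deriv ?_
    simp only [id, cpow_one_div_pow (by omega : n ≠ 0), symbol, ofReal_one, mul_one]
    rw [show (t : ℂ) * (1 + w * I) - y * (1 + w * I) ^ ((1 / n : ℝ) : ℂ)
      = (1 + w * I) * t + -y * (1 + w * I) ^ ((1 / n : ℝ) : ℂ) by ring, exp_add]
    linear_combination (-(y : ℂ) * (exp ((1 + w * I) * t) * exp (-y * (1 + w * I) ^ ((1 / n : ℝ) : ℂ))
      * (((1 / n : ℝ) : ℂ) * (1 + w * I) ^ (((1 / n : ℝ) : ℂ) - 1)))) * I_mul_I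
  have h := intervalIntegral.integral_eq_sub_of_hasDerivAt (a := -R) (b := R)
    (fun w _ => hd w) hi.intervalIntegrable
  simp only [id]
  rw [h]
  ring

theorem norm_sub_le_of_horizontal {P E : ℂ → ℂ} (hP : ∀ v, HasDerivAt P (E v) v) {c p q B : ℝ}
    (hcp : c ≤ p) (hB : ∀ x ∈ Icc c p, ‖E (x + q * I)‖ ≤ B) :
    ‖P (p + q * I) - P (c + q * I)‖ ≤ B * (p - c) := by
  refine norm_image_sub_le_of_norm_deriv_le_segment' (f := fun x : ℝ => P (x + q * I))
    (f' := fun x : ℝ => E (x + q * I)) (a := c) (b := p) (fun x _ => ?_)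
    (fun x hx => hB x ⟨hx.1, hx.2.le⟩) p (right_mem_Icc.2 hcp)
  have hl : HasDerivAt (fun x : ℝ => (x + q * I : ℂ)) 1 x := by
    simpa using (ofRealCLM.hasDerivAt (x := x)).add_const (q * I : ℂ)
  exact (((hP _).comp x hl).congr_deriv (mul_one _)).hasDerivWithinAt

/-- The image of Re s = 1 under s^(1/n) is a curve on which Re v^n = 1, with endpoints p ± iq as s =
1 ± iR. They are joined to the line Re v = c by horizontal segments. `hE` makes the integrand
exponentially small there, and `hq` forces q → ∞ so that the vertical segments exhaust the line.
Only p → ∞ matters, hence the harmless restriction p ≥ 4. -/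
theorem kernel_eq_integral_vertical {n : ℕ} (hn : 2 ≤ n) {y t c K d : ℝ} (hy : 0 < y)
    (ht : 0 < t) (hd : 0 < d)
    (hE : ∀ p q x : ℝ, 4 ≤ p → (((p + q * I : ℂ)) ^ n).re = 1 → x ∈ Icc c p →
      ‖exp (t * (x + q * I : ℂ) ^ n - y * (x + q * I : ℂ))‖ ≤ K * Real.exp (-d * p))
    (hq : ∀ p q : ℝ, 4 ≤ p → 0 ≤ q → (((p + q * I : ℂ)) ^ n).re = 1 → p / 4 ≤ q)
    (hint : Integrable fun w : ℝ => exp (t * (c + w * I : ℂ) ^ n - y * (c + w * I : ℂ))) :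
    ((kernel (1 / n) y t : ℝ) : ℂ) = (y / t : ℝ) * ((1 / (2 * Real.pi) : ℝ) *
      ∫ w : ℝ, exp (t * (c + w * I : ℂ) ^ n - y * (c + w * I : ℂ))) := by
  set E : ℂ → ℂ := fun v => exp (t * v ^ n - y * v) with hEdef
  -- An entire function has a primitive, so deforming the contour reduces to comparing values of
  -- `P`.
  obtain ⟨P, hP⟩ := (by fun_prop : Differentiable ℂ E).isExactOn_univ
  replace hP : ∀ v, HasDerivAt P (E v) v := fun v => hP v (mem_univ v)
  have hlim := mul_kernel_eq_tendsto hn hy hP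
  set γ : ℝ → ℂ := fun R => (1 + R * I : ℂ) ^ ((1 / n : ℝ) : ℂ) with hγ
  have hn' : (2 : ℝ) ≤ n := by exact_mod_cast hn
  have h0 : (0 : ℝ) < 1 / n := by positivity
  have h1 : (1 : ℝ) / n < 1 := by rw [div_lt_one (by linarith)]; linarith
  have hconj : ∀ R : ℝ, γ (-R) = (γ R).re + (-(γ R).im : ℝ) * I := by
    intro R
    have h := conj_cpow_ofReal (1 / n) (s := 1 + R * I) (by simp)
    have h2 : (starRingEnd ℂ) (1 + R * I : ℂ) = 1 + (-R : ℝ) * I := by simp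
    rw [h2] at h
    simp only [hγ]
    rw [← h]
    apply Complex.ext <;> simp
  have hpow : ∀ R : ℝ, ((((γ R).re : ℂ) + (γ R).im * I) ^ n).re = 1 := by
    intro R
    rw [re_add_im, hγ, cpow_one_div_pow (by omega)]
    simp
  have hpow' : ∀ R : ℝ, ((((γ R).re : ℂ) + (-(γ R).im : ℝ) * I) ^ n).re = 1 := by
    intro R
    rw [← hconj, hγ, cpow_one_div_pow (by omega)]
    simp
  have hre : Tendsto (fun R => (γ R).re) atTop atTop := by
    have h2 : Tendsto (fun R : ℝ => symbolConst (1 / n) * R ^ (1 / n : ℝ)) atTop atTop :=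
      (tendsto_rpow_atTop h0).const_mul_atTop (symbolConst_pos h0 h1)
    refine tendsto_atTop_mono' _ ?_ h2
    filter_upwards [eventually_ge_atTop 0] with R hR
    refine le_trans ?_ (symbolConst_mul_le_re_cpow h0 h1 (s := 1 + R * I) (by simp))
    refine mul_le_mul_of_nonneg_left ?_ (symbolConst_pos h0 h1).le
    gcongr
    calc R ≤ |R| := le_abs_self R
      _ = |(1 + R * I : ℂ).im| := by simp
      _ ≤ _ := abs_im_le_norm _
  have him0 : ∀ R : ℝ, 0 ≤ R → 0 ≤ (γ R).im := by
    intro R hR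
    have h3 : (γ R).im = ‖(1 + R * I : ℂ)‖ ^ (1 / n : ℝ) *
      Real.sin (arg (1 + R * I) * (1 / n : ℝ)) := cpow_ofReal_im _ _
    rw [h3]
    refine mul_nonneg (by positivity) (Real.sin_nonneg_of_nonneg_of_le_pi ?_ ?_)
    · exact mul_nonneg (arg_nonneg_iff.2 (by simpa using hR)) h0.le
    · calc _ ≤ Real.pi * 1 := mul_le_mul (arg_le_pi _) h1.le h0.le Real.pi_pos.le
        _ = _ := mul_one _
  have him : Tendsto (fun R => (γ R).im) atTop atTop := by
    refine tendsto_atTop_mono' _ ?_ (hre.atTop_div_const (by norm_num : (0 : ℝ) < 4))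
    filter_upwards [hre.eventually_ge_atTop 4, eventually_ge_atTop 0] with R hR hR0
    exact hq _ _ hR (him0 R hR0) (hpow R)
  have hvert : Tendsto (fun R => P (c + (γ R).im * I) - P (c + (-(γ R).im : ℝ) * I)) atTop
      (𝓝 (I * ∫ w : ℝ, E (c + w * I))) := by
    refine (((intervalIntegral_tendsto_integral hint (tendsto_neg_atTop_atBot.comp him)
      him)).const_mul I).congr fun R => ?_
    have hdv : ∀ w : ℝ, HasDerivAt (fun w : ℝ => P (c + w * I)) (I * E (c + w * I)) w := by
      intro w
      have hl : HasDerivAt (fun w : ℝ => (c : ℂ) + w * I) I w := by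
        simpa using ((ofRealCLM.hasDerivAt (x := w)).mul_const I).const_add (c : ℂ)
      exact ((hP _).comp w hl).congr_deriv (by ring)
    rw [← intervalIntegral.integral_const_mul]
    exact intervalIntegral.integral_eq_sub_of_hasDerivAt (fun w _ => hdv w)
      (hint.const_mul I).intervalIntegrable
  have hsmall : Tendsto (fun R => K * Real.exp (-d * (γ R).re) * ((γ R).re - c)) atTop (𝓝 0) := by
    have e1 : Tendsto (fun x : ℝ => x * Real.exp (-d * x)) atTop (𝓝 0) := by
      simpa using Real.tendsto_pow_mul_exp_neg_atTop_nhds_zero 1 |>.comp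
        (tendsto_id.const_mul_atTop hd) |>.const_mul (1 / d) |>.congr (fun x => by
          simp only [Function.comp_apply, pow_one, id]; field_simp)
    have e2 : Tendsto (fun x : ℝ => Real.exp (-d * x)) atTop (𝓝 0) :=
      Real.tendsto_exp_atBot.comp (tendsto_id.const_mul_atTop_of_neg (by linarith))
    have e3 := ((e1.sub (e2.mul_const c)).const_mul K).comp hre
    simp only [zero_mul, sub_zero, mul_zero] at e3
    refine e3.congr fun R => ?_
    simp only [Function.comp_apply]; ring
  have htop : Tendsto (fun R => P (γ R) - P (c + (γ R).im * I)) atTop (𝓝 0) := by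
    refine squeeze_zero_norm' ?_ hsmall
    filter_upwards [hre.eventually_ge_atTop 4, hre.eventually_ge_atTop c] with R hR hR2
    have := norm_sub_le_of_horizontal hP (q := (γ R).im) hR2 (fun x hx => hE _ _ x hR (hpow R) hx)
    rwa [re_add_im] at this
  have hbot : Tendsto (fun R => P (γ (-R)) - P (c + (-(γ R).im : ℝ) * I)) atTop (𝓝 0) := by
    refine squeeze_zero_norm' ?_ hsmall
    filter_upwards [hre.eventually_ge_atTop 4, hre.eventually_ge_atTop c] with R hR hR2
    have := norm_sub_le_of_horizontal hP (q := -(γ R).im) hR2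
      (fun x hx => hE _ _ x hR (hpow' R) hx)
    rwa [← hconj] at this
  have hall : Tendsto (fun R => P (γ R) - P (γ (-R))) atTop (𝓝 (I * ∫ w : ℝ, E (c + w * I))) := by
    have := (htop.add hvert).sub hbot
    simp only [zero_add, sub_zero] at this
    refine this.congr fun R => ?_
    ring
  have := tendsto_nhds_unique hlim ((hall.const_mul (y * -I : ℂ)).const_mul _)
  have htc : (t : ℂ) ≠ 0 := by exact_mod_cast ht.ne'
  rw [ofReal_mul] at this
  rw [ofReal_div, div_mul_eq_mul_div, eq_div_iff htc, mul_comm, this]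
  linear_combination -(((1 / (2 * Real.pi) : ℝ) : ℂ) * y * (∫ w : ℝ, E (c + w * I))) * I_mul_I

/-- On the imaginary axis exp(tv² - yv) is a Gaussian times a character, whose integral is explicit.
-/
theorem kernel_one_half {y t : ℝ} (hy : 0 < y) (ht : 0 < t) :
    kernel (1 / 2) y t
      = y / (2 * √Real.pi * t ^ (3 / 2 : ℝ)) * Real.exp (-(y ^ 2) / (4 * t)) := by
  have hEq : ∀ w : ℝ, exp (t * ((0 : ℝ) + w * I : ℂ) ^ 2 - y * ((0 : ℝ) + w * I : ℂ))
      = exp (I * (-y : ℝ) * w) * exp (-(t : ℂ) * w ^ 2) := by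
    intro w
    rw [← exp_add]
    congr 1
    push_cast
    linear_combination (t : ℂ) * w ^ 2 * I_sq
  have hE : ∀ x q : ℝ, ‖exp (t * (x + q * I : ℂ) ^ 2 - y * (x + q * I : ℂ))‖
      = Real.exp (t * (x ^ 2 - q ^ 2) - y * x) := by
    intro x q
    rw [norm_exp]
    congr 1
    simp [pow_two]
  have hr : ∀ p q : ℝ, ((p + q * I : ℂ) ^ 2).re = p ^ 2 - q ^ 2 := by
    intro p q; simp [pow_two]
  have h := kernel_eq_integral_vertical le_rfl (c := 0) (K := Real.exp t)
    (d := min t (y / 2)) hy ht (lt_min ht (by linarith)) ?_ ?_ ?_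
  · simp_rw [hEq] at h
    rw [fourierIntegral_gaussian (by simpa using ht)] at h
    have e1 : ((Real.pi : ℂ) / t) ^ (1 / 2 : ℂ) = ((√Real.pi / √t : ℝ) : ℂ) := by
      rw [← Real.sqrt_div Real.pi_pos.le, Real.sqrt_eq_rpow, ofReal_cpow (by positivity)]
      push_cast; rfl
    have e2 : exp (-((-y : ℝ) : ℂ) ^ 2 / (4 * t)) = (Real.exp (-(y ^ 2) / (4 * t)) : ℝ) := by
      push_cast; ring_nf
    rw [e1, e2] at h
    have h' : kernel (1 / 2) y t = y / t * (1 / (2 * Real.pi) * (√Real.pi / √t *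
        Real.exp (-(y ^ 2) / (4 * t)))) := by exact_mod_cast h
    have e3 : t ^ (3 / 2 : ℝ) = t * √t := by
      rw [Real.sqrt_eq_rpow, ← Real.rpow_one_add' ht.le (by norm_num)]; norm_num
    have e4 : Real.pi = √Real.pi * √Real.pi := (Real.mul_self_sqrt Real.pi_pos.le).symm
    rw [h', e3]
    have : 0 < √t := Real.sqrt_pos.2 ht
    have : 0 < √Real.pi := Real.sqrt_pos.2 Real.pi_pos
    generalize Real.exp (-(y ^ 2) / (4 * t)) = A
    conv_lhs => rw [show 1 / (2 * Real.pi) = 1 / (2 * (√Real.pi * √Real.pi)) by rw [← e4]]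
    field_simp
  · intro p q x hp hpq hx
    rw [hr] at hpq
    rw [hE, ← Real.exp_add, Real.exp_le_exp]
    obtain ⟨hx0, hxp⟩ := hx
    have m1 := min_le_left t (y / 2)
    have m2 := min_le_right t (y / 2)
    have hm : 0 < min t (y / 2) := lt_min ht (by linarith)
    -- Here p² - q² = 1, so x² - q² = 1 - (p² - x²). In the left half of the segment this is at most
    -- 1 - p and gives the rate t; in the right half exp(-yx) gives the rate y/2. The leftover 1
    -- accounts for K = exp t.
    rcases le_total x (p / 2) with hx2 | hx2
    · have : x ^ 2 - q ^ 2 ≤ 1 - p := by nlinarith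
      nlinarith [mul_le_mul_of_nonneg_left this ht.le, mul_nonneg hy.le hx0]
    · have : x ^ 2 - q ^ 2 ≤ 1 := by nlinarith
      nlinarith [mul_le_mul_of_nonneg_left this ht.le]
  · intro p q hp hq hpq
    rw [hr] at hpq
    nlinarith
  · simp_rw [hEq]
    have hg : Integrable fun w : ℝ => exp (-(t : ℂ) * w ^ 2) :=
      integrable_cexp_neg_mul_sq (by simpa using ht)
    refine hg.bdd_mul (c := 1) (Continuous.aestronglyMeasurable (by fun_prop))
      (ae_of_all _ fun w => ?_)
    rw [norm_exp]; simp

/-- The scaling v ↦ v/b with b³ = 3t turns tv³ into v³/3 and the line Re v = 1/b into the line Re v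
= 1 of the Airy integral. -/
theorem kernel_one_third {y t : ℝ} (hy : 0 < y) (ht : 0 < t) :
    kernel (1 / 3) y t
      = y / ((3 : ℝ) ^ (1 / 3 : ℝ) * t ^ (4 / 3 : ℝ))
          * airyAi (y / ((3 : ℝ) ^ (1 / 3 : ℝ) * t ^ (1 / 3 : ℝ))) := by
  set b : ℝ := (3 : ℝ) ^ (1 / 3 : ℝ) * t ^ (1 / 3 : ℝ) with hb
  have hb0 : 0 < b := by positivity
  have hb3 : b ^ 3 = 3 * t := by
    rw [hb, mul_pow, ← Real.rpow_natCast, ← Real.rpow_natCast, ← Real.rpow_mul (by norm_num),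
      ← Real.rpow_mul ht.le]
    norm_num
  have hr : ∀ p q : ℝ, ((p + q * I : ℂ) ^ 3).re = p ^ 3 - 3 * p * q ^ 2 := by
    intro p q; simp [pow_succ]; ring
  have hE : ∀ x q : ℝ, ‖exp (t * (x + q * I : ℂ) ^ 3 - y * (x + q * I : ℂ))‖
      = Real.exp (t * (x ^ 3 - 3 * x * q ^ 2) - y * x) := by
    intro x q
    rw [norm_exp, sub_re, re_ofReal_mul, re_ofReal_mul, hr]
    simp
  have hc : 0 < b⁻¹ := inv_pos.2 hb0
  have h := kernel_eq_integral_vertical (n := 3) (by norm_num) (c := b⁻¹) (K := Real.exp t)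
    (d := min (t * b⁻¹) (y / 2)) hy ht (lt_min (by positivity) (by linarith)) ?_ ?_ ?_
  · have hs := Measure.integral_comp_mul_left (fun w : ℝ =>
      exp (t * (((b⁻¹ : ℝ) : ℂ) + w * I) ^ 3 - y * (((b⁻¹ : ℝ) : ℂ) + w * I))) b⁻¹
    rw [inv_inv, abs_of_pos hb0] at hs
    have hs2 : ∀ w : ℝ, exp (t * (((b⁻¹ : ℝ) : ℂ) + (b⁻¹ * w : ℝ) * I) ^ 3
        - y * (((b⁻¹ : ℝ) : ℂ) + (b⁻¹ * w : ℝ) * I))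
        = exp ((1 + (w : ℂ) * I) ^ 3 / 3 - ((y / b : ℝ) : ℂ) * (1 + (w : ℂ) * I)) := by
      intro w
      have hb3c : (b : ℂ) ^ 3 = 3 * t := by exact_mod_cast hb3
      have hbc : (b : ℂ) ≠ 0 := by exact_mod_cast hb0.ne'
      have htc : (t : ℂ) * ((b : ℂ)⁻¹) ^ 3 = 1 / 3 := by
        rw [inv_pow, hb3c]
        have : (t : ℂ) ≠ 0 := by exact_mod_cast ht.ne'
        field_simp
      congr 1
      push_cast
      rw [div_eq_mul_inv (y : ℂ)]
      linear_combination (1 + (w : ℂ) * I) ^ 3 * htc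
    simp_rw [hs2] at hs
    have hai : kernel (1 / 3) y t = y / t * b⁻¹ * airyAi (y / b) := by
      have h' := congrArg re h
      rw [ofReal_re] at h'
      rw [show ((3 : ℕ) : ℝ) = 3 by norm_num] at h'
      rw [h', airyAi, hs, real_smul, ← re_ofReal_mul]
      congr 1
      have hbc : (b : ℂ) ≠ 0 := by exact_mod_cast hb0.ne'
      generalize (∫ w : ℝ, exp (t * (((b⁻¹ : ℝ) : ℂ) + w * I) ^ 3
        - y * (((b⁻¹ : ℝ) : ℂ) + w * I))) = A
      push_cast
      field_simp
    have ht4 : t ^ (4 / 3 : ℝ) = t * t ^ (1 / 3 : ℝ) := by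
      rw [← Real.rpow_one_add' ht.le (by norm_num)]; norm_num
    rw [hai, ht4, show (3 : ℝ) ^ (1 / 3 : ℝ) * (t * t ^ (1 / 3 : ℝ)) = t * b by rw [hb]; ring]
    field_simp
  · intro p q x hp hpq hx
    rw [hr] at hpq
    rw [hE, ← Real.exp_add, Real.exp_le_exp]
    obtain ⟨hx0, hxp⟩ := hx
    have m1 := min_le_left (t * b⁻¹) (y / 2)
    have m2 := min_le_right (t * b⁻¹) (y / 2)
    have hx1 : 0 < x := hc.trans_le hx0
    -- Eliminating q through p³ - 3pq² = 1 leaves x/p - x(p - x)(p + x); then x ≤ p and p + x ≥ p.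
    have key : x ^ 3 - 3 * x * q ^ 2 ≤ 1 - x * p * (p - x) := by
      have hp0 : 0 < p := by linarith
      have e : p * (x ^ 3 - 3 * x * q ^ 2) = x - x * p * (p - x) * (p + x) := by
        linear_combination x * hpq
      refine le_of_mul_le_mul_left ?_ hp0
      rw [e]
      nlinarith [mul_nonneg (mul_nonneg hx1.le hp0.le) (sub_nonneg.2 hxp),
        mul_nonneg (mul_nonneg (mul_nonneg hx1.le hp0.le) (sub_nonneg.2 hxp)) hx1.le]
    have key2 := mul_le_mul_of_nonneg_left key ht.le
    -- In the left half x ≥ 1/b and p - x ≥ 1 give the rate t/b; in the right half exp(-yx) gives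
    -- the rate y/2.
    rcases le_total x (p / 2) with hx2 | hx2
    · have e1 : b⁻¹ * p ≤ x * p * (p - x) := by
        have : 1 ≤ p - x := by linarith
        have h2 : b⁻¹ * p ≤ x * p := mul_le_mul_of_nonneg_right hx0 (by linarith)
        nlinarith [mul_nonneg hx1.le (by linarith : (0 : ℝ) ≤ p)]
      have e2 := mul_le_mul_of_nonneg_left e1 ht.le
      have e3 := mul_le_mul_of_nonneg_right m1 (by linarith : (0 : ℝ) ≤ p)
      nlinarith [mul_pos hy hx1]
    · have e1 : 0 ≤ x * p * (p - x) :=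
        mul_nonneg (mul_nonneg hx1.le (by linarith)) (by linarith)
      have e3 := mul_le_mul_of_nonneg_right m2 (by linarith : (0 : ℝ) ≤ p)
      nlinarith [mul_nonneg ht.le e1]
  · intro p q hp hq hpq
    rw [hr] at hpq
    have : p * (p ^ 2 - 3 * q ^ 2) ≤ p * 1 := by nlinarith
    have := le_of_mul_le_mul_left this (by linarith)
    nlinarith
  · have hg := (integrable_exp_neg_mul_sq (b := 3 * t * b⁻¹) (by positivity)).const_mul
      (Real.exp (t * b⁻¹ ^ 3 - y * b⁻¹))
    refine hg.mono' (Continuous.aestronglyMeasurable (by fun_prop)) (ae_of_all _ fun w => ?_)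
    rw [hE, ← Real.exp_add]
    apply le_of_eq
    congr 1
    ring

end FracAdvection

namespace FracAdvection

open Filter Topology

/-! ### The adjoint operator on test functions -/

/-- The formal adjoint of `∂_t + a ∂_x + ε D^α`. -/
def adjointOp (α a ε : ℝ) (φ : ℝ × ℝ → ℝ) (p : ℝ × ℝ) : ℝ :=
  -(deriv (fun t => φ (p.1, t)) p.2) - a * deriv (fun x => φ (x, p.2)) p.1
    + ε * caputoAdjoint α (fun t => φ (p.1, t)) p.2

/-- The time derivative. -/
def dt (φ : ℝ × ℝ → ℝ) (p : ℝ × ℝ) : ℝ := fderiv ℝ φ p (0, 1)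

/-- The space derivative. -/
def dx (φ : ℝ × ℝ → ℝ) (p : ℝ × ℝ) : ℝ := fderiv ℝ φ p (1, 0)

/-- The fractional integral `∫_0^∞ r^(-α) q(x, t + r) dr`. -/
def fracInt (α : ℝ) (q : ℝ × ℝ → ℝ) (p : ℝ × ℝ) : ℝ :=
  ∫ r in Ioi (0 : ℝ), r ^ (-α) * q (p + (0, r))

theorem hasDerivAt_snd {φ : ℝ × ℝ → ℝ} (hφ : Differentiable ℝ φ) (x t : ℝ) :
    HasDerivAt (fun t => φ (x, t)) (dt φ (x, t)) t :=
  (hφ (x, t)).hasFDerivAt.comp_hasDerivAt t ((hasDerivAt_const t x).prodMk (hasDerivAt_id t))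

theorem hasDerivAt_fst {φ : ℝ × ℝ → ℝ} (hφ : Differentiable ℝ φ) (x t : ℝ) :
    HasDerivAt (fun x => φ (x, t)) (dx φ (x, t)) x :=
  (hφ (x, t)).hasFDerivAt.comp_hasDerivAt x ((hasDerivAt_id x).prodMk (hasDerivAt_const x t))

theorem contDiff_dt {φ : ℝ × ℝ → ℝ} (hφ : ContDiff ℝ ∞ φ) : ContDiff ℝ ∞ (dt φ) :=
  (hφ.fderiv_right (by simp)).clm_apply contDiff_const

theorem contDiff_dx {φ : ℝ × ℝ → ℝ} (hφ : ContDiff ℝ ∞ φ) : ContDiff ℝ ∞ (dx φ) :=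
  (hφ.fderiv_right (by simp)).clm_apply contDiff_const

theorem hasCompactSupport_dt {φ : ℝ × ℝ → ℝ} (hφ : HasCompactSupport φ) :
    HasCompactSupport (dt φ) := hφ.fderiv_apply ℝ _

theorem hasCompactSupport_dx {φ : ℝ × ℝ → ℝ} (hφ : HasCompactSupport φ) :
    HasCompactSupport (dx φ) := hφ.fderiv_apply ℝ _

/-- The substitution s = t + r puts the fractional term in a form that visibly commutes with
translations. -/
theorem adjointOp_eq (α a ε : ℝ) {φ : ℝ × ℝ → ℝ} (hφ : Differentiable ℝ φ) (p : ℝ × ℝ) :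
    adjointOp α a ε φ p
      = -dt φ p - a * dx φ p - ε / Real.Gamma (1 - α) * fracInt α (dt φ) p := by
  obtain ⟨x, t⟩ := p
  have h1 : ∀ t, deriv (fun t => φ (x, t)) t = dt φ (x, t) :=
    fun t => (hasDerivAt_snd hφ x t).deriv
  simp only [adjointOp, caputoAdjoint, fracInt, h1, (hasDerivAt_fst hφ x t).deriv]
  have := integral_Ioi_shift (fun s => (s - t) ^ (-α) * dt φ (x, s)) 0 t
  simp only [add_sub_cancel_right, zero_add] at this
  rw [← this]
  simp only [Prod.mk_add_mk, add_zero, add_comm t]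
  ring

theorem dt_comp_add (φ : ℝ × ℝ → ℝ) (v p : ℝ × ℝ) :
    dt (fun p => φ (p + v)) p = dt φ (p + v) := by
  simp only [dt, fderiv_comp_add_right]

theorem dx_comp_add (φ : ℝ × ℝ → ℝ) (v p : ℝ × ℝ) :
    dx (fun p => φ (p + v)) p = dx φ (p + v) := by
  simp only [dx, fderiv_comp_add_right]

theorem adjointOp_comp_add (α a ε : ℝ) {φ : ℝ × ℝ → ℝ} (hφ : Differentiable ℝ φ)
    (v p : ℝ × ℝ) :
    adjointOp α a ε (fun p => φ (p + v)) p = adjointOp α a ε φ (p + v) := by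
  have hφ' : Differentiable ℝ fun p => φ (p + v) := hφ.comp (differentiable_id.add_const v)
  rw [adjointOp_eq _ _ _ hφ, adjointOp_eq _ _ _ hφ',
    dt_comp_add, dx_comp_add, fracInt, fracInt]
  simp_rw [dt_comp_add, add_right_comm]

/-- Only the values at later times matter. -/
theorem adjointOp_congr (α a ε : ℝ) {φ ψ : ℝ × ℝ → ℝ} {τ : ℝ}
    (h : ∀ p : ℝ × ℝ, τ < p.2 → φ p = ψ p) {p : ℝ × ℝ} (hp : τ < p.2) :
    adjointOp α a ε φ p = adjointOp α a ε ψ p := by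
  have h1 : ∀ t, τ < t → deriv (fun t => φ (p.1, t)) t = deriv (fun t => ψ (p.1, t)) t := by
    intro t ht
    refine Filter.EventuallyEq.deriv_eq ?_
    filter_upwards [lt_mem_nhds ht] with s hs using h (p.1, s) hs
  have h2 : (fun x => φ (x, p.2)) = fun x => ψ (x, p.2) := funext fun x => h (x, p.2) hp
  simp only [adjointOp, caputoAdjoint]
  rw [h1 _ hp, h2]
  congr 4
  refine setIntegral_congr_fun measurableSet_Ioi fun s hs => ?_
  simp only [h1 s (hp.trans hs)]

/-- The bound must be uniform in p, although the fractional integral has a tail towards t → -∞. For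
r ≤ 1 the singularity is integrable; for r > 1 the weight is at most 1, and the compact support
confines r to an interval of length 2T wherever p is. -/
theorem exists_fracInt_bound {α : ℝ} (h0 : 0 < α) (h1 : α < 1) {q : ℝ × ℝ → ℝ} (hq : Continuous q)
    (hs : HasCompactSupport q) :
    ∃ m : ℝ, (∀ p, IntegrableOn (fun r : ℝ => r ^ (-α) * q (p + (0, r))) (Ioi 0)) ∧
      ∀ p, ∫ r in Ioi (0 : ℝ), |r ^ (-α) * q (p + (0, r))| ≤ m := by
  obtain ⟨N, hN⟩ := hs.exists_bound_of_continuous hq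
  have hN0 : 0 ≤ N := (norm_nonneg _).trans (hN 0)
  obtain ⟨T, hT⟩ := hs.isCompact.isBounded.subset_closedBall 0
  have hT' : ∀ p, q p ≠ 0 → |p.2| ≤ T := fun p hp => by
    have := hT (subset_tsupport q hp)
    rw [mem_closedBall_zero_iff] at this
    exact (norm_snd_le p).trans this
  let b : ℝ → ℝ → ℝ := fun t r => N * ((Ioc (0 : ℝ) 1).indicator (fun r => r ^ (-α)) r +
    (Icc (-T - t) (T - t)).indicator (fun _ => 1) r)
  have hi1 : Integrable ((Ioc (0 : ℝ) 1).indicator (fun r : ℝ => r ^ (-α))) := by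
    rw [integrable_indicator_iff measurableSet_Ioc,
      ← intervalIntegrable_iff_integrableOn_Ioc_of_le zero_le_one]
    exact intervalIntegral.intervalIntegrable_rpow' (by linarith)
  have hi2 : ∀ t, Integrable ((Icc (-T - t) (T - t)).indicator (fun _ => (1 : ℝ))) := fun t => by
    rw [integrable_indicator_iff measurableSet_Icc]
    simp
  have hb : ∀ t, Integrable (b t) := fun t => (hi1.add (hi2 t)).const_mul N
  have hle : ∀ p : ℝ × ℝ, ∀ r ∈ Ioi (0 : ℝ), ‖r ^ (-α) * q (p + (0, r))‖ ≤ b p.2 r := by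
    intro p r hr
    have hr0 : (0 : ℝ) ≤ r ^ (-α) := Real.rpow_nonneg (le_of_lt hr) _
    have n1 : 0 ≤ (Ioc (0 : ℝ) 1).indicator (fun r : ℝ => r ^ (-α)) r :=
      indicator_nonneg (fun x hx => Real.rpow_nonneg hx.1.le _) _
    have n2 : 0 ≤ (Icc (-T - p.2) (T - p.2)).indicator (fun _ => (1 : ℝ)) r :=
      indicator_nonneg (fun x hx => zero_le_one) _
    by_cases hz : q (p + (0, r)) = 0
    · rw [hz, mul_zero, norm_zero]
      positivity
    · have hm : r ∈ Icc (-T - p.2) (T - p.2) := by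
        have := abs_le.1 (hT' _ hz)
        simp only [Prod.snd_add] at this
        constructor <;> linarith [this.1, this.2]
      rw [norm_mul, mul_comm, Real.norm_of_nonneg hr0]
      refine mul_le_mul (hN _) ?_ hr0 hN0
      rw [indicator_of_mem hm]
      rcases le_or_gt r 1 with h | h
      · rw [indicator_of_mem (mem_Ioc.2 ⟨hr, h⟩)]
        linarith
      · have := Real.rpow_le_one_of_one_le_of_nonpos h.le (by linarith : -α ≤ 0)
        linarith
  have hint : ∀ p : ℝ × ℝ, IntegrableOn (fun r : ℝ => r ^ (-α) * q (p + (0, r))) (Ioi 0) := by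
    intro p
    refine (hb p.2).integrableOn.mono' ?_
      ((ae_restrict_iff' measurableSet_Ioi).2 (ae_of_all _ (hle p)))
    have := hq.measurable
    exact Measurable.aestronglyMeasurable (by fun_prop)
  refine ⟨N * ((∫ r, (Ioc (0 : ℝ) 1).indicator (fun r : ℝ => r ^ (-α)) r) + max (2 * T) 0), hint,
    fun p => ?_⟩
  have hb0 : ∀ r, 0 ≤ b p.2 r := fun r => mul_nonneg hN0 (add_nonneg
    (indicator_nonneg (fun x hx => Real.rpow_nonneg hx.1.le _) _)
    (indicator_nonneg (fun x hx => zero_le_one) _))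
  calc ∫ r in Ioi (0 : ℝ), |r ^ (-α) * q (p + (0, r))| ≤ ∫ r in Ioi (0 : ℝ), b p.2 r :=
        setIntegral_mono_on (hint p).abs (hb p.2).integrableOn measurableSet_Ioi (hle p)
    _ ≤ ∫ r, b p.2 r := setIntegral_le_integral (hb p.2) (ae_of_all _ hb0)
    _ = _ := by
        simp only [b]
        rw [integral_const_mul, integral_add hi1 (hi2 _), integral_indicator measurableSet_Icc]
        simp only [integral_const, smul_eq_mul, mul_one, MeasurableSet.univ, measureReal_restrict_apply,
          univ_inter, Real.volume_real_Icc]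
        rw [show T - p.2 - (-T - p.2) = 2 * T by ring]

theorem measurable_fracInt (α : ℝ) {q : ℝ × ℝ → ℝ} (hq : Continuous q) :
    Measurable (fracInt α q) := by
  have h : Measurable fun z : (ℝ × ℝ) × ℝ => z.2 ^ (-α) * q (z.1 + (0, z.2)) := by
    have := hq.measurable
    fun_prop
  exact (h.stronglyMeasurable.integral_prod_right (ν := volume.restrict (Ioi 0))).measurable

theorem measurable_adjointOp (α a ε : ℝ) {φ : ℝ × ℝ → ℝ} (hφ : ContDiff ℝ ∞ φ) :
    Measurable (adjointOp α a ε φ) := by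
  rw [funext (adjointOp_eq α a ε (hφ.differentiable (by simp)))]
  have h1 := (contDiff_dt hφ).continuous.measurable
  have h2 := (contDiff_dx hφ).continuous.measurable
  have h3 := measurable_fracInt α (contDiff_dt hφ).continuous
  fun_prop

theorem exists_adjointOp_bound {α : ℝ} (a ε : ℝ) (h0 : 0 < α) (h1 : α < 1) {φ : ℝ × ℝ → ℝ}
    (hφ : ContDiff ℝ ∞ φ) (hs : HasCompactSupport φ) :
    ∃ m, ∀ p, |adjointOp α a ε φ p| ≤ m := by
  obtain ⟨m₁, hm₁⟩ := (hasCompactSupport_dt hs).exists_bound_of_continuous (contDiff_dt hφ).continuous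
  obtain ⟨m₂, hm₂⟩ := (hasCompactSupport_dx hs).exists_bound_of_continuous (contDiff_dx hφ).continuous
  obtain ⟨m₃, -, hm₃⟩ := exists_fracInt_bound h0 h1 (contDiff_dt hφ).continuous
    (hasCompactSupport_dt hs)
  refine ⟨m₁ + |a| * m₂ + |ε / Real.Gamma (1 - α)| * m₃, fun p => ?_⟩
  rw [adjointOp_eq _ _ _ (hφ.differentiable (by simp))]
  have h3 : |fracInt α (dt φ) p| ≤ m₃ := by
    rw [← Real.norm_eq_abs]
    exact (norm_integral_le_integral_norm _).trans (hm₃ p)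
  calc _ ≤ |-dt φ p| + |a * dx φ p| + |ε / Real.Gamma (1 - α) * fracInt α (dt φ) p| :=
        (abs_sub _ _).trans (add_le_add_left (abs_sub _ _) _)
    _ ≤ _ := by
        rw [abs_neg, abs_mul, abs_mul]
        gcongr
        · exact hm₁ p
        · exact hm₂ p

theorem exists_time_bound {φ : ℝ × ℝ → ℝ} (hs : HasCompactSupport φ) :
    ∃ T : ℝ, 0 < T ∧ ∀ p, φ p ≠ 0 → |p.1| ≤ T ∧ |p.2| ≤ T := by
  obtain ⟨T, hT0, hT⟩ := hs.isCompact.isBounded.subset_closedBall_lt 0 0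
  refine ⟨T, hT0, fun p hp => ?_⟩
  have := hT (subset_tsupport φ hp)
  rw [mem_closedBall_zero_iff] at this
  exact ⟨(norm_fst_le p).trans this, (norm_snd_le p).trans this⟩

theorem adjointOp_zero (α a ε : ℝ) (p : ℝ × ℝ) : adjointOp α a ε (fun _ => 0) p = 0 := by
  simp [adjointOp, caputoAdjoint]

theorem adjointOp_eq_zero_of_lt (α a ε : ℝ) {φ : ℝ × ℝ → ℝ} {T : ℝ}
    (hT : ∀ p, φ p ≠ 0 → |p.1| ≤ T ∧ |p.2| ≤ T) {p : ℝ × ℝ} (hp : T < p.2) :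
    adjointOp α a ε φ p = 0 := by
  rw [adjointOp_congr α a ε (ψ := fun _ => 0) (τ := T) (fun q hq => ?_) hp, adjointOp_zero]
  by_contra h
  exact absurd ((le_abs_self _).trans (hT q h).2) (not_le.2 hq)

end FracAdvection

namespace FracAdvection

open Filter Topology Complex

/-! ### The Gamma integral with complex rate -/

theorem integrableOn_rpow_mul_exp {β b : ℝ} (hβ : -1 < β) (hb : 0 < b) :
    IntegrableOn (fun r : ℝ => r ^ β * Real.exp (-b * r)) (Ioi 0) := by
  simpa using integrableOn_rpow_mul_exp_neg_mul_rpow hβ one_pos hb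

theorem integrableOn_rpow_mul_cexp {β : ℝ} (hβ : -1 < β) {s : ℂ} (hs : 0 < s.re) :
    IntegrableOn (fun r : ℝ => ((r ^ β : ℝ) : ℂ) * exp (-s * r)) (Ioi 0) := by
  refine (integrableOn_rpow_mul_exp hβ hs).mono' ?_
    ((ae_restrict_iff' measurableSet_Ioi).2 (ae_of_all _ fun r hr => ?_))
  · exact Measurable.aestronglyMeasurable (by fun_prop)
  · rw [norm_mul, norm_real, norm_exp, Real.norm_of_nonneg (Real.rpow_nonneg (le_of_lt hr) _)]
    simp

/-- Both sides are holomorphic on Re s > 0 and agree for real s by the Gamma integral, so the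
identity theorem applies. -/
theorem integral_rpow_mul_cexp {α : ℝ} (h1 : α < 1) {s : ℂ} (hs : 0 < s.re) :
    ∫ r in Ioi (0 : ℝ), ((r ^ (-α) : ℝ) : ℂ) * exp (-s * r)
      = Real.Gamma (1 - α) * s ^ ((α : ℂ) - 1) := by
  have hU : IsOpen {s : ℂ | 0 < s.re} := isOpen_lt continuous_const continuous_re
  have hd : DifferentiableOn ℂ
      (fun s : ℂ => ∫ r in Ioi (0 : ℝ), ((r ^ (-α) : ℝ) : ℂ) * exp (-s * r)) {s : ℂ | 0 < s.re} := by
    intro z hz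
    have hz' : 0 < z.re := hz
    refine DifferentiableAt.differentiableWithinAt ?_
    have hnear : ∀ᶠ w in 𝓝 z, z.re / 2 < w.re :=
      (isOpen_lt continuous_const continuous_re).mem_nhds (by simpa using half_lt_self hz')
    refine (hasDerivAt_integral_of_dominated_loc_of_deriv_le (μ := volume.restrict (Ioi (0 : ℝ)))
      (F := fun s r => ((r ^ (-α) : ℝ) : ℂ) * exp (-s * r))
      (F' := fun s r => ((r ^ (-α) : ℝ) : ℂ) * (exp (-s * r) * (-r : ℂ)))
      (bound := fun r : ℝ => r ^ (1 - α) * Real.exp (-(z.re / 2) * r)) hnear ?_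
      (integrableOn_rpow_mul_cexp (by linarith) hz') ?_ ?_
      (integrableOn_rpow_mul_exp (by linarith) (half_pos hz')) ?_).2.differentiableAt
    · exact Eventually.of_forall fun w => Measurable.aestronglyMeasurable (by fun_prop)
    · exact Measurable.aestronglyMeasurable (by fun_prop)
    · refine (ae_restrict_iff' measurableSet_Ioi).2 (ae_of_all _ fun r hr w hw => ?_)
      have hr' : (0 : ℝ) < r := hr
      rw [norm_mul, norm_mul, norm_neg, norm_real, norm_real, norm_exp,
        Real.norm_of_nonneg (Real.rpow_nonneg hr'.le _), Real.norm_of_nonneg hr'.le,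
        show (1 - α) = 1 + -α by ring, Real.rpow_one_add' hr'.le (by linarith)]
      have : Real.exp (-w * r).re ≤ Real.exp (-(z.re / 2) * r) := by
        rw [Real.exp_le_exp]
        simp only [neg_mul, neg_re, mul_re, ofReal_re, ofReal_im, mul_zero, sub_zero,
          neg_le_neg_iff]
        exact mul_le_mul_of_nonneg_right (le_of_lt hw) hr'.le
      have h0 := Real.rpow_nonneg hr'.le (-α)
      calc _ ≤ r ^ (-α) * (Real.exp (-(z.re / 2) * r) * r) := by gcongr
        _ = _ := by ring
    · refine ae_of_all _ fun r w _ => ?_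
      have : HasDerivAt (fun s : ℂ => -s * r) (-r : ℂ) w := by
        simpa using (hasDerivAt_id w).neg.mul_const (r : ℂ)
      exact this.cexp.const_mul _
  have hd2 : DifferentiableOn ℂ (fun s : ℂ => (Real.Gamma (1 - α) : ℂ) * s ^ ((α : ℂ) - 1))
      {s : ℂ | 0 < s.re} := fun z hz =>
    ((differentiableAt_id.cpow_const (Or.inl hz)).const_mul _).differentiableWithinAt
  have hpre : IsPreconnected {s : ℂ | 0 < s.re} := (convex_halfSpace_re_gt 0).isPreconnected
  have hfreq : ∃ᶠ z in 𝓝[≠] (1 : ℂ),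
      (∫ r in Ioi (0 : ℝ), ((r ^ (-α) : ℝ) : ℂ) * exp (-z * r))
        = Real.Gamma (1 - α) * z ^ ((α : ℂ) - 1) := by
    have ht : Tendsto (fun x : ℝ => (x : ℂ)) (𝓝[≠] 1) (𝓝[≠] (1 : ℂ)) := by
      refine tendsto_nhdsWithin_iff.2 ⟨?_, ?_⟩
      · exact (continuous_ofReal.tendsto' 1 1 (by simp)).mono_left nhdsWithin_le_nhds
      · filter_upwards [self_mem_nhdsWithin] with x hx
        simpa using hx
    refine ht.frequently (Eventually.frequently ?_)
    filter_upwards [nhdsWithin_le_nhds (lt_mem_nhds (zero_lt_one (α := ℝ)))] with x hx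
    have h := Real.integral_rpow_mul_exp_neg_mul_Ioi (a := 1 - α) (by linarith) hx
    have h' := congrArg (fun z : ℝ => (z : ℂ)) h
    rw [← integral_complex_ofReal] at h'
    have e : (1 / x : ℝ) ^ (1 - α) = x ^ (α - 1) := by
      rw [one_div, Real.inv_rpow hx.le, ← Real.rpow_neg hx.le, neg_sub]
    rw [e] at h'
    calc _ = ∫ r in Ioi (0 : ℝ), ((r ^ (1 - α - 1) * Real.exp (-(x * r)) : ℝ) : ℂ) := by
          refine integral_congr_ae (ae_of_all _ fun r => ?_)
          simp only
          push_cast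
          rw [show 1 - α - 1 = -α by ring, neg_mul]
      _ = _ := by
          rw [h', ofReal_mul, ofReal_cpow hx.le]
          push_cast
          ring
  exact (hd.analyticOnNhd hU).eqOn_of_preconnected_of_frequently_eq (hd2.analyticOnNhd hU) hpre
    (by simp : (1 : ℂ) ∈ {s : ℂ | 0 < s.re}) hfreq hs

/-! ### The bilateral Laplace transform in time of a test function -/

/-- `∫ exp (s τ) q(x, τ) dτ`. -/
def timeLaplace (q : ℝ × ℝ → ℝ) (x : ℝ) (s : ℂ) : ℂ := ∫ τ : ℝ, exp (s * τ) * (q (x, τ) : ℂ)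

theorem hasCompactSupport_slice {q : ℝ × ℝ → ℝ} (hs : HasCompactSupport q) (x : ℝ) :
    HasCompactSupport fun τ => q (x, τ) := by
  obtain ⟨T, -, hT⟩ := exists_time_bound hs
  refine HasCompactSupport.of_support_subset_isCompact (isCompact_Icc (a := -T) (b := T)) ?_
  intro τ hτ
  exact abs_le.1 (hT (x, τ) hτ).2

theorem integrable_exp_mul_slice {q : ℝ × ℝ → ℝ} (hq : Continuous q) (hs : HasCompactSupport q)
    (x : ℝ) (s : ℂ) : Integrable fun τ : ℝ => exp (s * τ) * (q (x, τ) : ℂ) := by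
  refine Continuous.integrable_of_hasCompactSupport (by fun_prop) ?_
  refine HasCompactSupport.mul_left ?_
  exact (hasCompactSupport_slice hs x).comp_left (g := fun r : ℝ => (r : ℂ)) ofReal_zero

theorem timeLaplace_dt {q : ℝ × ℝ → ℝ} (hq : ContDiff ℝ ∞ q) (hs : HasCompactSupport q)
    (x : ℝ) (s : ℂ) : timeLaplace (dt q) x s = -s * timeLaplace q x s := by
  have hi1 := integrable_exp_mul_slice hq.continuous hs x s
  have hi2 := integrable_exp_mul_slice (contDiff_dt hq).continuous (hasCompactSupport_dt hs) x s
  have hd : ∀ τ : ℝ, HasDerivAt (fun τ : ℝ => exp (s * τ) * (q (x, τ) : ℂ))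
      (s * (exp (s * τ) * (q (x, τ) : ℂ)) + exp (s * τ) * (dt q (x, τ) : ℂ)) τ := by
    intro τ
    have h1 : HasDerivAt (fun τ : ℝ => s * (τ : ℂ)) s τ := by
      simpa using (ofRealCLM.hasDerivAt (x := τ)).const_mul s
    have h2 := (hasDerivAt_snd (hq.differentiable (by simp)) x τ).ofReal_comp
    exact (h1.cexp.mul h2).congr_deriv (by ring)
  have h := integral_eq_zero_of_hasDerivAt_of_integrable hd ((hi1.const_mul s).add hi2) hi1
  rw [integral_add (hi1.const_mul s) hi2, integral_const_mul] at h
  rw [timeLaplace, timeLaplace]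
  linear_combination h

theorem exists_timeLaplace_bound {q : ℝ × ℝ → ℝ} (hq : Continuous q) (hs : HasCompactSupport q) :
    ∃ C, 0 ≤ C ∧ ∀ (x w : ℝ), ‖timeLaplace q x (1 + w * I)‖ ≤ C := by
  obtain ⟨N, hN⟩ := hs.exists_bound_of_continuous hq
  obtain ⟨T, hT0, hT⟩ := exists_time_bound hs
  have hN0 : 0 ≤ N := (norm_nonneg _).trans (hN 0)
  have hi : Integrable ((Icc (-T) T).indicator fun _ => Real.exp T * N) := by
    rw [integrable_indicator_iff measurableSet_Icc]
    exact Continuous.integrableOn_Icc (by fun_prop)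
  refine ⟨∫ τ, (Icc (-T) T).indicator (fun _ => Real.exp T * N) τ,
    integral_nonneg fun τ => indicator_nonneg (fun _ _ => by positivity) _, fun x w => ?_⟩
  refine norm_integral_le_of_norm_le hi (ae_of_all _ fun τ => ?_)
  by_cases h : q (x, τ) = 0
  · simp only [h, ofReal_zero, mul_zero, norm_zero]
    exact indicator_nonneg (fun _ _ => by positivity) _
  · have hm := abs_le.1 (hT _ h).2
    rw [indicator_of_mem (show τ ∈ Icc (-T) T from hm), norm_mul, norm_exp, norm_real]
    refine mul_le_mul ?_ (hN _) (norm_nonneg _) (Real.exp_pos _).le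
    rw [Real.exp_le_exp]
    simpa using hm.2

theorem timeLaplace_eq_zero {q : ℝ × ℝ → ℝ} {x : ℝ} (h : ∀ τ, q (x, τ) = 0) (s : ℂ) :
    timeLaplace q x s = 0 := by
  simp [timeLaplace, h]

theorem one_le_norm_vertical (w : ℝ) : 1 ≤ ‖(1 + w * I : ℂ)‖ := by
  simpa using abs_re_le_norm (1 + w * I : ℂ)

theorem norm_vertical_sq (w : ℝ) : ‖(1 + w * I : ℂ)‖ ^ 2 = 1 + w ^ 2 := by
  rw [← normSq_eq_norm_sq, normSq_apply]; simp; ring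

/-- Three time derivatives bound |s|³ times the transform, and |s|² = 1 + w² on the line. The spare
factor |s| ≥ 1 is kept to absorb |s^α| later. -/
theorem exists_timeLaplace_decay {q : ℝ × ℝ → ℝ} (hq : ContDiff ℝ ∞ q)
    (hs : HasCompactSupport q) : ∃ C, 0 ≤ C ∧ ∀ (x w : ℝ),
      ‖(1 + w * I : ℂ)‖ * ‖timeLaplace q x (1 + w * I)‖ ≤ C * (1 + w ^ 2)⁻¹ ∧
      ‖timeLaplace q x (1 + w * I)‖ ≤ C * (1 + w ^ 2)⁻¹ := by
  have h1 := contDiff_dt hq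
  have h2 := contDiff_dt h1
  have h3 := contDiff_dt h2
  have s1 := hasCompactSupport_dt hs
  have s2 := hasCompactSupport_dt s1
  have s3 := hasCompactSupport_dt s2
  obtain ⟨C, hC0, hC⟩ := exists_timeLaplace_bound h3.continuous s3
  refine ⟨C, hC0, fun x w => ?_⟩
  have h := hC x w
  rw [timeLaplace_dt h2 s2, timeLaplace_dt h1 s1, timeLaplace_dt hq hs, norm_mul, norm_mul,
    norm_mul, norm_neg] at h
  have hle := one_le_norm_vertical w
  have key : ‖(1 + w * I : ℂ)‖ * ‖timeLaplace q x (1 + w * I)‖ ≤ C * (1 + w ^ 2)⁻¹ := by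
    rw [← div_eq_mul_inv, le_div_iff₀ (by positivity), ← norm_vertical_sq]
    refine le_trans (le_of_eq ?_) h
    ring
  exact ⟨key, le_trans (le_mul_of_one_le_left (norm_nonneg _) hle) key⟩

theorem hasDerivAt_timeLaplace {q : ℝ × ℝ → ℝ} (hq : ContDiff ℝ ∞ q) (hs : HasCompactSupport q)
    (s : ℂ) (x : ℝ) :
    HasDerivAt (fun x => timeLaplace q x s) (timeLaplace (dx q) x s) x := by
  have hq1 := contDiff_dx hq
  have hs1 := hasCompactSupport_dx hs
  obtain ⟨N, hN⟩ := hs1.exists_bound_of_continuous hq1.continuous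
  obtain ⟨T, hT0, hT⟩ := exists_time_bound hs1
  have hN0 : 0 ≤ N := (norm_nonneg _).trans (hN 0)
  have hi : Integrable ((Icc (-T) T).indicator fun τ => Real.exp (s.re * τ) * N) := by
    rw [integrable_indicator_iff measurableSet_Icc]
    exact Continuous.integrableOn_Icc (by fun_prop)
  refine (hasDerivAt_integral_of_dominated_loc_of_deriv_le
      (F := fun x (τ : ℝ) => exp (s * τ) * (q (x, τ) : ℂ))
      (F' := fun x (τ : ℝ) => exp (s * τ) * (dx q (x, τ) : ℂ)) univ_mem
      (Eventually.of_forall fun x => (integrable_exp_mul_slice hq.continuous hs x s).1)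
      (integrable_exp_mul_slice hq.continuous hs x s)
      (integrable_exp_mul_slice hq1.continuous hs1 x s).1 (ae_of_all _ fun τ x _ => ?_) hi
      (ae_of_all _ fun τ x _ => ?_)).2
  · by_cases h : dx q (x, τ) = 0
    · simp only [h, ofReal_zero, mul_zero, norm_zero]
      exact indicator_nonneg (fun _ _ => by positivity) _
    · have hm := abs_le.1 (hT _ h).2
      rw [indicator_of_mem (show τ ∈ Icc (-T) T from hm), norm_mul, norm_exp, norm_real]
      refine mul_le_mul ?_ (hN _) (norm_nonneg _) (Real.exp_pos _).le
      simp
  · exact ((hasDerivAt_fst (hq.differentiable (by simp)) x τ).ofReal_comp).const_mul _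

theorem measurable_timeLaplace {q : ℝ × ℝ → ℝ} (hq : Continuous q) :
    Measurable fun z : ℝ × ℝ => timeLaplace q z.1 (1 + z.2 * I) := by
  have h : Measurable fun z : (ℝ × ℝ) × ℝ =>
      exp ((1 + z.1.2 * I) * z.2) * (q (z.1.1, z.2) : ℂ) := by
    have := hq.measurable
    fun_prop
  exact h.stronglyMeasurable.integral_prod_right.measurable

/-- Fourier inversion for e^τ q(x, τ), evaluated at τ = 0. -/
theorem integral_timeLaplace {q : ℝ × ℝ → ℝ} (hq : ContDiff ℝ ∞ q) (hs : HasCompactSupport q)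
    (x : ℝ) : Integrable (fun w : ℝ => timeLaplace q x (1 + w * I)) ∧
      (1 / (2 * Real.pi) : ℝ) * ∫ w : ℝ, timeLaplace q x (1 + w * I) = q (x, 0) := by
  obtain ⟨C, hC0, hC⟩ := exists_timeLaplace_decay hq hs
  have hi : Integrable (fun w : ℝ => timeLaplace q x (1 + w * I)) := by
    refine (integrable_inv_one_add_sq.const_mul C).mono' ?_ (ae_of_all _ fun w => (hC x w).2)
    have h : Measurable fun w : ℝ => (x, w) := by fun_prop
    exact ((measurable_timeLaplace hq.continuous).comp h).aestronglyMeasurable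
  refine ⟨hi, ?_⟩
  have h1 := integrable_exp_mul_slice hq.continuous hs x 1
  have hqc := hq.continuous
  have h := eq_integral_exp_mul_of_integrable (f := fun τ : ℝ => exp (1 * τ) * (q (x, τ) : ℂ))
    (by fun_prop) h1 hi (fun w => ?_) 0
  · simpa using h.symm
  · refine integral_congr_ae (ae_of_all _ fun τ => ?_)
    simp only
    rw [← mul_assoc, ← exp_add]
    ring_nf

/-- Translating τ by r produces the factor exp(-sr), so Fubini separates the transform of q from a
Gamma integral, which converges because Re s > 0. -/
theorem integral_exp_mul_fracInt {α : ℝ} (h1 : α < 1) {q : ℝ × ℝ → ℝ} (hq : Continuous q)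
    (hs : HasCompactSupport q) (x : ℝ) {s : ℂ} (hre : 0 < s.re) :
    ∫ τ : ℝ, exp (s * τ) * (fracInt α q (x, τ) : ℂ)
      = Real.Gamma (1 - α) * s ^ ((α : ℂ) - 1) * timeLaplace q x s := by
  have hsl := integrable_exp_mul_slice hq hs x s
  have hr : ∀ r τ : ℝ, exp (s * τ) * (((r ^ (-α) : ℝ) : ℂ) * (q (x, τ + r) : ℂ))
      = ((r ^ (-α) : ℝ) : ℂ) * exp (-s * r) * (exp (s * (τ + r : ℝ)) * (q (x, τ + r) : ℂ)) := by
    intro r τ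
    have : exp (s * τ) = exp (-s * r) * exp (s * (τ + r : ℝ)) := by
      rw [← exp_add]; push_cast; ring_nf
    rw [this]; ring
  have hint : Integrable (Function.uncurry fun (τ r : ℝ) =>
      exp (s * τ) * (((r ^ (-α) : ℝ) : ℂ) * (q (x, τ + r) : ℂ)))
      (volume.prod (volume.restrict (Ioi 0))) := by
    have hm : Measurable (Function.uncurry fun (τ r : ℝ) =>
        exp (s * τ) * (((r ^ (-α) : ℝ) : ℂ) * (q (x, τ + r) : ℂ))) := by
      have := hq.measurable
      simp only [Function.uncurry_def]
      fun_prop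
    rw [integrable_prod_iff' hm.aestronglyMeasurable]
    simp only [Function.uncurry_apply_pair, hr]
    refine ⟨ae_of_all _ fun r => (hsl.comp_add_right r).const_mul _, ?_⟩
    simp_rw [norm_mul (_ * _) (_ * _), integral_const_mul]
    have : ∀ r : ℝ, ∫ τ : ℝ, ‖exp (s * (τ + r : ℝ)) * (q (x, τ + r) : ℂ)‖
        = ∫ τ : ℝ, ‖exp (s * τ) * (q (x, τ) : ℂ)‖ := fun r =>
      integral_add_right_eq_self (fun τ : ℝ => ‖exp (s * τ) * (q (x, τ) : ℂ)‖) r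
    simp_rw [this]
    exact (integrableOn_rpow_mul_cexp (by linarith) hre).norm.mul_const _
  calc _ = ∫ τ : ℝ, ∫ r in Ioi (0 : ℝ), exp (s * τ) * (((r ^ (-α) : ℝ) : ℂ) * (q (x, τ + r) : ℂ)) := by
        refine integral_congr_ae (ae_of_all _ fun τ => ?_)
        simp only [fracInt]
        rw [← integral_complex_ofReal, ← integral_const_mul]
        simp
    _ = ∫ r in Ioi (0 : ℝ), ∫ τ : ℝ, exp (s * τ) * (((r ^ (-α) : ℝ) : ℂ) * (q (x, τ + r) : ℂ)) :=
        integral_integral_swap hint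
    _ = ∫ r in Ioi (0 : ℝ), ((r ^ (-α) : ℝ) : ℂ) * exp (-s * r) * timeLaplace q x s := by
        refine integral_congr_ae (ae_of_all _ fun r => ?_)
        simp only [hr]
        rw [integral_const_mul]
        congr 1
        exact integral_add_right_eq_self (fun τ : ℝ => exp (s * τ) * (q (x, τ) : ℂ)) r
    _ = _ := by rw [integral_mul_const, integral_rpow_mul_cexp h1 hre]

/-! ### Characteristic coordinates -/

/-- Time measured along the characteristics `t - x / a = τ`. -/
def shear (a : ℝ) (p : ℝ × ℝ) : ℝ × ℝ := (p.1, p.1 / a + p.2)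

theorem contDiff_shear (a : ℝ) : ContDiff ℝ ∞ (shear a) := by
  unfold shear
  fun_prop

/-- `shear a` as a homeomorphism. -/
def shearHomeomorph (a : ℝ) : ℝ × ℝ ≃ₜ ℝ × ℝ where
  toFun := shear a
  invFun p := (p.1, p.2 - p.1 / a)
  left_inv p := by simp [shear]
  right_inv p := by simp [shear]
  continuous_toFun := (contDiff_shear a).continuous
  continuous_invFun := by fun_prop

theorem measurePreserving_shear (a : ℝ) : MeasurePreserving (shear a) := by
  refine (MeasurePreserving.id (volume : Measure ℝ)).skew_product
    (g := fun x τ => x / a + τ) ?_ (ae_of_all _ fun x => ?_)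
  · simp only [Function.uncurry_def]
    fun_prop
  · exact (measurePreserving_add_left volume (x / a)).map_eq

theorem measurableEmbedding_shear (a : ℝ) : MeasurableEmbedding (shear a) :=
  (shearHomeomorph a).measurableEmbedding

theorem integral_comp_shear (a : ℝ) (f : ℝ × ℝ → ℝ) :
    ∫ p, f (shear a p) = ∫ p, f p :=
  (measurePreserving_shear a).integral_comp (measurableEmbedding_shear a) f

theorem integrable_comp_shear (a : ℝ) (f : ℝ × ℝ → ℝ) :
    Integrable (fun p => f (shear a p)) ↔ Integrable f :=
  (measurePreserving_shear a).integrable_comp_emb (measurableEmbedding_shear a)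

theorem dt_comp_shear (a : ℝ) {φ : ℝ × ℝ → ℝ} (hφ : ContDiff ℝ ∞ φ) (p : ℝ × ℝ) :
    dt (φ ∘ shear a) p = dt φ (shear a p) := by
  have h1 := hasDerivAt_snd ((hφ.comp (contDiff_shear a)).differentiable (by simp)) p.1 p.2
  have h2 := (hasDerivAt_snd (hφ.differentiable (by simp)) p.1 (p.1 / a + p.2)).comp p.2
    ((hasDerivAt_id p.2).const_add (p.1 / a))
  rw [mul_one] at h2
  exact h1.unique h2

theorem dx_comp_shear (a : ℝ) {φ : ℝ × ℝ → ℝ} (hφ : ContDiff ℝ ∞ φ) (p : ℝ × ℝ) :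
    dx (φ ∘ shear a) p = dx φ (shear a p) + a⁻¹ * dt φ (shear a p) := by
  have h1 := hasDerivAt_fst ((hφ.comp (contDiff_shear a)).differentiable (by simp)) p.1 p.2
  have h2 : HasDerivAt (fun x : ℝ => (x, x / a + p.2)) ((1 : ℝ), a⁻¹) p.1 := by
    refine (hasDerivAt_id p.1).prodMk ?_
    simpa using ((hasDerivAt_id p.1).div_const a).add_const p.2
  have h3 := ((hφ.differentiable (by simp)) (shear a p)).hasFDerivAt.comp_hasDerivAt p.1 h2
  rw [h1.unique h3, dx, dt, ← smul_eq_mul, ← map_smul, ← map_add]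
  simp

/-- The shear straightens the characteristics, so the transport part loses its time derivative; the
fractional part shifts time only and commutes with the shear. -/
theorem adjointOp_shear {α a ε : ℝ} (ha : 0 < a) {φ : ℝ × ℝ → ℝ} (hφ : ContDiff ℝ ∞ φ)
    (p : ℝ × ℝ) : adjointOp α a ε φ (shear a p) = -a * dx (φ ∘ shear a) p
      - ε / Real.Gamma (1 - α) * fracInt α (dt (φ ∘ shear a)) p := by
  have h : fracInt α (dt (φ ∘ shear a)) p = fracInt α (dt φ) (shear a p) := by
    simp only [fracInt, dt_comp_shear a hφ]
    refine integral_congr_ae (ae_of_all _ fun r => ?_)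
    simp [shear, add_assoc]
  rw [adjointOp_eq _ _ _ (hφ.differentiable (by simp)), h, dx_comp_shear a hφ]
  field_simp
  ring

/-! ### The fundamental solution -/

/-- Meant for the fractional terms: they are bounded and vanish at late times but have no compact
support, so it is exp(Re s τ) that gives convergence at -∞. -/
theorem integrable_exp_mul_of_bounded {f : ℝ → ℝ} (hf : Measurable f) {m T : ℝ}
    (hm : ∀ τ, |f τ| ≤ m) (hT : ∀ τ, T < τ → f τ = 0) {s : ℂ} (hs : 0 < s.re) :
    Integrable fun τ : ℝ => exp (s * τ) * (f τ : ℂ) := by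
  have hi : Integrable ((Iic T).indicator fun τ => Real.exp (s.re * τ) * m) := by
    rw [integrable_indicator_iff measurableSet_Iic]
    exact (integrableOn_exp_mul_Iic hs T).mul_const m
  refine hi.mono' (Measurable.aestronglyMeasurable (by fun_prop)) (ae_of_all _ fun τ => ?_)
  have hm0 : 0 ≤ m := (abs_nonneg _).trans (hm 0)
  rcases le_or_gt τ T with h | h
  · rw [indicator_of_mem (mem_Iic.2 h), norm_mul, norm_exp, norm_real]
    refine mul_le_mul ?_ (hm τ) (norm_nonneg _) (Real.exp_pos _).le
    simp
  · simp only [hT τ h, ofReal_zero, mul_zero, norm_zero]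
    exact indicator_nonneg (fun _ _ => by positivity) _

/-- The transform in time of the adjoint operator in characteristic coordinates. -/
def adjointSymbol (α a ε : ℝ) (Φ : ℝ × ℝ → ℝ) (x w : ℝ) : ℂ :=
  -a * timeLaplace (dx Φ) x (1 + w * I)
    + ε * (1 + w * I : ℂ) ^ (α : ℂ) * timeLaplace Φ x (1 + w * I)

theorem integral_exp_mul_adjointOp {α a : ℝ} (ε : ℝ) (h0 : 0 < α) (h1 : α < 1) (ha : 0 < a)
    {φ : ℝ × ℝ → ℝ} (hφ : ContDiff ℝ ∞ φ) (hs : HasCompactSupport φ) (x w : ℝ) :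
    ∫ τ : ℝ, exp ((1 + w * I : ℂ) * τ) * (adjointOp α a ε φ (shear a (x, τ)) : ℂ)
      = adjointSymbol α a ε (φ ∘ shear a) x w := by
  have hΦ : ContDiff ℝ ∞ (φ ∘ shear a) := hφ.comp (contDiff_shear a)
  have hsΦ : HasCompactSupport (φ ∘ shear a) := hs.comp_homeomorph (shearHomeomorph a)
  set Φ := φ ∘ shear a
  have hre : 0 < (1 + w * I : ℂ).re := by simp
  have hi1 := integrable_exp_mul_slice (contDiff_dx hΦ).continuous (hasCompactSupport_dx hsΦ) x
    (1 + w * I)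
  obtain ⟨m, -, hm⟩ := exists_fracInt_bound h0 h1 (contDiff_dt hΦ).continuous
    (hasCompactSupport_dt hsΦ)
  obtain ⟨T, hT0, hT⟩ := exists_time_bound (hasCompactSupport_dt hsΦ)
  have hmeas : Measurable fun τ : ℝ => fracInt α (dt Φ) (x, τ) := by
    have h : Measurable fun t : ℝ => (x, t) := by fun_prop
    exact (measurable_fracInt α (contDiff_dt hΦ).continuous).comp h
  have hi2 : Integrable fun τ : ℝ => exp ((1 + w * I : ℂ) * τ) * (fracInt α (dt Φ) (x, τ) : ℂ) := by
    refine integrable_exp_mul_of_bounded hmeas (m := m) (T := T) (fun τ => ?_) (fun τ hτ => ?_) hre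
    · rw [← Real.norm_eq_abs]
      exact (norm_integral_le_integral_norm _).trans (hm (x, τ))
    · refine setIntegral_eq_zero_of_forall_eq_zero fun r hr => ?_
      have : dt Φ ((x, τ) + (0, r)) = 0 := by
        by_contra h
        have h2 := (le_abs_self _).trans (hT _ h).2
        have hr' : (0 : ℝ) < r := hr
        simp only [Prod.snd_add] at h2
        linarith
      rw [this, mul_zero]
  have hG : (Real.Gamma (1 - α) : ℂ) ≠ 0 := by
    exact_mod_cast (Real.Gamma_pos_of_pos (by linarith)).ne'
  -- The fractional integral contributes s^(α-1) and the time derivative -s; together they form the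
  -- symbol s^α.
  have hcp : (1 + w * I : ℂ) ^ ((α : ℂ) - 1) * (1 + w * I) = (1 + w * I : ℂ) ^ (α : ℂ) := by
    have hne : (1 + w * I : ℂ) ≠ 0 := fun h => by simp [h] at hre
    rw [cpow_sub _ _ hne, cpow_one, div_mul_cancel₀ _ hne]
  calc _ = ∫ τ : ℝ, (-a * (exp ((1 + w * I : ℂ) * τ) * (dx Φ (x, τ) : ℂ))
        - ε / Real.Gamma (1 - α) * (exp ((1 + w * I : ℂ) * τ) * (fracInt α (dt Φ) (x, τ) : ℂ))) := by
        refine integral_congr_ae (ae_of_all _ fun τ => ?_)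
        simp only [adjointOp_shear ha hφ]
        push_cast
        ring
    _ = _ := by
        rw [integral_sub (hi1.const_mul _) (hi2.const_mul _), integral_const_mul,
          integral_const_mul, integral_exp_mul_fracInt h1 (contDiff_dt hΦ).continuous
          (hasCompactSupport_dt hsΦ) x hre, timeLaplace_dt hΦ hsΦ, adjointSymbol, ← hcp]
        simp only [timeLaplace]
        field_simp
        ring

/-- Replace the kernel by its Bromwich integral on Re s = 1 and exchange; the inner τ-integral is
the transform of the adjoint operator. -/
theorem integral_kernel_mul_adjointOp {α a y : ℝ} (ε : ℝ) (h0 : 0 < α) (h1 : α < 1)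
    (ha : 0 < a) (hy : 0 < y) {φ : ℝ × ℝ → ℝ} (hφ : ContDiff ℝ ∞ φ) (hs : HasCompactSupport φ)
    (x : ℝ) :
    ((∫ τ : ℝ, kernel α y τ * adjointOp α a ε φ (shear a (x, τ)) : ℝ) : ℂ)
      = (1 / (2 * Real.pi) : ℝ) *
        ∫ w : ℝ, symbol α y (1 + w * I) * adjointSymbol α a ε (φ ∘ shear a) x w := by
  obtain ⟨m, hm⟩ := exists_adjointOp_bound a ε h0 h1 hφ hs
  obtain ⟨T, hT0, hT⟩ := exists_time_bound hs
  set Ψ : ℝ → ℝ := fun τ => adjointOp α a ε φ (shear a (x, τ)) with hΨ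
  have hmeas : Measurable Ψ := by
    have h : Measurable fun t : ℝ => shear a (x, t) := by unfold shear; fun_prop
    exact (measurable_adjointOp α a ε hφ).comp h
  have hΨi : Integrable fun τ : ℝ => exp ((1 : ℂ) * τ) * (Ψ τ : ℂ) := by
    refine integrable_exp_mul_of_bounded hmeas (m := m) (T := T - x / a) (fun τ => hm _)
      (fun τ hτ => adjointOp_eq_zero_of_lt α a ε hT ?_) (by simp)
    simp only [shear]
    linarith
  have hsy := integrable_symbol_vertical h0 h1 hy one_pos
  have hint : Integrable (Function.uncurry fun (τ w : ℝ) =>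
      exp ((((1 : ℝ) : ℂ) + w * I) * τ) * symbol α y ((1 : ℝ) + w * I) * (Ψ τ : ℂ)) := by
    refine (hΨi.mul_prod hsy).mono ?_ (ae_of_all _ fun z => ?_)
    · refine Measurable.aestronglyMeasurable ?_
      simp only [Function.uncurry_def, symbol]
      fun_prop
    · simp only [Function.uncurry, norm_mul, norm_exp_vertical_mul]
      rw [norm_exp]
      simp only [one_mul, ofReal_re]
      apply le_of_eq
      ring
  rw [← integral_complex_ofReal]
  calc _ = ∫ τ : ℝ, ((1 / (2 * Real.pi) : ℝ) : ℂ) * ∫ w : ℝ,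
          exp ((((1 : ℝ) : ℂ) + w * I) * τ) * symbol α y ((1 : ℝ) + w * I) * (Ψ τ : ℂ) := by
        refine integral_congr_ae (ae_of_all _ fun τ => ?_)
        simp only
        rw [ofReal_mul, kernel_eq h0 h1 hy one_pos, integral_mul_const, mul_assoc]
    _ = _ := by
        rw [integral_const_mul, integral_integral_swap hint]
        congr 1
        refine integral_congr_ae (ae_of_all _ fun w => ?_)
        simp only
        rw [← integral_exp_mul_adjointOp ε h0 h1 ha hφ hs x w, ← integral_const_mul]
        refine integral_congr_ae (ae_of_all _ fun τ => ?_)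
        simp only [ofReal_one, hΨ]
        ring

theorem norm_symbol_le_one {α y : ℝ} (h0 : 0 < α) (h1 : α < 1) (hy : 0 ≤ y) (w : ℝ) :
    ‖symbol α y (1 + w * I)‖ ≤ 1 := by
  have h := norm_symbol_vertical_le h0 h1 hy one_pos w
  rw [ofReal_one] at h
  refine h.trans (Real.exp_le_one_iff.2 ?_)
  have := (symbolConst_pos h0 h1).le
  rw [neg_mul, neg_nonpos]
  positivity

/-- The decay of exp(-κx s^α) degenerates as x → 0, so only the bound 1 is used for it;
integrability in w comes from the smoothness of the test function, and in x from its support. -/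
theorem integrable_symbol_mul_adjointSymbol {α κ : ℝ} (a ε : ℝ) (h0 : 0 < α) (h1 : α < 1)
    (hκ : 0 ≤ κ) {Φ : ℝ × ℝ → ℝ} (hΦ : ContDiff ℝ ∞ Φ) (hs : HasCompactSupport Φ) :
    Integrable (Function.uncurry fun (x w : ℝ) =>
      symbol α (κ * x) (1 + w * I) * adjointSymbol α a ε Φ x w)
      ((volume.restrict (Ioi 0)).prod volume) := by
  have hdx := contDiff_dx hΦ
  have hsdx := hasCompactSupport_dx hs
  obtain ⟨C₁, hC₁0, hC₁⟩ := exists_timeLaplace_decay hΦ hs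
  obtain ⟨C₂, hC₂0, hC₂⟩ := exists_timeLaplace_decay hdx hsdx
  obtain ⟨T₁, hT₁0, hT₁⟩ := exists_time_bound hs
  obtain ⟨T₂, hT₂0, hT₂⟩ := exists_time_bound hsdx
  set T := max T₁ T₂
  have hi : Integrable ((Iic T).indicator fun _ => |a| * C₂ + |ε| * C₁)
      (volume.restrict (Ioi 0)) := by
    rw [integrable_indicator_iff measurableSet_Iic, IntegrableOn, Measure.restrict_restrict
      measurableSet_Iic, Iic_inter_Ioi]
    exact (continuousOn_const.integrableOn_Icc (a := (0 : ℝ)) (b := T)).mono_set Ioc_subset_Icc_self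
  refine (hi.mul_prod integrable_inv_one_add_sq).mono' ?_ ?_
  · refine Measurable.aestronglyMeasurable ?_
    have m1 := measurable_timeLaplace hdx.continuous
    have m2 := measurable_timeLaplace hΦ.continuous
    simp only [Function.uncurry_def, adjointSymbol, symbol]
    fun_prop
  · have hae : ∀ᵐ z ∂((volume.restrict (Ioi (0 : ℝ))).prod (volume : Measure ℝ)), 0 < z.1 :=
      Measure.quasiMeasurePreserving_fst.ae (ae_restrict_mem measurableSet_Ioi)
    filter_upwards [hae] with ⟨x, w⟩ hx
    simp only at hx
    simp only [Function.uncurry_apply_pair, norm_mul]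
    have hsym := norm_symbol_le_one h0 h1 (mul_nonneg hκ hx.le) w
    rcases le_or_gt x T with h | h
    · rw [indicator_of_mem (mem_Iic.2 h)]
      have hcp : ‖(1 + w * I : ℂ) ^ (α : ℂ)‖ ≤ ‖(1 + w * I : ℂ)‖ := by
        rw [norm_cpow_real]
        exact (Real.rpow_le_rpow_of_exponent_le (one_le_norm_vertical w) h1.le).trans
          (Real.rpow_one _).le
      have hA : ‖adjointSymbol α a ε Φ x w‖ ≤ (|a| * C₂ + |ε| * C₁) * (1 + w ^ 2)⁻¹ := by
        rw [adjointSymbol]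
        refine (norm_add_le _ _).trans ?_
        rw [norm_mul, norm_mul, norm_mul, norm_neg, norm_real, norm_real, Real.norm_eq_abs,
          Real.norm_eq_abs, add_mul, mul_assoc, mul_assoc, mul_assoc]
        refine add_le_add (mul_le_mul_of_nonneg_left (hC₂ x w).2 (abs_nonneg _))
          (mul_le_mul_of_nonneg_left ?_ (abs_nonneg _))
        exact (mul_le_mul_of_nonneg_right hcp (norm_nonneg _)).trans (hC₁ x w).1
      calc _ ≤ 1 * ‖adjointSymbol α a ε Φ x w‖ := by gcongr
        _ ≤ _ := by rw [one_mul]; exact hA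
    · have z1 : ∀ τ, Φ (x, τ) = 0 := fun τ => by
        by_contra hne
        exact absurd ((le_abs_self _).trans (hT₁ _ hne).1)
          (not_le.2 ((le_max_left _ _).trans_lt h))
      have z2 : ∀ τ, dx Φ (x, τ) = 0 := fun τ => by
        by_contra hne
        exact absurd ((le_abs_self _).trans (hT₂ _ hne).1)
          (not_le.2 ((le_max_right _ _).trans_lt h))
      rw [indicator_of_notMem (by simpa using h), zero_mul, adjointSymbol,
        timeLaplace_eq_zero z1, timeLaplace_eq_zero z2]
      simp

/-- The exponential solves a E' + ε s^α E = 0, so the integrand is the x-derivative of -a E(x) times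
the transform of Φ. It vanishes for large x, leaving the boundary term at x = 0, where E = 1. -/
theorem integral_symbol_mul_adjointSymbol {α a ε : ℝ} (ha : 0 < a)
    {Φ : ℝ × ℝ → ℝ} (hΦ : ContDiff ℝ ∞ Φ) (hs : HasCompactSupport Φ) {w : ℝ}
    (hi : IntegrableOn (fun x : ℝ => symbol α (ε / a * x) (1 + w * I) *
      adjointSymbol α a ε Φ x w) (Ioi 0)) :
    ∫ x in Ioi (0 : ℝ), symbol α (ε / a * x) (1 + w * I) * adjointSymbol α a ε Φ x w
      = a * timeLaplace Φ 0 (1 + w * I) := by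
  have hac : (a : ℂ) ≠ 0 := by exact_mod_cast ha.ne'
  obtain ⟨T, hT0, hT⟩ := exists_time_bound hs
  have hd : ∀ x : ℝ, HasDerivAt (fun x : ℝ => symbol α (ε / a * x) (1 + w * I) *
      (-a * timeLaplace Φ x (1 + w * I)))
      (symbol α (ε / a * x) (1 + w * I) * adjointSymbol α a ε Φ x w) x := by
    intro x
    have h1 : HasDerivAt (fun x : ℝ => -((ε / a * x : ℝ) : ℂ) * (1 + w * I : ℂ) ^ (α : ℂ))
        (-((ε / a : ℝ) : ℂ) * (1 + w * I : ℂ) ^ (α : ℂ)) x := by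
      have : HasDerivAt (fun x : ℝ => ε / a * x) (ε / a) x := by
        simpa using (hasDerivAt_id x).const_mul (ε / a)
      exact this.ofReal_comp.neg.mul_const _
    have h2 := (hasDerivAt_timeLaplace hΦ hs (1 + w * I) x).const_mul (-a : ℂ)
    refine (h1.cexp.mul h2).congr_deriv ?_
    simp only [symbol, adjointSymbol]
    push_cast
    field_simp
    ring
  have htop : Tendsto (fun x : ℝ => symbol α (ε / a * x) (1 + w * I) *
      (-a * timeLaplace Φ x (1 + w * I))) atTop (𝓝 0) := by
    refine tendsto_const_nhds.congr' ?_
    filter_upwards [eventually_gt_atTop T] with x hx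
    have z1 : ∀ τ, Φ (x, τ) = 0 := fun τ => by
      by_contra hne
      exact absurd ((le_abs_self _).trans (hT _ hne).1) (not_le.2 hx)
    rw [timeLaplace_eq_zero z1]
    simp
  rw [integral_Ioi_of_hasDerivAt_of_tendsto' (fun x _ => hd x) hi htop]
  simp [symbol]

/-- This is the fundamental solution property in characteristic coordinates, up to the factor a:
integrate in x first for fixed w, then invert the transform at the origin. -/
theorem integral_integral_kernel_mul_adjointOp {α a ε : ℝ} (h0 : 0 < α) (h1 : α < 1)
    (ha : 0 < a) (hε : 0 < ε) {φ : ℝ × ℝ → ℝ} (hφ : ContDiff ℝ ∞ φ)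
    (hs : HasCompactSupport φ) :
    ∫ x in Ioi (0 : ℝ), ∫ τ : ℝ, kernel α (ε * x / a) τ * adjointOp α a ε φ (shear a (x, τ))
      = a * φ 0 := by
  have hΦ : ContDiff ℝ ∞ (φ ∘ shear a) := hφ.comp (contDiff_shear a)
  have hsΦ : HasCompactSupport (φ ∘ shear a) := hs.comp_homeomorph (shearHomeomorph a)
  have hint := integrable_symbol_mul_adjointSymbol a ε h0 h1 (div_pos hε ha).le hΦ hsΦ
  have hfin := (integral_timeLaplace hΦ hsΦ 0).2
  rw [← ofReal_inj, ← integral_complex_ofReal]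
  calc _ = ∫ x in Ioi (0 : ℝ), ((1 / (2 * Real.pi) : ℝ) : ℂ) * ∫ w : ℝ,
          symbol α (ε / a * x) (1 + w * I) * adjointSymbol α a ε (φ ∘ shear a) x w := by
        refine setIntegral_congr_fun measurableSet_Ioi fun x hx => ?_
        have hx' : (0 : ℝ) < x := hx
        rw [show ε * x / a = ε / a * x by ring, integral_kernel_mul_adjointOp ε h0 h1 ha (by positivity) hφ hs]
    _ = ((1 / (2 * Real.pi) : ℝ) : ℂ) * ∫ w : ℝ, a * timeLaplace (φ ∘ shear a) 0 (1 + w * I) := by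
        rw [integral_const_mul, integral_integral_swap hint]
        congr 1
        refine integral_congr_ae ?_
        filter_upwards [hint.prod_left_ae] with w hw
        exact integral_symbol_mul_adjointSymbol ha hΦ hsΦ hw
    _ = _ := by
        rw [integral_const_mul, mul_left_comm, hfin]
        simp [shear, Prod.zero_eq_mk]

end FracAdvection

namespace FracAdvection

open Filter Topology

/-! ### Uniqueness by duality -/

/-- The measure `f μ` is a fundamental solution: it is carried by the cone `0 ≤ x ≤ a t`, and it
solves the equation with right hand side the Dirac mass at the origin. -/
structure IsFundamentalSolution (α a ε : ℝ) (μ : Measure (ℝ × ℝ)) (f : ℝ × ℝ → ℝ) : Prop where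
  integrableOn : ∀ T : ℝ, IntegrableOn f {q | q.2 ≤ T} μ
  support : ∀ q, f q ≠ 0 → 0 ≤ q.1 ∧ q.1 ≤ a * q.2
  integral_adjointOp : ∀ φ : ℝ × ℝ → ℝ, ContDiff ℝ ∞ φ → HasCompactSupport φ →
    ∫ q, f q * adjointOp α a ε φ q ∂μ = φ 0

theorem measurableSet_snd_le (T : ℝ) : MeasurableSet {q : ℝ × ℝ | q.2 ≤ T} :=
  measurableSet_le measurable_snd measurable_const

theorem integrable_mul_of_snd_le {μ : Measure (ℝ × ℝ)} {f ψ : ℝ × ℝ → ℝ} {T m : ℝ}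
    (hf : IntegrableOn f {q | q.2 ≤ T} μ) (hψ : Measurable ψ) (hm : ∀ q, |ψ q| ≤ m)
    (hT : ∀ q : ℝ × ℝ, T < q.2 → ψ q = 0) : Integrable (fun q => f q * ψ q) μ := by
  have h := ((integrable_indicator_iff (measurableSet_snd_le T)).2 hf).mul_bdd (c := m)
    hψ.aestronglyMeasurable (ae_of_all _ hm)
  refine h.congr (ae_of_all _ fun q => ?_)
  simp only
  rcases le_or_gt q.2 T with hq | hq
  · rw [indicator_of_mem (show q ∈ {q : ℝ × ℝ | q.2 ≤ T} from hq)]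
  · simp [hT q hq]

/-- The solution of the adjoint equation with source `ψ`. -/
def dual (μ : Measure (ℝ × ℝ)) (f ψ : ℝ × ℝ → ℝ) (p : ℝ × ℝ) : ℝ := ∫ q, f q * ψ (p + q) ∂μ

/-! ### Solving the adjoint equation with a smooth source -/

namespace IsFundamentalSolution

variable {α a ε : ℝ} {μ : Measure (ℝ × ℝ)} {f : ℝ × ℝ → ℝ}

theorem locallyIntegrable (h : IsFundamentalSolution α a ε μ f) : LocallyIntegrable f μ := by
  intro p
  refine ⟨{q | q.2 ≤ p.2 + 1}, ?_, h.integrableOn _⟩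
  have : {q : ℝ × ℝ | q.2 < p.2 + 1} ∈ 𝓝 p :=
    (isOpen_lt continuous_snd continuous_const).mem_nhds (by simp)
  exact mem_of_superset this fun q (hq : q.2 < p.2 + 1) => hq.le

theorem contDiff_dual (h : IsFundamentalSolution α a ε μ f) {ψ : ℝ × ℝ → ℝ}
    (hψ : ContDiff ℝ ∞ ψ) (hs : HasCompactSupport ψ) : ContDiff ℝ ∞ (dual μ f ψ) := by
  have hs' : HasCompactSupport fun z => ψ (-z) := hs.comp_homeomorph (Homeomorph.neg (ℝ × ℝ))
  -- Up to the reflection p ↦ -p, `dual` is a convolution of f with the reflected ψ, hence smooth.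
  have h1 := hs'.contDiff_convolution_right (ContinuousLinearMap.mul ℝ ℝ) h.locallyIntegrable
    (n := ⊤) (hψ.comp contDiff_neg)
  have h2 := h1.comp contDiff_neg
  convert h2 using 1
  funext p
  simp only [dual, Function.comp_apply, convolution, ContinuousLinearMap.mul_apply', neg_sub,
    sub_neg_eq_add, add_comm p]

theorem integrable_dual (h : IsFundamentalSolution α a ε μ f) {ψ : ℝ × ℝ → ℝ} (hψ : Measurable ψ)
    {m T : ℝ} (hm : ∀ q, |ψ q| ≤ m) (hT : ∀ q : ℝ × ℝ, T < q.2 → ψ q = 0) (p : ℝ × ℝ) :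
    Integrable (fun q => f q * ψ (p + q)) μ := by
  refine integrable_mul_of_snd_le (h.integrableOn (T - p.2)) (by fun_prop) (fun q => hm _)
    (fun q hq => hT _ ?_)
  rw [Prod.snd_add]
  linarith

theorem integrable_dual_of_hasCompactSupport (h : IsFundamentalSolution α a ε μ f)
    {ψ : ℝ × ℝ → ℝ} (hψ : Continuous ψ) (hs : HasCompactSupport ψ) (p : ℝ × ℝ) :
    Integrable (fun q => f q * ψ (p + q)) μ := by
  obtain ⟨m, hm⟩ := hs.exists_bound_of_continuous hψ
  obtain ⟨T, -, hT⟩ := exists_time_bound hs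
  refine h.integrable_dual hψ.measurable hm (T := T) (fun q hq => ?_) p
  by_contra hne
  exact absurd ((le_abs_self _).trans (hT q hne).2) (not_le.2 hq)

/-- Differentiation under the integral along p + sv. For |s| < 1 the translated supports stay in one
set where time is bounded above, on which f is integrable. -/
theorem fderiv_dual (h : IsFundamentalSolution α a ε μ f) {ψ : ℝ × ℝ → ℝ}
    (hψ : ContDiff ℝ ∞ ψ) (hs : HasCompactSupport ψ) (p v : ℝ × ℝ) :
    fderiv ℝ (dual μ f ψ) p v = dual μ f (fun q => fderiv ℝ ψ q v) p := by
  have hd : ContDiff ℝ ∞ fun q => fderiv ℝ ψ q v := (hψ.fderiv_right (by simp)).clm_apply contDiff_const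
  have hsd : HasCompactSupport fun q => fderiv ℝ ψ q v := hs.fderiv_apply ℝ v
  obtain ⟨m, hm⟩ := hsd.exists_bound_of_continuous hd.continuous
  obtain ⟨T, -, hT⟩ := exists_time_bound hsd
  have hm0 : 0 ≤ m := (norm_nonneg _).trans (hm 0)
  have hline : ∀ s : ℝ, HasDerivAt (fun s : ℝ => p + s • v) v s := fun s => by
    simpa using ((hasDerivAt_id s).smul_const v).const_add p
  have h1 : HasDerivAt (fun s : ℝ => dual μ f ψ (p + s • v)) (fderiv ℝ (dual μ f ψ) p v) 0 := by
    have := (((h.contDiff_dual hψ hs).differentiable (by simp)) (p + (0 : ℝ) • v)).hasFDerivAt.comp_hasDerivAt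
      0 (hline 0)
    rw [zero_smul, add_zero] at this
    exact this
  have hi := fun p => h.integrable_dual_of_hasCompactSupport hψ.continuous hs p
  have hi' := fun p => h.integrable_dual_of_hasCompactSupport hd.continuous hsd p
  have h2 := (hasDerivAt_integral_of_dominated_loc_of_deriv_le (μ := μ)
    (F := fun (s : ℝ) q => f q * ψ (p + s • v + q))
    (F' := fun (s : ℝ) q => f q * fderiv ℝ ψ (p + s • v + q) v) (x₀ := 0)
    (bound := fun q => ‖{q : ℝ × ℝ | q.2 ≤ T - p.2 + ‖v‖}.indicator f q‖ * m)
    (Metric.ball_mem_nhds (0 : ℝ) one_pos) (Eventually.of_forall fun s => (hi _).1) (hi _) (hi' _).1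
    (ae_of_all _ fun q s hs => ?_)
    ((((integrable_indicator_iff (measurableSet_snd_le _)).2 (h.integrableOn _)).norm).mul_const m)
    (ae_of_all _ fun q s _ => ?_)).2
  · simpa [dual] using h1.unique h2
  · by_cases hz : fderiv ℝ ψ (p + s • v + q) v = 0
    · rw [hz, mul_zero, norm_zero]
      positivity
    · have hq : q ∈ {q : ℝ × ℝ | q.2 ≤ T - p.2 + ‖v‖} := by
        have h3 := (abs_le.1 (hT _ hz).2).2
        simp only [Prod.snd_add, Prod.smul_snd, smul_eq_mul] at h3
        have h4 : |s * v.2| ≤ 1 * ‖v‖ := by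
          rw [abs_mul]
          refine mul_le_mul ?_ (norm_snd_le v) (abs_nonneg _) zero_le_one
          simpa using (mem_ball_zero_iff.1 hs).le
        change q.2 ≤ T - p.2 + ‖v‖
        linarith [neg_abs_le (s * v.2)]
      rw [indicator_of_mem hq, norm_mul]
      exact mul_le_mul_of_nonneg_left (hm _) (norm_nonneg _)
  · refine HasDerivAt.const_mul _ ?_
    exact ((hψ.differentiable (by simp)) (p + s • v + q)).hasFDerivAt.comp_hasDerivAt s
      ((hline s).add_const q)

/-- Fubini is justified because ∫ |r^(-α) ψ(· + (0, r))| dr is bounded and vanishes at late times,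
which is all that integrability against f requires. -/
theorem fracInt_dual [SFinite μ] (h : IsFundamentalSolution α a ε μ f) (h0 : 0 < α) (h1 : α < 1)
    {ψ : ℝ × ℝ → ℝ} (hψ : Continuous ψ) (hs : HasCompactSupport ψ) (p : ℝ × ℝ) :
    Integrable (fun q => f q * fracInt α ψ (p + q)) μ ∧
      fracInt α (dual μ f ψ) p = dual μ f (fracInt α ψ) p := by
  obtain ⟨m, hi, hm⟩ := exists_fracInt_bound h0 h1 hψ hs
  obtain ⟨T, -, hT⟩ := exists_time_bound hs
  have hfm : AEStronglyMeasurable f μ := h.locallyIntegrable.aestronglyMeasurable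
  have hzero : ∀ (q : ℝ × ℝ) (r : ℝ), 0 < r → T < q.2 → ψ (q + (0, r)) = 0 := by
    intro q r hr hq
    by_contra hne
    have h3 := (abs_le.1 (hT _ hne).2).2
    simp only [Prod.snd_add] at h3
    linarith
  have hA : Measurable fun q => ∫ r in Ioi (0 : ℝ), |r ^ (-α) * ψ (q + (0, r))| := by
    have h3 : Measurable fun z : (ℝ × ℝ) × ℝ => |z.2 ^ (-α) * ψ (z.1 + (0, z.2))| := by
      have := hψ.measurable
      fun_prop
    exact (h3.stronglyMeasurable.integral_prod_right (ν := volume.restrict (Ioi 0))).measurable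
  have hAint := h.integrable_dual hA (m := m) (T := T) (fun q => by
    rw [abs_of_nonneg (integral_nonneg fun r => abs_nonneg _)]
    exact hm q) (fun q hq => setIntegral_eq_zero_of_forall_eq_zero fun r hr => by
      rw [hzero q r hr hq, mul_zero, abs_zero]) p
  have hint : Integrable (Function.uncurry fun (r : ℝ) (q : ℝ × ℝ) =>
      f q * (r ^ (-α) * ψ (p + q + (0, r)))) ((volume.restrict (Ioi 0)).prod μ) := by
    have hmeas : AEStronglyMeasurable (Function.uncurry fun (r : ℝ) (q : ℝ × ℝ) =>
        f q * (r ^ (-α) * ψ (p + q + (0, r)))) ((volume.restrict (Ioi 0)).prod μ) := by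
      refine AEStronglyMeasurable.mul hfm.comp_snd (Measurable.aestronglyMeasurable ?_)
      have := hψ.measurable
      fun_prop
    rw [integrable_prod_iff' hmeas]
    refine ⟨ae_of_all _ fun q => (hi (p + q)).const_mul (f q), ?_⟩
    refine hAint.norm.congr (ae_of_all _ fun q => ?_)
    simp only [Function.uncurry_apply_pair, norm_mul (f q)]
    rw [integral_const_mul, Real.norm_of_nonneg (integral_nonneg fun r => abs_nonneg _)]
    rfl
  have e1 : ∀ q, ∫ r in Ioi (0 : ℝ), f q * (r ^ (-α) * ψ (p + q + (0, r)))
      = f q * fracInt α ψ (p + q) := fun q => by rw [integral_const_mul, fracInt]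
  refine ⟨by simpa only [Function.uncurry_apply_pair, e1] using hint.integral_prod_right, ?_⟩
  have hsw := integral_integral_swap hint
  simp only [e1] at hsw
  rw [dual, ← hsw, fracInt]
  refine integral_congr_ae (ae_of_all _ fun r => ?_)
  simp only [dual]
  rw [← integral_const_mul]
  refine integral_congr_ae (ae_of_all _ fun q => ?_)
  simp only
  rw [add_right_comm]
  ring

/-- The adjoint operator commutes with translations and can be moved inside the integral; what
remains is the fundamental solution tested against q ↦ ψ(q + p), whose value at 0 is ψ(p). -/
theorem adjointOp_dual [SFinite μ] (h : IsFundamentalSolution α a ε μ f) (h0 : 0 < α) (h1 : α < 1)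
    {ψ : ℝ × ℝ → ℝ} (hψ : ContDiff ℝ ∞ ψ) (hs : HasCompactSupport ψ) (p : ℝ × ℝ) :
    adjointOp α a ε (dual μ f ψ) p = ψ p := by
  have hdt : dt (dual μ f ψ) = dual μ f (dt ψ) := funext fun q => h.fderiv_dual hψ hs q _
  have hdx : dx (dual μ f ψ) = dual μ f (dx ψ) := funext fun q => h.fderiv_dual hψ hs q _
  have i1 := h.integrable_dual_of_hasCompactSupport (contDiff_dt hψ).continuous
    (hasCompactSupport_dt hs) p
  have i2 := h.integrable_dual_of_hasCompactSupport (contDiff_dx hψ).continuous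
    (hasCompactSupport_dx hs) p
  obtain ⟨i3, e3⟩ := h.fracInt_dual h0 h1 (contDiff_dt hψ).continuous (hasCompactSupport_dt hs) p
  have hψp : ContDiff ℝ ∞ fun q => ψ (q + p) := hψ.comp (contDiff_id.add contDiff_const)
  have hsp : HasCompactSupport fun q => ψ (q + p) := hs.comp_homeomorph (Homeomorph.addRight p)
  have key := h.integral_adjointOp _ hψp hsp
  rw [zero_add] at key
  rw [adjointOp_eq _ _ _ ((h.contDiff_dual hψ hs).differentiable (by simp)), hdt, hdx, e3, ← key]
  have e : ∀ q, f q * adjointOp α a ε (fun q => ψ (q + p)) q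
      = (-(f q * dt ψ (p + q)) - a * (f q * dx ψ (p + q)))
        - ε / Real.Gamma (1 - α) * (f q * fracInt α (dt ψ) (p + q)) := by
    intro q
    rw [adjointOp_comp_add _ _ _ (hψ.differentiable (by simp)),
      adjointOp_eq _ _ _ (hψ.differentiable (by simp)), add_comm p]
    ring
  have i12 : Integrable (fun q => -(f q * dt ψ (p + q)) - a * (f q * dx ψ (p + q))) μ :=
    i1.neg.sub (i2.const_mul a)
  have i1n : Integrable (fun q => -(f q * dt ψ (p + q))) μ := i1.neg
  simp_rw [e]
  rw [integral_sub i12 (i3.const_mul _),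
    integral_sub i1n (i2.const_mul a), integral_neg, integral_const_mul, integral_const_mul]
  rfl

/-- The adjoint equation has compactly supported solutions, up to modifications at negative
times. -/
theorem exists_adjointOp_eq [SFinite μ] (h : IsFundamentalSolution α a ε μ f) (ha : 0 < a) (h0 : 0 < α)
    (h1 : α < 1) {ψ : ℝ × ℝ → ℝ} (hψ : ContDiff ℝ ∞ ψ) (hs : HasCompactSupport ψ) :
    ∃ φ : ℝ × ℝ → ℝ, ContDiff ℝ ∞ φ ∧ HasCompactSupport φ ∧
      ∀ p : ℝ × ℝ, 0 < p.2 → adjointOp α a ε φ p = ψ p := by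
  -- The cutoff is 1 for t ≥ 0 and 0 for t ≤ -1. Only later times enter the adjoint operator, so it
  -- has no effect where t > 0.
  refine ⟨fun p => Real.smoothTransition (p.2 + 1) * dual μ f ψ p, ?_, ?_, fun p hp => ?_⟩
  · exact ((Real.smoothTransition.contDiff (n := ⊤)).comp (contDiff_snd.add contDiff_const)).mul
      (h.contDiff_dual hψ hs)
  · obtain ⟨T, hT0, hT⟩ := exists_time_bound hs
    refine HasCompactSupport.of_support_subset_isCompact
      (isCompact_closedBall (0 : ℝ × ℝ) (2 * T + 1 + a * (T + 1))) fun p hp => ?_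
    have hp1 : -1 < p.2 := by
      by_contra hc
      exact hp (by simp only [Real.smoothTransition.zero_of_nonpos (by linarith : p.2 + 1 ≤ 0),
        zero_mul])
    -- Some q in the cone has p + q in the support of ψ. As p.2 > -1, this forces 0 ≤ q.2 ≤ T + 1,
    -- hence 0 ≤ q.1 ≤ a(T + 1), which bounds p.
    obtain ⟨q, hq⟩ : ∃ q, f q * ψ (p + q) ≠ 0 := by
      by_contra! hc
      exact hp (by simp [dual, hc])
    obtain ⟨q1, q2⟩ := h.support q (left_ne_zero_of_mul hq)
    obtain ⟨t1, t2⟩ := hT _ (right_ne_zero_of_mul hq)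
    rw [Prod.fst_add, abs_le] at t1
    rw [Prod.snd_add, abs_le] at t2
    have q3 : 0 ≤ q.2 := nonneg_of_mul_nonneg_right (q1.trans q2) ha
    have q4 : a * q.2 ≤ a * (T + 1) := mul_le_mul_of_nonneg_left (by linarith) ha.le
    have q5 : 0 ≤ a * (T + 1) := by positivity
    rw [mem_closedBall_zero_iff, Prod.norm_def, max_le_iff, Real.norm_eq_abs, Real.norm_eq_abs,
      abs_le, abs_le]
    refine ⟨⟨?_, ?_⟩, ?_, ?_⟩ <;> linarith
  · rw [adjointOp_congr α a ε (ψ := dual μ f ψ) (τ := 0) (fun q hq => ?_) hp,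
      h.adjointOp_dual h0 h1 hψ hs]
    rw [Real.smoothTransition.one_of_one_le (by linarith), one_mul]

end IsFundamentalSolution

/-! ### Weak solutions -/

theorem ae_snd_ne_zero : ∀ᵐ p : ℝ × ℝ, p.2 ≠ 0 :=
  Measure.quasiMeasurePreserving_snd.ae (Measure.ae_ne volume 0)

theorem restrict_nonneg_eq_restrict_pos :
    (volume : Measure (ℝ × ℝ)).restrict {p | 0 ≤ p.2} = volume.restrict {p | 0 < p.2} := by
  refine Measure.restrict_congr_set ?_
  filter_upwards [ae_snd_ne_zero] with p hp
  refine propext ⟨fun h => lt_of_le_of_ne h hp.symm, fun h => le_of_lt h⟩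

theorem isWeakSolution_iff {α a ε : ℝ} {g : ℝ → ℝ} {u : ℝ × ℝ → ℝ} :
    IsWeakSolution α a ε g u ↔ LocallyIntegrableOn u {p : ℝ × ℝ | 0 ≤ p.2} ∧
      ∀ φ : ℝ × ℝ → ℝ, ContDiff ℝ ∞ φ → HasCompactSupport φ →
        ∫ p in {p : ℝ × ℝ | 0 < p.2}, u p * adjointOp α a ε φ p
          = ∫ t in Ioi (0 : ℝ), g t * φ (0, t) := Iff.rfl

/-- `u` is the superposition of time translates of the fundamental solution `f μ`, with
weight `g`. -/
def IsSuperposition (μ : Measure (ℝ × ℝ)) (f : ℝ × ℝ → ℝ) (g : ℝ → ℝ) (u : ℝ × ℝ → ℝ) : Prop :=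
  ∀ (T m : ℝ) (ψ : ℝ × ℝ → ℝ), Measurable ψ → (∀ p, |ψ p| ≤ m) →
    (∀ p : ℝ × ℝ, T < p.2 → ψ p = 0) →
    IntegrableOn (fun p => u p * ψ p) {p | 0 < p.2} ∧
    ∫ p in {p : ℝ × ℝ | 0 < p.2}, u p * ψ p
      = ∫ r in Ioi (0 : ℝ), g r * ∫ q, f q * ψ (q + (0, r)) ∂μ

theorem IsFundamentalSolution.isWeakSolution {α a ε : ℝ} {μ : Measure (ℝ × ℝ)} {f : ℝ × ℝ → ℝ}
    (h : IsFundamentalSolution α a ε μ f) (h0 : 0 < α) (h1 : α < 1) {g : ℝ → ℝ} {u : ℝ × ℝ → ℝ}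
    (hu : IsSuperposition μ f g u) : IsWeakSolution α a ε g u := by
  rw [isWeakSolution_iff]
  refine ⟨fun p _ => ?_, fun φ hφ hs => ?_⟩
  · have hmeas : MeasurableSet {q : ℝ × ℝ | q.2 ≤ p.2 + 1} := measurableSet_snd_le _
    refine ⟨{q | q.2 ≤ p.2 + 1} ∩ {q | 0 ≤ q.2}, ?_, ?_⟩
    · refine inter_mem (mem_nhdsWithin_of_mem_nhds ?_) self_mem_nhdsWithin
      have : {q : ℝ × ℝ | q.2 < p.2 + 1} ∈ 𝓝 p :=
        (isOpen_lt continuous_snd continuous_const).mem_nhds (by simp)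
      exact mem_of_superset this fun q (hq : q.2 < p.2 + 1) => hq.le
    -- Local integrability up to t = 0 comes from testing the superposition against the indicator of
    -- a past half plane.
    · have h2 := (hu (p.2 + 1) 1 ({q : ℝ × ℝ | q.2 ≤ p.2 + 1}.indicator fun _ => 1)
        (measurable_const.indicator hmeas) (fun q => ?_) (fun q hq => ?_)).1
      · rw [IntegrableOn, ← Measure.restrict_restrict hmeas, restrict_nonneg_eq_restrict_pos,
          ← IntegrableOn, ← integrable_indicator_iff hmeas]
        refine Integrable.congr h2 (ae_of_all _ fun q => ?_)
        by_cases hq : q ∈ {q : ℝ × ℝ | q.2 ≤ p.2 + 1}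
        · simp only [indicator_of_mem hq, mul_one]
        · simp only [indicator_of_notMem hq, mul_zero]
      · by_cases hq : q ∈ {q : ℝ × ℝ | q.2 ≤ p.2 + 1}
        · simp [indicator_of_mem hq]
        · simp [indicator_of_notMem hq]
      · rw [indicator_of_notMem]
        exact fun hq' : q.2 ≤ p.2 + 1 => absurd hq (not_lt.2 hq')
  · obtain ⟨m, hm⟩ := exists_adjointOp_bound a ε h0 h1 hφ hs
    obtain ⟨T, -, hT⟩ := exists_time_bound hs
    rw [(hu T m _ (measurable_adjointOp α a ε hφ) hm
      (fun p hp => adjointOp_eq_zero_of_lt α a ε hT hp)).2]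
    refine integral_congr_ae (ae_of_all _ fun r => ?_)
    -- The translate by time r pairs with the fundamental solution to give φ(0, r), the weight of
    -- g(r) in the source term.
    have hφr : ContDiff ℝ ∞ fun q => φ (q + (0, r)) := hφ.comp (contDiff_id.add contDiff_const)
    have hsr : HasCompactSupport fun q => φ (q + (0, r)) :=
      hs.comp_homeomorph (Homeomorph.addRight ((0 : ℝ), r))
    have key := h.integral_adjointOp _ hφr hsr
    simp_rw [adjointOp_comp_add α a ε (hφ.differentiable (by simp))] at key
    simp only [key, zero_add]

/-! ### Uniqueness of weak solutions -/

theorem integrableOn_mul_of_hasCompactSupport {u ψ : ℝ × ℝ → ℝ}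
    (hu : LocallyIntegrableOn u {p : ℝ × ℝ | 0 ≤ p.2}) (hψ : Continuous ψ)
    (hs : HasCompactSupport ψ) : IntegrableOn (fun p => u p * ψ p) {p | 0 < p.2} := by
  have hcl : IsClosed {p : ℝ × ℝ | 0 ≤ p.2} := isClosed_le continuous_const continuous_snd
  have hi : IntegrableOn u (tsupport ψ ∩ {p : ℝ × ℝ | 0 ≤ p.2}) :=
    hu.integrableOn_compact_subset inter_subset_right (hs.isCompact.inter_right hcl)
  have hm : MeasurableSet (tsupport ψ) := (isClosed_tsupport ψ).measurableSet
  obtain ⟨m, hb⟩ := hs.exists_bound_of_continuous hψ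
  rw [IntegrableOn, ← Measure.restrict_restrict hm, restrict_nonneg_eq_restrict_pos,
    ← IntegrableOn, ← integrable_indicator_iff hm] at hi
  refine (hi.mul_bdd (c := m) hψ.aestronglyMeasurable (ae_of_all _ hb)).congr
    (ae_of_all _ fun p => ?_)
  by_cases hp : p ∈ tsupport ψ
  · simp only [indicator_of_mem hp]
  · simp only [image_eq_zero_of_notMem_tsupport hp, mul_zero]

/-- Any test function ψ supported in t > 0 equals there the adjoint operator applied to an
admissible φ. Both solutions give φ the same source term, so u - v integrates to zero against ψ. -/
theorem IsFundamentalSolution.ae_eq {α a ε : ℝ} {μ : Measure (ℝ × ℝ)} [SFinite μ]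
    {f : ℝ × ℝ → ℝ} (h : IsFundamentalSolution α a ε μ f) (ha : 0 < a) (h0 : 0 < α) (h1 : α < 1)
    {g : ℝ → ℝ} {u v : ℝ × ℝ → ℝ} (hu : IsWeakSolution α a ε g u)
    (hv : IsWeakSolution α a ε g v) :
    ∀ᵐ p ∂(volume.restrict {p : ℝ × ℝ | 0 < p.2}), u p = v p := by
  rw [isWeakSolution_iff] at hu hv
  have hU : IsOpen {p : ℝ × ℝ | 0 < p.2} := isOpen_lt continuous_const continuous_snd
  have hsub : {p : ℝ × ℝ | 0 < p.2} ⊆ {p | 0 ≤ p.2} := fun p (hp : 0 < p.2) => hp.le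
  have key := hU.ae_eq_zero_of_integral_contDiff_smul_eq_zero (f := u - v) (μ := volume)
    ((hu.1.sub hv.1).mono_set hsub) fun ψ hψ hs ht => ?_
  · rw [ae_restrict_iff' hU.measurableSet]
    filter_upwards [key] with p hp hp' using sub_eq_zero.1 (hp hp')
  · obtain ⟨φ, hφ, hsφ, hadj⟩ := h.exists_adjointOp_eq ha h0 h1 hψ hs
    have hw : ∀ w : ℝ × ℝ → ℝ, ∫ p in {p : ℝ × ℝ | 0 < p.2}, w p * ψ p
        = ∫ p in {p : ℝ × ℝ | 0 < p.2}, w p * adjointOp α a ε φ p := fun w =>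
      setIntegral_congr_fun hU.measurableSet fun p hp => by simp only [hadj p hp]
    have hz : ∀ p, p ∉ {p : ℝ × ℝ | 0 < p.2} → ψ p • (u - v) p = 0 := fun p hp => by
      rw [image_eq_zero_of_notMem_tsupport (fun hc => hp (ht hc)), zero_smul]
    rw [← setIntegral_eq_integral_of_forall_compl_eq_zero hz]
    calc _ = ∫ p in {p : ℝ × ℝ | 0 < p.2}, (u p * ψ p - v p * ψ p) := by
          refine integral_congr_ae (ae_of_all _ fun p => ?_)
          simp only [Pi.sub_apply, smul_eq_mul]
          ring
      _ = 0 := by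
          rw [integral_sub (integrableOn_mul_of_hasCompactSupport hu.1 hψ.continuous hs)
            (integrableOn_mul_of_hasCompactSupport hv.1 hψ.continuous hs), hw, hw,
            hu.2 φ hφ hsφ, hv.2 φ hφ hsφ, sub_self]

/-! ### The fundamental solution for positive `ε` -/

/-- The density of the fundamental solution. -/
def fundamentalDensity (α a ε : ℝ) (p : ℝ × ℝ) : ℝ :=
  if 0 < p.1 ∧ p.1 / a < p.2 then (1 / a) * kernel α (ε * p.1 / a) (p.2 - p.1 / a) else 0

theorem measurable_fundamentalDensity (α a ε : ℝ) : Measurable (fundamentalDensity α a ε) := by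
  refine Measurable.ite ?_ ?_ measurable_const
  · exact (measurableSet_lt measurable_const measurable_fst).inter
      (measurableSet_lt (by fun_prop) measurable_snd)
  · have h : Measurable fun p : ℝ × ℝ => (ε * p.1 / a, p.2 - p.1 / a) := by fun_prop
    exact ((measurable_kernel α).comp h).const_mul _

theorem fundamentalDensity_shear (α a ε x τ : ℝ) :
    fundamentalDensity α a ε (shear a (x, τ))
      = if 0 < x ∧ 0 < τ then (1 / a) * kernel α (ε * x / a) τ else 0 := by
  simp only [fundamentalDensity, shear, add_sub_cancel_left, lt_add_iff_pos_right]

theorem fundamentalDensity_support {α a ε : ℝ} (ha : 0 < a) {q : ℝ × ℝ}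
    (hq : fundamentalDensity α a ε q ≠ 0) : 0 < q.1 ∧ q.1 < a * q.2 := by
  rw [fundamentalDensity] at hq
  have h := (ite_ne_right_iff.1 hq).1
  exact ⟨h.1, (div_lt_iff₀' ha).1 h.2⟩

/-- In characteristic coordinates the past t ≤ T meets the cone inside the box (0, aT] × (0, T],
where the interpolated bound is a product of integrable powers of x and τ. -/
theorem integrableOn_fundamentalDensity {α a ε : ℝ} (h0 : 0 < α) (h1 : α < 1) (ha : 0 < a)
    (hε : 0 < ε) (T : ℝ) :
    IntegrableOn (fundamentalDensity α a ε) {q | q.2 ≤ T} := by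
  obtain ⟨C, hC0, hC⟩ := abs_kernel_le_mul_rpow h0 h1
  rw [← integrable_indicator_iff (measurableSet_snd_le T), ← integrable_comp_shear a]
  have hpow : ∀ β R : ℝ, -1 < β → Integrable ((Ioc (0 : ℝ) R).indicator fun x => x ^ β) := by
    intro β R hβ
    rw [integrable_indicator_iff measurableSet_Ioc]
    rcases le_or_gt 0 R with hR | hR
    · rw [← intervalIntegrable_iff_integrableOn_Ioc_of_le hR]
      exact intervalIntegral.intervalIntegrable_rpow' hβ
    · simp [Ioc_eq_empty (not_lt.mpr hR.le)]
  have hprod := ((hpow (-1 / 2) (a * T) (by norm_num)).mul_prod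
    (hpow (α / 2 - 1) T (by linarith))).const_mul (1 / a * C * (ε / a) ^ (-1 / 2 : ℝ))
  refine hprod.mono' ?_ (ae_of_all _ fun z => ?_)
  · exact (((measurable_fundamentalDensity α a ε).indicator (measurableSet_snd_le T)).comp
      (contDiff_shear a).continuous.measurable).aestronglyMeasurable
  · obtain ⟨x, τ⟩ := z
    have hnn : 0 ≤ 1 / a * C * (ε / a) ^ (-1 / 2 : ℝ) *
        ((Ioc (0 : ℝ) (a * T)).indicator (fun x => x ^ (-1 / 2 : ℝ)) x *
          (Ioc (0 : ℝ) T).indicator (fun x => x ^ (α / 2 - 1)) τ) := by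
      refine mul_nonneg (by positivity) (mul_nonneg ?_ ?_) <;>
      exact indicator_nonneg (fun x hx => Real.rpow_nonneg hx.1.le _) _
    by_cases hT : shear a (x, τ) ∈ {q : ℝ × ℝ | q.2 ≤ T}
    · rw [indicator_of_mem hT, fundamentalDensity_shear]
      have hT' : x / a + τ ≤ T := hT
      split_ifs with hpos
      · obtain ⟨hx, hτ⟩ := hpos
        have hxa : 0 < x / a := div_pos hx ha
        have hx2 : x ≤ a * T := by rw [← div_le_iff₀' ha]; linarith
        simp only
        rw [indicator_of_mem (mem_Ioc.2 ⟨hx, hx2⟩), indicator_of_mem (mem_Ioc.2 ⟨hτ, by linarith⟩),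
          norm_mul, Real.norm_of_nonneg (one_div_pos.2 ha).le, Real.norm_eq_abs]
        calc _ ≤ 1 / a * (C * ((ε * x / a) ^ (-1 / 2 : ℝ) * τ ^ (α / 2 - 1))) := by
              gcongr
              exact hC _ _ (by positivity) hτ
          _ = _ := by
              rw [show ε * x / a = ε / a * x by ring, Real.mul_rpow (by positivity) hx.le]
              ring
      · rw [norm_zero]
        exact hnn
    · rw [indicator_of_notMem hT, norm_zero]
      exact hnn

theorem isFundamentalSolution_fundamentalDensity {α a ε : ℝ} (h0 : 0 < α) (h1 : α < 1)
    (ha : 0 < a) (hε : 0 < ε) :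
    IsFundamentalSolution α a ε volume (fundamentalDensity α a ε) where
  integrableOn := integrableOn_fundamentalDensity h0 h1 ha hε
  support q hq := by
    have := fundamentalDensity_support ha hq
    exact ⟨this.1.le, this.2.le⟩
  integral_adjointOp φ hφ hs := by
    obtain ⟨m, hm⟩ := exists_adjointOp_bound a ε h0 h1 hφ hs
    obtain ⟨T, -, hT⟩ := exists_time_bound hs
    have hi : Integrable fun q => fundamentalDensity α a ε q * adjointOp α a ε φ q :=
      integrable_mul_of_snd_le (integrableOn_fundamentalDensity h0 h1 ha hε T)
        (measurable_adjointOp α a ε hφ) hm (fun q hq => adjointOp_eq_zero_of_lt α a ε hT hq)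
    have key := integral_integral_kernel_mul_adjointOp h0 h1 ha hε hφ hs
    rw [← integral_comp_shear a (fun q => fundamentalDensity α a ε q * adjointOp α a ε φ q)]
    rw [← integrable_comp_shear a] at hi
    rw [Measure.volume_eq_prod] at hi ⊢
    rw [integral_prod _ hi, ← mul_right_inj' ha.ne', ← key, ← integral_const_mul,
      ← integral_indicator measurableSet_Ioi]
    refine integral_congr_ae (ae_of_all _ fun x => ?_)
    simp only [fundamentalDensity_shear]
    by_cases hx : 0 < x
    · rw [indicator_of_mem (mem_Ioi.2 hx), ← integral_const_mul]
      refine integral_congr_ae ?_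
      -- Causality of the kernel reconciles the integral over all τ with the restriction τ > 0 in
      -- the density.
      filter_upwards [Measure.ae_ne volume 0] with τ hτ
      rcases lt_or_gt_of_ne hτ with h | h
      · rw [kernel_eq_zero_of_neg h0 h1 (by positivity) h]
        simp
      · rw [if_pos ⟨hx, h⟩]
        field_simp
    · rw [indicator_of_notMem (by simpa using hx)]
      simp [hx]

/-! ### The closed form as a superposition, for positive ε -/

theorem closedForm_eq_zero_of_nonpos {α a ε : ℝ} (ha : 0 < a) (g : ℝ → ℝ) {p : ℝ × ℝ}
    (hp : p.2 ≤ 0) : closedForm α a ε g p = 0 := by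
  rw [closedForm]
  split_ifs with hx
  · have hb : p.2 - p.1 / a < 0 := by
      have := div_pos hx ha
      linarith
    rw [kernelConv]
    split_ifs with h1 h2
    · exact absurd h2 (not_le.2 hb)
    · rw [mul_zero]
    · rw [Ioc_eq_empty (not_lt.2 hb.le)]
      simp
  · rfl

theorem setIntegral_closedForm_mul {α a ε : ℝ} (ha : 0 < a) (g : ℝ → ℝ) (ψ : ℝ × ℝ → ℝ) :
    ∫ p in {p : ℝ × ℝ | 0 < p.2}, closedForm α a ε g p * ψ p
      = ∫ p, closedForm α a ε g p * ψ p := by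
  refine setIntegral_eq_integral_of_forall_compl_eq_zero fun p hp => ?_
  rw [closedForm_eq_zero_of_nonpos ha g (not_lt.1 hp), zero_mul]

theorem closedForm_eq_integral {α a ε : ℝ} (ha : 0 < a) (hε : 0 < ε) (g : ℝ → ℝ) (p : ℝ × ℝ) :
    closedForm α a ε g p
      = ∫ r in Ioi (0 : ℝ), g r * fundamentalDensity α a ε (p - (0, r)) := by
  rw [closedForm]
  split_ifs with hx
  · have hy : ε * p.1 / a ≠ 0 := by positivity
    set b := p.2 - p.1 / a with hb
    rw [kernelConv, if_neg hy, ← integral_const_mul, ← integral_indicator measurableSet_Ioc,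
      ← integral_indicator measurableSet_Ioi, ← integral_sub_left_eq_self _ volume b]
    refine integral_congr_ae ?_
    -- After the reflection τ = b - r the convolution runs over 0 ≤ r < b; only the null point r = 0
    -- separates this from r > 0.
    filter_upwards [Measure.ae_ne volume 0] with r hr
    rcases lt_or_gt_of_ne hr with h | h
    · rw [indicator_of_notMem, indicator_of_notMem]
      · simpa using h.le
      · simp only [mem_Ioc, not_and, not_le]
        intro _; linarith
    · rw [indicator_of_mem (mem_Ioi.2 h), fundamentalDensity]
      simp only [Prod.fst_sub, Prod.snd_sub, sub_zero]
      by_cases hrb : r < b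
      · rw [indicator_of_mem (by simp only [mem_Ioc]; constructor <;> linarith),
          if_pos ⟨hx, by linarith⟩, sub_sub_cancel, show p.2 - r - p.1 / a = b - r by rw [hb]; ring]
        ring
      · rw [indicator_of_notMem, if_neg, mul_zero]
        · rintro ⟨_, h2⟩
          exact hrb (by linarith)
        · simp only [mem_Ioc, not_and]
          intro h2; linarith
  · simp [fundamentalDensity, hx]

theorem measurePreserving_timeShift :
    MeasurePreserving (fun z : ℝ × (ℝ × ℝ) => (z.1, z.2 - ((0 : ℝ), z.1)))
      ((volume.restrict (Ioi 0)).prod volume) ((volume.restrict (Ioi 0)).prod volume) := by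
  refine (MeasurePreserving.id (volume.restrict (Ioi (0 : ℝ)))).skew_product
    (g := fun r p => p - ((0 : ℝ), r)) ?_ (ae_of_all _ fun r => ?_)
  · simp only [Function.uncurry_def]
    fun_prop
  · exact (measurePreserving_sub_right volume ((0 : ℝ), r)).map_eq

theorem integrableOn_Icc_of_locallyIntegrableOn {g : ℝ → ℝ} (hg : LocallyIntegrableOn g (Ici 0))
    (T : ℝ) : IntegrableOn g (Icc 0 T) :=
  hg.integrableOn_compact_subset Icc_subset_Ici_self isCompact_Icc

/-- Truncated to times at most T, g and f are integrable, and the time shift (r, p) ↦ (r, p - (0,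
r)) preserves the product measure, which justifies Fubini. The truncations are invisible because f
is causal and ψ vanishes after T. -/
theorem isSuperposition_fundamentalDensity {α a ε : ℝ} (h0 : 0 < α) (h1 : α < 1)
    (ha : 0 < a) (hε : 0 < ε) {g : ℝ → ℝ} (hg : LocallyIntegrableOn g (Ici 0)) :
    IsSuperposition volume (fundamentalDensity α a ε) g (closedForm α a ε g) := by
  intro T m ψ hψ hm hT
  set f := fundamentalDensity α a ε with hf
  have hgi : Integrable ((Icc 0 T).indicator g) (volume.restrict (Ioi 0)) :=
    ((integrable_indicator_iff measurableSet_Icc).2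
      (integrableOn_Icc_of_locallyIntegrableOn hg T)).restrict
  have hfi : Integrable ({q : ℝ × ℝ | q.2 ≤ T}.indicator f) :=
    (integrable_indicator_iff (measurableSet_snd_le T)).2
      (integrableOn_fundamentalDensity h0 h1 ha hε T)
  have hG := measurePreserving_timeShift.integrable_comp_of_integrable (hgi.mul_prod hfi)
  have hW : Integrable (Function.uncurry fun (r : ℝ) (p : ℝ × ℝ) => g r * f (p - (0, r)) * ψ p)
      ((volume.restrict (Ioi 0)).prod volume) := by
    refine (hG.mul_bdd (g := fun z => ψ z.2) (c := m)
      (hψ.comp measurable_snd).aestronglyMeasurable (ae_of_all _ fun z => hm _)).congr ?_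
    have hae : ∀ᵐ z ∂((volume.restrict (Ioi (0 : ℝ))).prod (volume : Measure (ℝ × ℝ))), 0 < z.1 :=
      Measure.quasiMeasurePreserving_fst.ae (ae_restrict_mem measurableSet_Ioi)
    filter_upwards [hae] with ⟨r, p⟩ hr
    simp only at hr
    simp only [Function.comp_apply, Function.uncurry_apply_pair]
    by_cases hz : f (p - (0, r)) * ψ p = 0
    · rcases mul_eq_zero.1 hz with h | h
      · rw [h, mul_zero, zero_mul, indicator_apply_eq_zero.2 fun _ => h, mul_zero, zero_mul]
      · rw [h, mul_zero, mul_zero]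
    · have hp : p.2 ≤ T := by
        by_contra hc
        exact hz (by rw [hT p (not_le.1 hc), mul_zero])
      obtain ⟨s1, s2⟩ := fundamentalDensity_support ha (left_ne_zero_of_mul hz)
      have s3 : 0 < (p - (0, r)).2 := (mul_pos_iff_of_pos_left ha).1 (s1.trans s2)
      have s4 : (p - (0, r)).2 = p.2 - r := rfl
      rw [s4] at s3
      rw [indicator_of_mem (mem_Icc.2 ⟨hr.le, by linarith⟩), indicator_of_mem]
      change p.2 - r ≤ T
      linarith
  have hcf : ∀ p, ∫ r in Ioi (0 : ℝ), g r * f (p - (0, r)) * ψ p = closedForm α a ε g p * ψ p :=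
    fun p => by rw [integral_mul_const, closedForm_eq_integral ha hε]
  have hi := hW.integral_prod_right
  have hsw := integral_integral_swap hW
  simp only [Function.uncurry_apply_pair, hcf] at hi hsw
  refine ⟨hi.integrableOn, ?_⟩
  rw [setIntegral_closedForm_mul ha, ← hsw]
  refine integral_congr_ae (ae_of_all _ fun r => ?_)
  simp only [mul_assoc]
  rw [integral_const_mul, ← integral_sub_right_eq_self (fun q => f q * ψ (q + (0, r))) ((0 : ℝ), r)]
  simp only [sub_add_cancel]

/-! ### The fundamental solution for `ε = 0` -/

/-- Lebesgue measure on the characteristic ray, parametrised by `x`. -/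
def rayMeasure (a : ℝ) : Measure (ℝ × ℝ) :=
  (volume.restrict (Ioi 0)).map fun x => shear a (x, 0)

instance (a : ℝ) : SFinite (rayMeasure a) := by
  unfold rayMeasure
  infer_instance

/-- The constant `1 / a` on the cone `0 ≤ x ≤ a t`. -/
def rayDensity (a : ℝ) (q : ℝ × ℝ) : ℝ := if 0 ≤ q.1 ∧ q.1 ≤ a * q.2 then 1 / a else 0

theorem measurable_rayDensity (a : ℝ) : Measurable (rayDensity a) :=
  Measurable.ite ((measurableSet_le measurable_const measurable_fst).inter
    (measurableSet_le measurable_fst (by fun_prop))) measurable_const measurable_const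

theorem integral_rayMeasure {a : ℝ} (ha : 0 < a) {ψ : ℝ × ℝ → ℝ} (hψ : Measurable ψ) :
    ∫ q, rayDensity a q * ψ q ∂(rayMeasure a) = ∫ x in Ioi (0 : ℝ), 1 / a * ψ (shear a (x, 0)) := by
  have hm : Measurable fun x : ℝ => shear a (x, 0) := by unfold shear; fun_prop
  have hm2 : Measurable fun q => rayDensity a q * ψ q := (measurable_rayDensity a).mul hψ
  rw [rayMeasure, integral_map hm.aemeasurable hm2.aestronglyMeasurable]
  refine setIntegral_congr_fun measurableSet_Ioi fun x (hx : 0 < x) => ?_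
  rw [rayDensity, if_pos]
  simp only [shear, add_zero]
  exact ⟨hx.le, by rw [mul_div_cancel₀ _ ha.ne']⟩

/-- On the ray the adjoint operator is -a times the derivative of φ along the ray, so the pairing is
evaluated by the fundamental theorem of calculus. -/
theorem isFundamentalSolution_rayDensity (α : ℝ) {a : ℝ} (ha : 0 < a) :
    IsFundamentalSolution α a 0 (rayMeasure a) (rayDensity a) where
  integrableOn T := by
    have hm : Measurable fun x : ℝ => shear a (x, 0) := by unfold shear; fun_prop
    refine Measure.integrableOn_of_bounded (M := 1 / a) ?_
      (measurable_rayDensity a).aestronglyMeasurable (ae_of_all _ fun q => ?_)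
    · rw [rayMeasure, Measure.map_apply hm (measurableSet_snd_le T), Measure.restrict_apply
        (hm (measurableSet_snd_le T))]
      refine ((measure_mono (t := Icc 0 (a * T)) ?_).trans_lt measure_Icc_lt_top).ne
      rintro x ⟨hx, hx0⟩
      have hx' : x / a + 0 ≤ T := hx
      exact ⟨le_of_lt hx0, by rw [← div_le_iff₀' ha]; linarith⟩
    · rw [rayDensity]
      split_ifs
      · rw [Real.norm_of_nonneg (by positivity)]
      · rw [norm_zero]; positivity
  support q hq := (ite_ne_right_iff.1 hq).1
  integral_adjointOp φ hφ hs := by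
    have hΦ : ContDiff ℝ ∞ (φ ∘ shear a) := hφ.comp (contDiff_shear a)
    have hsΦ : HasCompactSupport (φ ∘ shear a) := hs.comp_homeomorph (shearHomeomorph a)
    rw [integral_rayMeasure ha (measurable_adjointOp α a 0 hφ)]
    have hc1 : ContDiff ℝ 1 fun x => (φ ∘ shear a) (x, 0) :=
      (hΦ.comp (contDiff_id.prodMk contDiff_const)).of_le (by simp)
    have hs1 : HasCompactSupport fun x => (φ ∘ shear a) (x, 0) := by
      obtain ⟨T, -, hT⟩ := exists_time_bound hsΦ
      refine HasCompactSupport.of_support_subset_isCompact (isCompact_Icc (a := -T) (b := T)) ?_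
      exact fun x hx => abs_le.1 (hT (x, 0) hx).1
    have h := HasCompactSupport.integral_Ioi_deriv_eq hc1 hs1 0
    have hd : ∀ x, deriv (fun x => (φ ∘ shear a) (x, 0)) x = dx (φ ∘ shear a) (x, 0) := fun x =>
      (hasDerivAt_fst (hΦ.differentiable (by simp)) x 0).deriv
    simp only [hd] at h
    simp only [adjointOp_shear ha hφ, zero_div, zero_mul, sub_zero]
    have e : ∀ x : ℝ, 1 / a * (-a * dx (φ ∘ shear a) (x, 0)) = -dx (φ ∘ shear a) (x, 0) := by
      intro x
      field_simp
    simp_rw [e]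
    rw [integral_neg, h]
    simp [shear, Prod.zero_eq_mk]

/-- Without memory the solution is a product of a function of x and a function of τ, so the
superposition reduces to Fubini for a product. -/
theorem closedForm_shear_of_eps_zero (α a : ℝ) (g : ℝ → ℝ) (x τ : ℝ) :
    closedForm α a 0 g (shear a (x, τ))
      = (Ioi (0 : ℝ)).indicator (fun _ => 1 / a) x * (Ici (0 : ℝ)).indicator g τ := by
  simp only [closedForm, kernelConv, shear, zero_mul, zero_div, if_true, add_sub_cancel_left,
    indicator_apply, mem_Ioi, mem_Ici]
  split_ifs <;> simp

theorem isSuperposition_rayDensity (α : ℝ) {a : ℝ} (ha : 0 < a) {g : ℝ → ℝ}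
    (hg : LocallyIntegrableOn g (Ici 0)) :
    IsSuperposition (rayMeasure a) (rayDensity a) g (closedForm α a 0 g) := by
  intro T m ψ hψ hm hT
  have hgi : Integrable ((Icc 0 T).indicator g) :=
    (integrable_indicator_iff measurableSet_Icc).2 (integrableOn_Icc_of_locallyIntegrableOn hg T)
  have hxi : Integrable ((Ioc 0 (a * T)).indicator fun _ => 1 / a) := by
    rw [integrable_indicator_iff measurableSet_Ioc]
    exact (continuousOn_const.integrableOn_Icc).mono_set Ioc_subset_Icc_self
  have hsh : Measurable (shear a) := (contDiff_shear a).continuous.measurable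
  have hV : Integrable fun z : ℝ × ℝ => closedForm α a 0 g (shear a z) * ψ (shear a z) := by
    refine ((hxi.mul_prod hgi).mul_bdd (g := fun z => ψ (shear a z)) (c := m)
      (hψ.comp hsh).aestronglyMeasurable (ae_of_all _ fun z => hm _)).congr (ae_of_all _ ?_)
    rintro ⟨x, τ⟩
    simp only [closedForm_shear_of_eps_zero, indicator_apply, mem_Ioc, mem_Icc, mem_Ioi, mem_Ici]
    by_cases hz : T < x / a + τ
    · rw [hT (shear a (x, τ)) hz, mul_zero, mul_zero]
    · by_cases hx : 0 < x
      · by_cases hτ : 0 ≤ τ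
        · have hxa : 0 < x / a := div_pos hx ha
          rw [if_pos ⟨hx, by rw [← div_le_iff₀' ha]; linarith⟩, if_pos ⟨hτ, by linarith⟩, if_pos hx,
            if_pos hτ]
        · simp [hτ]
      · simp [hx]
  refine ⟨((integrable_comp_shear a _).1 hV).integrableOn, ?_⟩
  rw [setIntegral_closedForm_mul ha,
    ← integral_comp_shear a (fun p => closedForm α a 0 g p * ψ p)]
  rw [Measure.volume_eq_prod] at hV ⊢
  rw [integral_prod_symm _ hV, ← integral_Ici_eq_integral_Ioi,
    ← integral_indicator measurableSet_Ici]
  refine integral_congr_ae (ae_of_all _ fun τ => ?_)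
  have hψτ : Measurable fun q : ℝ × ℝ => ψ (q + (0, τ)) := by fun_prop
  simp only [closedForm_shear_of_eps_zero]
  by_cases hτ : τ ∈ Ici (0 : ℝ)
  · rw [indicator_of_mem hτ, indicator_of_mem hτ, integral_rayMeasure ha hψτ,
      ← integral_const_mul, ← integral_indicator measurableSet_Ioi]
    refine integral_congr_ae (ae_of_all _ fun x => ?_)
    by_cases hx : x ∈ Ioi (0 : ℝ)
    · simp only [indicator_of_mem hx, shear, Prod.mk_add_mk, add_zero]
      ring
    · simp only [indicator_of_notMem hx, zero_mul]
  · rw [indicator_of_notMem hτ, indicator_of_notMem hτ]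
    simp

/-! ### Both cases of ε together, and the main theorem -/

theorem exists_fundamentalSolution {α a ε : ℝ} (h0 : 0 < α) (h1 : α < 1) (ha : 0 < a)
    (hε : 0 ≤ ε) : ∃ (μ : Measure (ℝ × ℝ)) (f : ℝ × ℝ → ℝ), SFinite μ ∧
      IsFundamentalSolution α a ε μ f ∧ ∀ g : ℝ → ℝ, LocallyIntegrableOn g (Ici 0) →
        IsSuperposition μ f g (closedForm α a ε g) := by
  rcases hε.eq_or_lt with rfl | hε
  · exact ⟨rayMeasure a, rayDensity a, inferInstance, isFundamentalSolution_rayDensity α ha,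
      fun g hg => isSuperposition_rayDensity α ha hg⟩
  · exact ⟨volume, fundamentalDensity α a ε, inferInstance,
      isFundamentalSolution_fundamentalDensity h0 h1 ha hε,
      fun g hg => isSuperposition_fundamentalDensity h0 h1 ha hε hg⟩

end FracAdvection

end

theorem mainTheorem4 :
    -- the solution: existence, and uniqueness among all weak solutions
    (∀ α a ε : ℝ, 0 < α → α < 1 → 0 < a → 0 ≤ ε →
      ∀ g : ℝ → ℝ, LocallyIntegrableOn g (Ici 0) →
        FracAdvection.IsWeakSolution α a ε g (FracAdvection.closedForm α a ε g) ∧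
        ∀ u : ℝ × ℝ → ℝ, FracAdvection.IsWeakSolution α a ε g u →
          ∀ᵐ p ∂(volume.restrict {p : ℝ × ℝ | 0 < p.2}),
            u p = FracAdvection.closedForm α a ε g p) ∧
    -- the Laplace transform of the kernel
    (∀ α y : ℝ, 0 < α → α < 1 → 0 < y → ∀ s : ℂ, 0 < s.re →
      IntegrableOn (fun t : ℝ => Complex.exp (-s * t) * (FracAdvection.kernel α y t : ℂ))
        (Ioi 0) ∧
      ∫ t in Ioi (0 : ℝ), Complex.exp (-s * t) * (FracAdvection.kernel α y t : ℂ)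
        = Complex.exp (-(y : ℂ) * s ^ (α : ℂ))) ∧
    -- `α = 1/3`
    (∀ y t : ℝ, 0 < y → 0 < t →
      FracAdvection.kernel (1 / 3) y t
        = y / ((3 : ℝ) ^ (1 / 3 : ℝ) * t ^ (4 / 3 : ℝ))
          * FracAdvection.airyAi (y / ((3 : ℝ) ^ (1 / 3 : ℝ) * t ^ (1 / 3 : ℝ)))) ∧
    -- `α = 1/2`
    (∀ y t : ℝ, 0 < y → 0 < t →
      FracAdvection.kernel (1 / 2) y t
        = y / (2 * √Real.pi * t ^ (3 / 2 : ℝ)) * Real.exp (-(y ^ 2) / (4 * t))) := by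
  refine ⟨fun α a ε h0 h1 ha hε g hg => ?_, fun α y h0 h1 hy s hs =>
    FracAdvection.laplace_kernel h0 h1 hy hs, fun y t hy ht => FracAdvection.kernel_one_third hy ht,
    fun y t hy ht => FracAdvection.kernel_one_half hy ht⟩
  obtain ⟨μ, f, hμ, hf, hsup⟩ := FracAdvection.exists_fundamentalSolution h0 h1 ha hε
  have hsol := hf.isWeakSolution h0 h1 (hsup g hg)
  exact ⟨hsol, fun u hu => hf.ae_eq ha h0 h1 hu hsol⟩
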